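/- Let $\mathrm{M}$ be a finite loopless matroid on a ground set $E$ with lattice of flats $\mathcal{L}$, least flat $\hat 0=\varnothing$ and greatest flat $\hat 1=E$, and let $\mathcal{G}\subseteq\mathcal{L}\setminus\{\hat 0\}$ be a building set: for every flat $F\neq\hat 0$ the join map $\prod_{G\in\max\mathcal{G}_{\leqslant F}}[\hat 0,G]\to[\hat 0,F]$ is an isomorphism of posets. Let $\vartriangleleft$ be a total order on $E$. For flats $F\subseteq G$ with $G\setminus F=\{e_1\vartriangleleft\cdots\vartriangleleft e_k\}$, let $C_\vartriangleleft(F,G)$ be the set consisting of $F$ and the flats $\operatorname{cl}(F\cup\{e_1,\dots,e_i\})$, $1\leqslant i\leqslant k$. Assume that $(\mathrm{M},\mathcal{G})$ is $\vartriangleleft$-complete: for every flat $F$ and every $G\in\mathcal{G}$ with $F\subseteq G$, every member of $C_\vartriangleleft(F,G)$ other than $F$ is of the form $F\vee H$ with $H\in\mathcal{G}$, $H\subseteq G$. A set $\mathcal{S}\subseteq\mathcal{G}$ is nested if no antichain of at least two members of $\mathcal{S}$ has its join in $\mathcal{G}$. Let $\mathcal{S}$ be an inclusion-maximal nested subset of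 $\mathcal{G}$. For $G\in\mathcal{S}$ put $J^G=\bigvee\{H\in\mathcal{S}: H\subsetneq G\}$ and $\lambda_{\mathcal{S}}(G)=\min_\vartriangleleft\{e\in E: J^G\vee e=G\}$. If $G$ is not maximal in $\mathcal{S}$, its parent $p(G)$ is the least member of $\mathcal{S}$ strictly containing $G$, and $G$ is a child of $p(G)$. A descent of $\mathcal{S}$ is a non-maximal $G\in\mathcal{S}$ with $\lambda_{\mathcal{S}}(G)\vartriangleright\lambda_{\mathcal{S}}(p(G))$, and $\mathrm{Des}(\mathcal{S})$ is the set of descents. A descent is a bottom descent if it is minimal in $\mathcal{S}$, and a double descent if it is not minimal in $\mathcal{S}$ and all its children are descents. The maximal nested set $\mathcal{S}$ is stable if it has no bottom descents and no double descents. Put $$\Gamma=\{\mathrm{Des}(\mathcal{S}) : \mathcal{S}\ \text{a stable maximal nested set}\},\qquad V=\mathcal{G}\setminus\bigl(C_\vartriangleleft(\hat 0,\hat 1)\cup\{\operatorname{cl}(e):e\in E\}\bigr).$$ Let $\mathrm{H}(\mathrm{M},\mathcal{G})(t)=\sum_k \operatorname{rank}_{\mathbb{Z}}(\mathrm{CH}^k)\,t^k$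 be the Hilbert–Poincaré series of the Chow ring $$\mathrm{CH}(\mathrm{M},\mathcal{G})=\mathbb{Z}[x_G : G\in\mathcal{G}]\Big/\Bigl(\prod_{G\in\mathcal{S}}x_G\ (\mathcal{S}\subseteq\mathcal{G}\text{ not nested}),\ \sum_{G\in\mathcal{G},\,e\in G}x_G\ (e\in E)\Bigr).$$ Theorem. $\Gamma$ is the set of faces of a simplicial complex: it contains $\varnothing$ and is closed under taking subsets. All its faces are subsets of $V$, and if $E\in\mathcal{G}$ then its vertex set is exactly $V$. Moreover, $\mathrm{H}(\mathrm{M},\mathcal{G})(t)$ is a polynomial, and its $\gamma$-vector is the $f$-vector of $\Gamma$: if $d$ is the degree of $\mathrm{H}(\mathrm{M},\mathcal{G})(t)$ and $f_i$ is the number of faces of $\Gamma$ with $i$ elements, then $f_i=0$ for $i>\lfloor d/2\rfloor$ and $$\mathrm{H}(\mathrm{M},\mathcal{G})(t)=\sum_{i=0}^{\lfloor d/2\rfloor} f_i\,t^i(1+t)^{d-2i}.$$ -/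

import Mathlib

noncomputable section

namespace BuiltMatroid

open MvPolynomial

variable {α : Type*}

/-- The join, in the lattice of flats of `M`, of a collection `A` of flats. -/
def join (M : Matroid α) (A : Set (Set α)) : Set α := M.closure (⋃₀ A)

/-- The interval `[0, F]` of the lattice of flats of `M`, ordered by inclusion. -/
abbrev FlatsBelow (M : Matroid α) (F : Set α) : Type _ := {H : Set α // M.IsFlat H ∧ H ⊆ F}

/-- The factors of `F`: the maximal elements among the members of `𝒢` contained in `F`. -/
def factors (𝒢 : Set (Set α)) (F : Set α) : Set (Set α) := {G | Maximal (fun H => H ∈ 𝒢 ∧ H ⊆ F) G}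

/-- `𝒢` is a building set of the lattice of flats of the loopless matroid `M` (whose least flat
is `∅`): it consists of nonempty flats, and for every nonempty flat `F` the join map
`∏ [0, G] → [0, F]`, the product being over the factors `G` of `F`, is an isomorphism of posets. -/
structure IsBuildingSet (M : Matroid α) (𝒢 : Set (Set α)) : Prop where
  isFlat : ∀ G ∈ 𝒢, M.IsFlat G
  nonempty : ∀ G ∈ 𝒢, G.Nonempty
  structural_iso : ∀ F : Set α, M.IsFlat F → F.Nonempty →
    ∃ e : (∀ G : factors 𝒢 F, FlatsBelow M G.1) ≃o FlatsBelow M F,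
      ∀ x : (∀ G : factors 𝒢 F, FlatsBelow M G.1),
        (e x : Set α) = join M (Set.range fun G : factors 𝒢 F => (x G : Set α))

/-- A subset `S` of `𝒢` is nested if no antichain of at least two members of `S` has its join
in `𝒢`. -/
structure IsNested (M : Matroid α) (𝒢 S : Set (Set α)) : Prop where
  subset : S ⊆ 𝒢
  join_notMem : ∀ A ⊆ S, IsAntichain (· ⊆ ·) A → A.Nontrivial → join M A ∉ 𝒢

/-- Maximal nested sets. They contain all the maximal elements of `𝒢`. -/
def IsMaxNested (M : Matroid α) (𝒢 S : Set (Set α)) : Prop :=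
  Maximal (fun T : Set (Set α) => IsNested M 𝒢 T) S

/-- The building set `𝒢_F^G` of the interval `[F, G]` (restriction to `G`, contraction
by `F`). -/
def localBuildingSet (M : Matroid α) (𝒢 : Set (Set α)) (F G : Set α) : Set (Set α) :=
  {K | ∃ H ∈ 𝒢, H ⊆ G ∧ K = join M {F, H}} \ {F}

section Order

variable [LinearOrder α]

/-- The `◁`-chain from `F` to `G`: the flats `F` and `cl (F ∪ {e₁, …, eᵢ})`, where
`e₁ ◁ ⋯ ◁ eₖ` are the elements of `G \ F`. -/
def orderChain (M : Matroid α) (F G : Set α) : Set (Set α) :=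
  insert F {K | ∃ e ∈ G \ F, K = M.closure (F ∪ {x ∈ G \ F | x ≤ e})}

/-- `(M, 𝒢)` is complete with respect to the given total order. -/
def IsComplete (M : Matroid α) (𝒢 : Set (Set α)) : Prop :=
  ∀ F G : Set α, M.IsFlat F → G ∈ 𝒢 → F ⊆ G →
    orderChain M F G ⊆ localBuildingSet M 𝒢 F G ∪ {F}

/-- `J` is the join of the members of `S` strictly below `G`. -/
def joinBelow (M : Matroid α) (S : Set (Set α)) (G : Set α) : Set α := join M {H ∈ S | H ⊂ G}

/-- `e` is the label of `G` in `S`: the least element `e` of the ground set such that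
`J ∨ e = G`, where `J` is the join of the members of `S` strictly below `G`. -/
def IsLabel (M : Matroid α) (S : Set (Set α)) (G : Set α) (e : α) : Prop :=
  IsLeast {a ∈ M.E | M.closure (insert a (joinBelow M S G)) = G} e

/-- `P` is the parent of `G` in `S`: the least member of `S` strictly above `G`. -/
def IsParent (S : Set (Set α)) (G P : Set α) : Prop := IsLeast {H ∈ S | G ⊂ H} P

/-- `G` is a descent of `S`: it has a parent, and its label is strictly larger than that of its
parent. -/
def IsDescent (M : Matroid α) (S : Set (Set α)) (G : Set α) : Prop :=
  G ∈ S ∧ ∃ P, IsParent S G P ∧ ∃ a b, IsLabel M S G a ∧ IsLabel M S P b ∧ b < a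

/-- The descent set of `S`. -/
def descentSet (M : Matroid α) (S : Set (Set α)) : Set (Set α) := {G | IsDescent M S G}

/-- A bottom descent is a descent that is minimal in `S`. -/
def IsBottomDescent (M : Matroid α) (S : Set (Set α)) (G : Set α) : Prop :=
  IsDescent M S G ∧ Minimal (fun H => H ∈ S) G

/-- A double descent is a descent that is not minimal in `S` and all of whose children are
descents. -/
def IsDoubleDescent (M : Matroid α) (S : Set (Set α)) (G : Set α) : Prop :=
  IsDescent M S G ∧ ¬ Minimal (fun H => H ∈ S) G ∧
    ∀ H ∈ S, IsParent S H G → IsDescent M S H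

/-- Stable maximal nested sets: no bottom descent and no double descent. -/
structure IsStable (M : Matroid α) (𝒢 S : Set (Set α)) : Prop where
  isMaxNested : IsMaxNested M 𝒢 S
  no_bottom : ∀ G, ¬ IsBottomDescent M S G
  no_double : ∀ G, ¬ IsDoubleDescent M S G

/-- The family `Γ` of the descent sets of the stable maximal nested sets. -/
def gammaComplex (M : Matroid α) (𝒢 : Set (Set α)) : Set (Set (Set α)) :=
  {D | ∃ S, IsStable M 𝒢 S ∧ D = descentSet M S}

/-- The members of `𝒢` that are neither atoms of the lattice of flats nor members of the
`◁`-chain from the least to the greatest flat. -/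
def gammaVertices (M : Matroid α) (𝒢 : Set (Set α)) : Set (Set α) :=
  𝒢 \ (orderChain M ∅ M.E ∪ {A | ∃ e ∈ M.E, A = M.closure {e}})

end Order

/-- `Δ` is the set of faces of a simplicial complex with vertex set `V`. The empty set is
a face. -/
structure IsSimplicialComplexOn {β : Type*} (V : Set β) (Δ : Set (Set β)) : Prop where
  face_subset : ∀ D ∈ Δ, D ⊆ V
  empty_mem : ∅ ∈ Δ
  down_closed : ∀ D ∈ Δ, ∀ D' ⊆ D, D' ∈ Δ
  singleton_mem : ∀ v ∈ V, {v} ∈ Δ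

/-- `f_i`, the number of faces with `i` elements. -/
def fNumber {β : Type*} (Δ : Set (Set β)) (i : ℕ) : ℕ := {D ∈ Δ | D.Finite ∧ D.ncard = i}.ncard

/-- The ideal of relations of the Feichtner–Yuzvinsky Chow ring: the squarefree monomials of the
non-nested sets, and for every element `e` of the ground set the sum of the variables `x_G` with
`e ∈ G`. -/
def chowIdeal (M : Matroid α) (𝒢 : Set (Set α)) : Ideal (MvPolynomial 𝒢 ℤ) :=
  Ideal.span
    ({p | ∃ S : Finset 𝒢, ¬ IsNested M 𝒢 (Subtype.val '' (S : Set 𝒢)) ∧ p = ∏ G ∈ S, X G} ∪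
     {p | ∃ e ∈ M.E, p = ∑ᶠ G : {G : 𝒢 // e ∈ G.1}, X G.1})

/-- The Chow ring of `(M, 𝒢)`. -/
abbrev ChowRing (M : Matroid α) (𝒢 : Set (Set α)) : Type _ :=
  MvPolynomial 𝒢 ℤ ⧸ chowIdeal M 𝒢

/-- The degree `k` piece of the Chow ring. -/
def chowPiece (M : Matroid α) (𝒢 : Set (Set α)) (k : ℕ) : Submodule ℤ (ChowRing M 𝒢) :=
  (homogeneousSubmodule 𝒢 ℤ k).map (Ideal.Quotient.mkₐ ℤ (chowIdeal M 𝒢)).toLinearMap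

/-- The Hilbert–Poincaré series of the Chow ring: the coefficient of `t ^ k` is the rank of the
degree `k` piece. -/
def chowSeries (M : Matroid α) (𝒢 : Set (Set α)) : PowerSeries ℤ :=
  PowerSeries.mk fun k => (Module.finrank ℤ (chowPiece M 𝒢 k) : ℤ)

/-- `γ`, extended by zero, is the `γ`-vector of the polynomial `h` of degree `d`:
`h = ∑ γ_i t ^ i (1 + t) ^ (d - 2 i)`, the sum being over `0 ≤ i ≤ ⌊d / 2⌋`. -/
def IsGammaVector (h : Polynomial ℤ) (γ : ℕ → ℤ) : Prop :=
  (∀ i, h.natDegree / 2 < i → γ i = 0) ∧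
    h = ∑ i ∈ Finset.range (h.natDegree / 2 + 1),
      Polynomial.C (γ i) * Polynomial.X ^ i * (1 + Polynomial.X) ^ (h.natDegree - 2 * i)

end BuiltMatroid

end

noncomputable section
set_option linter.unusedSectionVars false
namespace BuiltMatroid
open Set

variable {α : Type*} {M : Matroid α} {𝒢 S T A : Set (Set α)} {F G H K P Q J : Set α}

/-! ### Joins of flats. -/

section Flats

/-! Nestedness of `S` amounts to a covering property: a member of `𝒢` contained in the join of some
members of `S` is contained in one of them (`IsNested.exists_subset`, `isNested_of_exists_subset`).
In a maximal nested set, any element of `G` outside the join `J` of the smaller members generates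
`G` over `J`, so the label of `G` is the least element of `G \ J`. The central fact is a unique
filling (`existsUnique_fill`): each nested `T` containing the maximal members of `𝒢` satisfies
`Des(S) ⊆ T ⊆ S` for exactly one maximal nested `S`. It is obtained greedily, by repeatedly adding a
member generated by the least new element of a gap of `T`. Hence a maximal nested set is determined
by its descents.

Completeness provides, for two elements of a gap, a common member of `𝒢` inside the corresponding
step of the order chain. It follows that each member of `S` has at most one child that is not a
descent (`eq_of_not_isDescent`), and that a member of `T` is a descent of the filling as soon as its
label exceeds some new element of its parent in `T` (`isDescent_of_lt`). Filling a subset `D` of the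
descents of a stable set then gives a stable set with descent set exactly `D`, so `Γ` is closed
under subsets; the same criterion finds the vertices.

For the Hilbert series, the Chow ring has as many independent classes as there are exponents `d`
with nested support and `d_G < rk G - rk J_G` on the support, where `J_G` is the join of the support
members strictly below `G`. Sort these exponents by the filling `S` of their support. Following the
unique ascending children cuts `S` into paths, and the rank bound says that the `d_G` members
following `G` on its path have exponent zero. Counting on paths gives a product over `S`: the term
of `G` is the sum of `1` if `G` is not a descent and `t` if `G` has an ascending child. It vanishes
unless `S` is stable, and otherwise equals `t^i (1+t)^(n-2i)` with `i = |Des(S)|` and `n` the rank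
minus the number of maximal members of `𝒢`. Summing over stable `S` gives the theorem.

The rank count has two halves. For the upper bound, a monomial violating the bound is rewritten by
heavier ones, the weight being the sum of the ranks. For the lower bound, pass to the generators
`h_G = ∑ x_{G'}`, over `G' ⊇ G`, in which the relations become `h_a = 0` for atoms and `∏ (h_a -
h_G) = 0` when the `a` have join `G`. A functional that is `1` on the monomials satisfying a strict
Rado type rank condition in each block of `T`, and `0` on the others, kills these relations because
the terms cancel in pairs. One such functional per exponent gives a unitriangular system. -/

lemma isFlat_join (M : Matroid α) (A : Set (Set α)) : M.IsFlat (join M A) := M.isFlat_closure _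

lemma join_mono {B : Set (Set α)} (h : A ⊆ B) : join M A ⊆ join M B :=
  M.closure_subset_closure (sUnion_subset_sUnion h)

lemma subset_join (hA : ∀ a ∈ A, a ⊆ M.E) (hG : G ∈ A) : G ⊆ join M A :=
  (subset_sUnion_of_mem hG).trans (M.subset_closure _ (sUnion_subset hA))

lemma join_subset (hF : M.IsFlat F) (h : ∀ a ∈ A, a ⊆ F) : join M A ⊆ F :=
  (M.closure_subset_closure (sUnion_subset h)).trans hF.closure.subset

lemma closure_subset_of_isFlat (hF : M.IsFlat F) {X : Set α} (h : X ⊆ F) : M.closure X ⊆ F :=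
  (M.closure_subset_closure h).trans hF.closure.subset

lemma isFlat_empty (M : Matroid α) [M.Loopless] : M.IsFlat ∅ := by
  rw [Matroid.isFlat_iff_closure_eq, M.closure_empty, M.loops_eq_empty]

lemma join_empty (M : Matroid α) [M.Loopless] : join M ∅ = ∅ := by
  simp [join, M.closure_empty]

lemma join_singleton (hG : M.IsFlat G) : join M {G} = G := by
  simp [join, hG.closure]

lemma flat_eq_atom [M.Loopless] {x : α} (hF : M.IsFlat F) (hne : F.Nonempty)
    (h : F ⊆ M.closure {x}) : F = M.closure {x} := by
  obtain ⟨y, hy⟩ := hne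
  have hyE : y ∈ M.E := hF.subset_ground hy
  have := (M.isNonloop_of_loopless hyE).closure_eq_of_mem_closure (h hy)
  refine h.antisymm ?_
  rw [← this]
  exact closure_subset_of_isFlat hF (singleton_subset_iff.2 hy)

end Flats

/-! ### Building sets and factors of a flat. -/

namespace IsBuildingSet

variable [M.Loopless] (h : IsBuildingSet M 𝒢)
include h

lemma subset_ground (hG : G ∈ 𝒢) : G ⊆ M.E := (h.isFlat G hG).subset_ground

lemma sUnion_subset_ground (hS : S ⊆ 𝒢) : ∀ a ∈ S, a ⊆ M.E := fun _ ha => h.subset_ground (hS ha)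

lemma finite [M.Finite] : 𝒢.Finite :=
  (M.ground_finite.finite_subsets).subset fun _ hG => h.subset_ground hG

lemma exists_factor [M.Finite] (hG : G ∈ 𝒢) (hF : G ⊆ F) : ∃ K ∈ factors 𝒢 F, G ⊆ K := by
  have hfin : {H | H ∈ 𝒢 ∧ H ⊆ F}.Finite := h.finite.subset fun _ hx => hx.1
  obtain ⟨K, hGK, hK⟩ := hfin.exists_le_maximal (a := G) ⟨hG, hF⟩
  exact ⟨K, hK, hGK⟩

end IsBuildingSet

/-- All three claims are read off the product decomposition by looking at the atom spanned by `x`: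
it has a preimage, the preimage is unique, and comparison of tuples is coordinatewise. -/
lemma IsBuildingSet.factors_aux [M.Loopless] (h : IsBuildingSet M 𝒢) (hF : M.IsFlat F) {x : α}
    (hx : x ∈ F) : (∃ K ∈ factors 𝒢 F, x ∈ K) ∧
      (∀ K ∈ factors 𝒢 F, ∀ L ∈ factors 𝒢 F, x ∈ K → x ∈ L → K = L) ∧
      ∀ A : Set (Set α), (∀ a ∈ A, a ⊆ M.E ∧ ∃ K ∈ factors 𝒢 F, a ⊆ K) → ∀ K ∈ factors 𝒢 F, x ∈ K →
        x ∈ join M A → x ∈ join M {a ∈ A | a ⊆ K} := by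
  classical
  obtain ⟨e, he⟩ := h.structural_iso F hF ⟨x, hx⟩
  have hxE := hF.subset_ground hx
  have hxF : M.closure {x} ⊆ F := closure_subset_of_isFlat hF (singleton_subset_iff.2 hx)
  let a : FlatsBelow M F := ⟨M.closure {x}, M.isFlat_closure _, hxF⟩
  have hbot : ∀ K : Set α, M.IsFlat ∅ ∧ ∅ ⊆ K := fun K => ⟨isFlat_empty M, empty_subset K⟩
  have hsub : ∀ (K : Set α), M.IsFlat K → x ∈ K → M.closure {x} ⊆ K := fun K hK hxK =>
    closure_subset_of_isFlat hK (singleton_subset_iff.2 hxK)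
  have hflat : ∀ K : factors 𝒢 F, M.IsFlat K.1 := fun K => h.isFlat _ K.2.1.1
  -- The tuple with the atom in coordinate `K` and the bottom flat elsewhere. For every factor `K`
  -- containing `x` its join is that atom, so two such factors coincide by injectivity.
  let s : ∀ K : factors 𝒢 F, x ∈ K.1 → (∀ G : factors 𝒢 F, FlatsBelow M G.1) := fun K hK G =>
    if hG : G = K then ⟨M.closure {x}, M.isFlat_closure _, hG ▸ hsub K.1 (hflat K) hK⟩
      else ⟨∅, hbot _⟩
  have hs : ∀ (K : factors 𝒢 F) (hK : x ∈ K.1), e (s K hK) = a := by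
    intro K hK
    apply Subtype.ext
    rw [he]
    have : ⋃₀ (Set.range fun G : factors 𝒢 F => (s K hK G : Set α)) = M.closure {x} := by
      apply subset_antisymm
      · rintro y ⟨_, ⟨G, rfl⟩, hy⟩
        by_cases hG : G = K
        · simpa [s, hG] using hy
        · simp [s, hG] at hy
      · exact fun y hy => ⟨_, ⟨K, rfl⟩, by simpa [s] using hy⟩
    change M.closure _ = M.closure {x}
    rw [this, M.closure_closure]
  refine ⟨?_, ?_, ?_⟩
  · have hy : e (e.symm a) = a := e.apply_symm_apply a
    have hy' := congrArg Subtype.val hy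
    rw [he] at hy'
    by_contra hcon
    push Not at hcon
    have hx0 : x ∈ M.closure {x} := M.mem_closure_self x hxE
    have hall : ∀ K : factors 𝒢 F, ((e.symm a K : FlatsBelow M K.1) : Set α) = ∅ := by
      intro K
      by_contra hne
      have hle : ((e.symm a K : FlatsBelow M K.1) : Set α) ⊆ M.closure {x} := by
        change _ = M.closure {x} at hy'
        rw [← hy']
        refine subset_join ?_ ⟨K, rfl⟩
        rintro _ ⟨L, rfl⟩
        exact (e.symm a L).2.1.subset_ground
      have := flat_eq_atom (e.symm a K).2.1 (nonempty_iff_ne_empty.2 hne) hle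
      exact hcon K.1 K.2 ((e.symm a K).2.2 (this ▸ hx0))
    have : ⋃₀ (Set.range fun G : factors 𝒢 F => ((e.symm a G : FlatsBelow M G.1) : Set α)) = ∅ := by
      apply subset_empty_iff.1
      rintro y ⟨_, ⟨G, rfl⟩, hy⟩
      simp only [hall G] at hy
      exact hy
    rw [join, this, M.closure_empty, M.loops_eq_empty] at hy'
    change ∅ = M.closure {x} at hy'
    rw [← hy'] at hx0
    exact hx0
  · intro K hK L hL hxK hxL
    have h1 : s ⟨K, hK⟩ hxK = s ⟨L, hL⟩ hxL := e.injective ((hs ⟨K, hK⟩ hxK).trans (hs ⟨L, hL⟩ hxL).symm)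
    by_contra hne
    have h2 := congrArg Subtype.val (congrFun h1 ⟨K, hK⟩)
    simp [s, hne] at h2
    have : x ∈ M.closure {x} := M.mem_closure_self x hxE
    rw [h2] at this
    exact this
  · intro A hA K hK hxK hxA
    -- The tuple of the joins taken inside each factor. Its image contains `join M A`, hence the
    -- atom of `x`, and comparing the coordinates at `K` gives the claim.
    let y : ∀ G : factors 𝒢 F, FlatsBelow M G.1 := fun G =>
      ⟨join M {a ∈ A | a ⊆ G.1}, isFlat_join M _, join_subset (hflat G) fun a ha => ha.2⟩
    have h1 : join M A ⊆ (e y : Set α) := by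
      refine join_subset (e y).2.1 fun b hb => ?_
      obtain ⟨L, hL, hbL⟩ := (hA b hb).2
      rw [he]
      refine Subset.trans ?_ (subset_join (A := Set.range fun G : factors 𝒢 F => (y G : Set α)) ?_
        ⟨⟨L, hL⟩, rfl⟩)
      · exact subset_join (A := {a ∈ A | a ⊆ L}) (fun c hc => (hA c hc.1).1) ⟨hb, hbL⟩
      · rintro _ ⟨L, rfl⟩
        exact (y L).2.1.subset_ground
    have h2 : a ≤ e y := closure_subset_of_isFlat (e y).2.1 (singleton_subset_iff.2 (h1 hxA))
    rw [← hs ⟨K, hK⟩ hxK, e.le_iff_le] at h2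
    have h3 := h2 ⟨K, hK⟩
    have h4 : M.closure {x} ⊆ join M {a ∈ A | a ⊆ K} := by
      simpa [s, y] using h3
    exact h4 (M.mem_closure_self x hxE)

namespace IsBuildingSet

variable [M.Loopless] (h : IsBuildingSet M 𝒢)
include h

lemma exists_mem_factor (hF : M.IsFlat F) {x : α} (hx : x ∈ F) : ∃ K ∈ factors 𝒢 F, x ∈ K :=
  (h.factors_aux hF hx).1

lemma factor_unique (hF : M.IsFlat F) {x : α} (hK : K ∈ factors 𝒢 F) (hH : H ∈ factors 𝒢 F)
    (hxK : x ∈ K) (hxH : x ∈ H) : K = H :=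
  (h.factors_aux hF (hK.1.2 hxK)).2.1 K hK H hH hxK hxH

/-- Joins of members of `𝒢` below `F` are computed factor by factor. -/
lemma join_inter_factor [M.Finite] (hF : M.IsFlat F) (hA : A ⊆ 𝒢) (hAF : ∀ a ∈ A, a ⊆ F)
    (hK : K ∈ factors 𝒢 F) : join M A ∩ K ⊆ join M {a ∈ A | a ⊆ K} := fun _ hx =>
  (h.factors_aux hF (hK.1.2 hx.2)).2.2 A
    (fun a ha => ⟨h.subset_ground (hA ha), h.exists_factor (hA ha) (hAF a ha)⟩) K hK hx.2 hx.1

lemma atom_mem {x : α} (hx : x ∈ M.E) : M.closure {x} ∈ 𝒢 := by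
  obtain ⟨K, hK, hxK⟩ := h.exists_mem_factor (M.isFlat_closure {x}) (M.mem_closure_self x hx)
  rw [← flat_eq_atom (h.isFlat _ hK.1.1) ⟨x, hxK⟩ hK.1.2]
  exact hK.1.1

lemma join_pair_mem [M.Finite] (hG : G ∈ 𝒢) (hH : H ∈ 𝒢) (hne : (G ∩ H).Nonempty) :
    join M {G, H} ∈ 𝒢 := by
  obtain ⟨x, hxG, hxH⟩ := hne
  have hE : ∀ a ∈ ({G, H} : Set (Set α)), a ⊆ M.E := by
    rintro a (rfl | rfl)
    exacts [h.subset_ground hG, h.subset_ground hH]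
  have hGF : G ⊆ join M {G, H} := subset_join hE (by simp)
  have hHF : H ⊆ join M {G, H} := subset_join hE (by simp)
  obtain ⟨K, hK, hGK⟩ := h.exists_factor hG hGF
  obtain ⟨L, hL, hHL⟩ := h.exists_factor hH hHF
  obtain rfl := h.factor_unique (isFlat_join M _) hK hL (hGK hxG) (hHL hxH)
  have : join M {G, H} = K := by
    refine subset_antisymm (join_subset (h.isFlat _ hK.1.1) ?_) hK.1.2
    rintro a (rfl | rfl)
    exacts [hGK, hHL]
  rw [this]
  exact hK.1.1

lemma factors_nonempty (hK : K ∈ factors 𝒢 F) : K.Nonempty := h.nonempty _ hK.1.1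

end IsBuildingSet

/-! ### Nested sets. -/

section Nested

variable [M.Finite] [M.Loopless]

/-- A member of `𝒢` below the join of members of a nested set is below one of them. -/
lemma IsNested.exists_subset (h : IsBuildingSet M 𝒢) (hS : IsNested M 𝒢 S) (hA : A ⊆ S)
    (hG : G ∈ 𝒢) (hGA : G ⊆ join M A) : ∃ H ∈ A, G ⊆ H := by
  obtain ⟨K, hK, hGK⟩ := h.exists_factor hG hGA
  have hA𝒢 := hA.trans hS.subset
  have hAE := h.sUnion_subset_ground hA𝒢
  set A' : Set (Set α) := {a ∈ A | a ⊆ K} with hA'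
  have hjoin : join M A' = K := by
    refine subset_antisymm (join_subset (h.isFlat _ hK.1.1) fun a ha => ha.2) ?_
    exact (subset_inter hK.1.2 Subset.rfl).trans
      (h.join_inter_factor (isFlat_join M A) hA𝒢 (fun a ha => subset_join hAE ha) hK)
  have hfin : A'.Finite := h.finite.subset fun a ha => hA𝒢 ha.1
  -- Passing to maximal elements gives an antichain with the same join `K ∈ 𝒢`. Nestedness forces it
  -- to be a single set, which is then `K` itself.
  set B : Set (Set α) := {b | Maximal (· ∈ A') b} with hB
  have hBA : B ⊆ A' := fun b hb => hb.1
  have hBj : join M B = K := by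
    refine subset_antisymm ((join_mono hBA).trans hjoin.subset) ?_
    rw [← hjoin]
    refine join_subset (isFlat_join M B) fun a ha => ?_
    obtain ⟨b, hab, hb⟩ := hfin.exists_le_maximal ha
    exact hab.trans (subset_join (fun c hc => hAE c (hBA hc).1) hb)
  have hanti : IsAntichain (· ⊆ ·) B := fun b hb c hc hne hbc => hne (hb.eq_of_le hc.1 hbc)
  have hsub : ¬ B.Nontrivial := fun hnt =>
    hS.join_notMem B (fun b hb => hA (hBA hb).1) hanti hnt (hBj ▸ hK.1.1)
  rw [not_nontrivial_iff] at hsub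
  obtain hB0 | ⟨b, hb⟩ := hsub.eq_empty_or_singleton
  · obtain ⟨x, hx⟩ := h.factors_nonempty hK
    rw [hB0, join_empty] at hBj
    exact absurd (hBj ▸ hx) (notMem_empty x)
  · have hbB : b ∈ B := hb ▸ mem_singleton b
    rw [hb, join_singleton (h.isFlat _ (hA𝒢 (hBA hbB).1))] at hBj
    exact ⟨b, (hBA hbB).1, hBj ▸ hGK⟩

/-- If an antichain had its join in `𝒢`, one of its members would contain that join and so every
other member. This converse of `IsNested.exists_subset` is the form in which nestedness is checked.
-/
lemma isNested_of_exists_subset (hS : S ⊆ 𝒢) (h𝒢 : IsBuildingSet M 𝒢)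
    (hs : ∀ A ⊆ S, ∀ G ∈ 𝒢, G ⊆ join M A → ∃ H ∈ A, G ⊆ H) : IsNested M 𝒢 S := by
  refine ⟨hS, fun A hA hanti hnt hmem => ?_⟩
  have hAE := h𝒢.sUnion_subset_ground (hA.trans hS)
  obtain ⟨H, hH, hle⟩ := hs A hA _ hmem Subset.rfl
  obtain ⟨K, hK, hne⟩ := hnt.exists_ne H
  exact hanti hK hH hne ((subset_join hAE hK).trans hle)

lemma IsNested.mono (hS : IsNested M 𝒢 S) (hT : T ⊆ S) : IsNested M 𝒢 T :=
  ⟨hT.trans hS.subset, fun A hA => hS.join_notMem A (hA.trans hT)⟩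

lemma IsNested.mem_of_mem_join (h : IsBuildingSet M 𝒢) (hS : IsNested M 𝒢 S) (hA : A ⊆ S) {x : α}
    (hx : x ∈ join M A) : ∃ H ∈ A, x ∈ H := by
  have hxE := (isFlat_join M A).subset_ground hx
  obtain ⟨H, hH, hs⟩ := hS.exists_subset h hA (h.atom_mem hxE)
    (closure_subset_of_isFlat (isFlat_join M A) (singleton_subset_iff.2 hx))
  exact ⟨H, hH, hs (M.mem_closure_self x hxE)⟩

lemma IsNested.subset_or_subset (h : IsBuildingSet M 𝒢) (hS : IsNested M 𝒢 S) (hG : G ∈ S)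
    (hH : H ∈ S) {x : α} (hxG : x ∈ G) (hxH : x ∈ H) : G ⊆ H ∨ H ⊆ G := by
  have hE : ∀ a ∈ ({G, H} : Set (Set α)), a ⊆ M.E := by
    rintro a (rfl | rfl)
    exacts [h.subset_ground (hS.subset hG), h.subset_ground (hS.subset hH)]
  obtain ⟨K, hK, hle⟩ := hS.exists_subset h (A := {G, H}) (by rintro a (rfl | rfl) <;> assumption)
    (h.join_pair_mem (hS.subset hG) (hS.subset hH) ⟨x, hxG, hxH⟩) Subset.rfl
  obtain rfl | rfl := hK
  · exact Or.inr ((subset_join hE (by simp)).trans hle)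
  · exact Or.inl ((subset_join hE (by simp)).trans hle)

lemma mem_joinBelow (h : IsBuildingSet M 𝒢) (hS : IsNested M 𝒢 S) {x : α} :
    x ∈ joinBelow M S G ↔ ∃ Q ∈ S, Q ⊂ G ∧ x ∈ Q := by
  constructor
  · intro hx
    obtain ⟨Q, hQ, hxQ⟩ := hS.mem_of_mem_join h (sep_subset _ _) hx
    exact ⟨Q, hQ.1, hQ.2, hxQ⟩
  · rintro ⟨Q, hQ, hQG, hxQ⟩
    exact subset_join (A := {H ∈ S | H ⊂ G})
      (fun a ha => h.subset_ground (hS.subset ha.1)) ⟨hQ, hQG⟩ hxQ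

lemma joinBelow_subset (hG : M.IsFlat G) : joinBelow M S G ⊆ G :=
  join_subset hG fun _ ha => ha.2.subset

lemma joinBelow_mono (hT : T ⊆ S) : joinBelow M T G ⊆ joinBelow M S G :=
  join_mono fun _ ha => ⟨hT ha.1, ha.2⟩

lemma isFlat_joinBelow : M.IsFlat (joinBelow M S G) := isFlat_join M _

lemma IsNested.exists_notMem_joinBelow (h : IsBuildingSet M 𝒢) (hS : IsNested M 𝒢 S)
    (hG : G ∈ 𝒢) : ∃ x ∈ G, x ∉ joinBelow M S G := by
  by_contra! hcon
  obtain ⟨H, hH, hle⟩ := hS.exists_subset h (sep_subset _ _) hG hcon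
  exact hH.2.not_subset hle

/-- A nested set can be enlarged by a factor of a flat lying between a member and the join of the
members strictly below it. -/
lemma IsNested.insert_factor (h : IsBuildingSet M 𝒢) (hT : IsNested M 𝒢 T) (hP : P ∈ T)
    (hK : M.IsFlat K) (hJK : joinBelow M T P ⊆ K) (hKP : K ⊆ P) (hH : H ∈ factors 𝒢 K) :
    IsNested M 𝒢 (insert H T) := by
  have hsub : insert H T ⊆ 𝒢 := insert_subset hH.1.1 hT.subset
  have hHP : H ⊆ P := hH.1.2.trans hKP
  refine isNested_of_exists_subset hsub h fun A hA G hG hGA => ?_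
  have hAE := h.sUnion_subset_ground (hA.trans hsub)
  -- When `A` has a member of `T` above `P`, the new set `H` is redundant in the join. Otherwise `H`
  -- and the members below `P` are first absorbed into `P`, which reduces to a covering by members
  -- of `T`.
  by_cases hPA : ∃ Q ∈ A, Q ∈ T ∧ P ⊆ Q
  · obtain ⟨Q, hQA, hQT, hPQ⟩ := hPA
    have : G ⊆ join M (A ∩ T) := by
      refine hGA.trans (join_subset (isFlat_join M _) fun a ha => ?_)
      have hE' : ∀ a ∈ A ∩ T, a ⊆ M.E := fun a ha => hAE a ha.1
      obtain rfl | haT := hA ha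
      · exact (hHP.trans hPQ).trans (subset_join hE' ⟨hQA, hQT⟩)
      · exact subset_join hE' ⟨ha, haT⟩
    obtain ⟨L, hL, hGL⟩ := hT.exists_subset h inter_subset_right hG this
    exact ⟨L, hL.1, hGL⟩
  push Not at hPA
  set A₁ : Set (Set α) := {Q ∈ A | Q ∈ T ∧ ¬ Q ⊆ P} with hA₁
  set B : Set (Set α) := insert P A₁ with hB
  have hBT : B ⊆ T := insert_subset hP fun Q hQ => hQ.2.1
  have hBE := h.sUnion_subset_ground (hBT.trans hT.subset)
  have hAB : ∀ a ∈ A, a ⊆ join M B := by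
    intro a ha
    obtain rfl | haT := hA ha
    · exact hHP.trans (subset_join hBE (mem_insert _ _))
    · by_cases haP : a ⊆ P
      · exact haP.trans (subset_join hBE (mem_insert _ _))
      · exact subset_join hBE (mem_insert_of_mem _ ⟨ha, haT, haP⟩)
  obtain ⟨Q, hQ, hGQ⟩ := hT.exists_subset h hBT hG (hGA.trans (join_subset (isFlat_join M B) hAB))
  obtain rfl | hQ := hQ
  swap
  · exact ⟨Q, hQ.1, hGQ⟩
  -- The remaining case is `G ⊆ P`, with `P` now called `Q`. As no member of `A₁` contains it, it is
  -- a full factor of the join, so only the members of `A` inside it contribute to `G`. These lie in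
  -- `K`, whose own factors then separate `H` from the rest.
  have hQf : Q ∈ factors 𝒢 (join M B) := by
    refine ⟨⟨hT.subset hP, subset_join hBE (mem_insert _ _)⟩, fun L hL hQL => ?_⟩
    obtain ⟨N, hN, hLN⟩ := hT.exists_subset h hBT hL.1 hL.2
    obtain rfl | hN := hN
    · exact hLN
    · exact absurd (hQL.trans hLN) (hPA N hN.1 hN.2.1)
  set A₂ : Set (Set α) := {a ∈ A | a ⊆ Q} with hA₂
  have hG2 : G ⊆ join M A₂ := (subset_inter hGA hGQ).trans
    (h.join_inter_factor (isFlat_join M B) (hA.trans hsub) hAB hQf)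
  have hA₂K : ∀ a ∈ A₂, a ⊆ K := by
    rintro a ⟨ha, haQ⟩
    obtain rfl | haT := hA ha
    · exact hH.1.2
    · refine Subset.trans ?_ hJK
      exact subset_join (A := {H ∈ T | H ⊂ Q}) (fun c hc => h.subset_ground (hT.subset hc.1))
        ⟨haT, haQ, hPA a ha haT⟩
  obtain ⟨L, hL, hGL⟩ := h.exists_factor hG (hG2.trans (join_subset hK hA₂K))
  have hA₂𝒢 : A₂ ⊆ 𝒢 := fun a ha => hsub (hA ha.1)
  have hG3 : G ⊆ join M {a ∈ A₂ | a ⊆ L} :=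
    (subset_inter hG2 hGL).trans (h.join_inter_factor hK hA₂𝒢 hA₂K hL)
  by_cases hHA : H ∈ A ∧ L = H
  · exact ⟨H, hHA.1, hHA.2 ▸ hGL⟩
  have : {a ∈ A₂ | a ⊆ L} ⊆ T := by
    rintro a ⟨ha, haL⟩
    obtain rfl | haT := hA ha.1
    · obtain ⟨x, hx⟩ := h.factors_nonempty hH
      exact absurd ⟨ha.1, h.factor_unique hK hL hH (haL hx) hx⟩ hHA
    · exact haT
  obtain ⟨N, hN, hGN⟩ := hT.exists_subset h this hG hG3
  exact ⟨N, hN.1.1, hGN⟩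

lemma IsNested.union_factors (h : IsBuildingSet M 𝒢) (hT : IsNested M 𝒢 T) :
    IsNested M 𝒢 (T ∪ factors 𝒢 M.E) := by
  have hsub : T ∪ factors 𝒢 M.E ⊆ 𝒢 := union_subset hT.subset fun K hK => hK.1.1
  refine isNested_of_exists_subset hsub h fun A hA G hG hGA => ?_
  obtain ⟨K, hK, hGK⟩ := h.exists_factor hG (h.subset_ground hG)
  by_cases hKA : K ∈ A
  · exact ⟨K, hKA, hGK⟩
  have hG2 : G ⊆ join M {a ∈ A | a ⊆ K} := (subset_inter hGA hGK).trans
    (h.join_inter_factor M.ground_isFlat (hA.trans hsub)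
      (h.sUnion_subset_ground (hA.trans hsub)) hK)
  have : {a ∈ A | a ⊆ K} ⊆ T := by
    rintro a ⟨ha, haK⟩
    obtain haT | haf := hA ha
    · exact haT
    · have hmax : Maximal (fun H => H ∈ 𝒢 ∧ H ⊆ M.E) a := haf
      obtain rfl : a = K := hmax.eq_of_le hK.1 haK
      exact absurd ha hKA
  obtain ⟨N, hN, hGN⟩ := hT.exists_subset h this hG hG2
  exact ⟨N, hN.1, hGN⟩

lemma isNested_empty (h : IsBuildingSet M 𝒢) : IsNested M 𝒢 ∅ := by
  refine isNested_of_exists_subset (empty_subset _) h fun A hA G hG hGA => ?_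
  rw [subset_empty_iff.1 hA, join_empty] at hGA
  exact absurd (hGA (h.nonempty G hG).some_mem) (notMem_empty _)

lemma isNested_singleton (hG : G ∈ 𝒢) : IsNested M 𝒢 {G} :=
  ⟨singleton_subset_iff.2 hG, fun _ hA _ hnt => absurd hnt
    (not_nontrivial_iff.2 (subsingleton_singleton.anti hA))⟩

end Nested

end BuiltMatroid
end

noncomputable section
namespace BuiltMatroid
open Set
set_option linter.unusedSectionVars false

variable {α : Type*} {M : Matroid α} {𝒢 S T A : Set (Set α)} {F G H K P Q Z J : Set α}

/-! ### Maximal nested sets and the forest order. -/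

section MaxNested

variable [M.Finite] [M.Loopless]

lemma IsMaxNested.isNested (hS : IsMaxNested M 𝒢 S) : IsNested M 𝒢 S := hS.1

lemma IsMaxNested.mem_of_insert (hS : IsMaxNested M 𝒢 S) (hH : IsNested M 𝒢 (insert H S)) :
    H ∈ S := hS.2 hH (subset_insert _ _) (mem_insert _ _)

lemma IsMaxNested.factors_subset (h : IsBuildingSet M 𝒢) (hS : IsMaxNested M 𝒢 S) :
    factors 𝒢 M.E ⊆ S := fun _ hx =>
  hS.2 (hS.isNested.union_factors h) subset_union_left (Or.inr hx)

lemma IsNested.finite (h : IsBuildingSet M 𝒢) (hS : IsNested M 𝒢 S) : S.Finite :=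
  h.finite.subset hS.subset

lemma IsNested.exists_isLeast (h : IsBuildingSet M 𝒢) (hT : IsNested M 𝒢 T) {p : Set α → Prop}
    (hP : ∃ Q ∈ T, p Q) {x : α} (hx : ∀ Q ∈ T, p Q → x ∈ Q) : ∃ P, IsLeast {Q ∈ T | p Q} P := by
  obtain ⟨Q, hQ, hpQ⟩ := hP
  obtain ⟨P, hPQ, hP⟩ :=
    ((hT.finite h).subset (sep_subset T p)).exists_le_minimal (a := Q) ⟨hQ, hpQ⟩
  refine ⟨P, hP.1, fun R hR => ?_⟩
  obtain hc | hc := hT.subset_or_subset h hP.1.1 hR.1 (hx _ hP.1.1 hP.1.2) (hx _ hR.1 hR.2)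
  · exact hc
  · exact hP.2 hR hc

/-- The least member of `T` containing a given member of `𝒢`. -/
lemma IsNested.exists_least_superset (h : IsBuildingSet M 𝒢) (hT : IsNested M 𝒢 T)
    (hr : factors 𝒢 M.E ⊆ T) (hZ : Z ∈ 𝒢) : ∃ P, IsLeast {Q ∈ T | Z ⊆ Q} P := by
  obtain ⟨K, hK, hZK⟩ := h.exists_factor hZ (h.subset_ground hZ)
  obtain ⟨x, hx⟩ := h.nonempty Z hZ
  exact hT.exists_isLeast h ⟨K, hr hK, hZK⟩ (fun Q _ hQ => hQ hx)

lemma IsNested.exists_least_mem (h : IsBuildingSet M 𝒢) (hT : IsNested M 𝒢 T)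
    (hr : factors 𝒢 M.E ⊆ T) {x : α} (hx : x ∈ M.E) : ∃ P, IsLeast {Q ∈ T | x ∈ Q} P := by
  obtain ⟨K, hK, hxK⟩ := h.exists_mem_factor M.ground_isFlat hx
  exact hT.exists_isLeast h ⟨K, hr hK, hxK⟩ (fun Q _ hQ => hQ)

lemma IsNested.exists_isParent (h : IsBuildingSet M 𝒢) (hT : IsNested M 𝒢 T) (hG : G ∈ T)
    (hP : ∃ P ∈ T, G ⊂ P) : ∃ P, IsParent T G P := by
  obtain ⟨x, hx⟩ := h.nonempty G (hT.subset hG)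
  exact hT.exists_isLeast h hP (fun Q _ hQ => hQ.subset hx)

lemma IsNested.exists_child (h : IsBuildingSet M 𝒢) (hT : IsNested M 𝒢 T) (hQ : Q ∈ T)
    (hG : G ∈ T) (hQG : Q ⊂ G) : ∃ R ∈ T, Q ⊆ R ∧ IsParent T R G := by
  obtain ⟨R, _, hR⟩ := ((hT.finite h).subset
    (sep_subset T fun R => Q ⊆ R ∧ R ⊂ G)).exists_le_maximal (a := Q) ⟨hQ, Subset.rfl, hQG⟩
  obtain ⟨hRT, hQR, hRG⟩ := hR.1
  obtain ⟨x, hx⟩ := h.nonempty Q (hT.subset hQ)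
  refine ⟨R, hRT, hQR, ⟨hG, hRG⟩, fun N hN => ?_⟩
  obtain hc | hc := hT.subset_or_subset h hG hN.1 (hQG.subset hx) (hN.2.subset (hQR hx))
  · exact hc
  · obtain rfl | hne := hc.eq_or_ssubset
    · exact Subset.rfl
    · exact absurd (hR.2 ⟨hN.1, hQR.trans hN.2.subset, hne⟩ hN.2.subset) hN.2.not_subset

/-- The factor of this closure containing `a` can be inserted, so by maximality it already belongs
to `S`. Were it smaller than `G`, it would put `a` in the join of the smaller members. -/
lemma closure_insert_joinBelow (h : IsBuildingSet M 𝒢) (hS : IsMaxNested M 𝒢 S) (hG : G ∈ S)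
    {a : α} (ha : a ∈ G) (haJ : a ∉ joinBelow M S G) : M.closure (insert a (joinBelow M S G)) = G := by
  have hGf := h.isFlat G (hS.isNested.subset hG)
  have hJG := joinBelow_subset (M := M) (S := S) hGf
  have hE : insert a (joinBelow M S G) ⊆ M.E := (insert_subset ha hJG).trans hGf.subset_ground
  have hle : M.closure (insert a (joinBelow M S G)) ⊆ G :=
    closure_subset_of_isFlat hGf (insert_subset ha hJG)
  have hsub := M.subset_closure _ hE
  obtain ⟨H, hH, haH⟩ := h.exists_mem_factor (M.isFlat_closure _) (hsub (mem_insert _ _))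
  have hHS : H ∈ S := hS.mem_of_insert
    (hS.isNested.insert_factor h hG (M.isFlat_closure _) ((subset_insert _ _).trans hsub) hle hH)
  refine hle.antisymm ?_
  by_contra hcon
  have hHG : H ⊂ G := ⟨hH.1.2.trans hle, fun hGH => hcon (hGH.trans hH.1.2)⟩
  exact haJ ((mem_joinBelow h hS.isNested).2 ⟨H, hHS, hHG, haH⟩)

/-- The members of `S` whose least superset in `T` is `P` form the block of `P`. New elements of a
block member, in particular its label, are also new for `P` relative to `T`; this lets labels inside
a block be compared with elements of `P \ joinBelow M T P`. -/
lemma notMem_joinBelow_of_isLeast (h : IsBuildingSet M 𝒢) (hS : IsNested M 𝒢 S) (hTS : T ⊆ S)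
    (hZ : Z ∈ S) (hP : IsLeast {Q ∈ T | Z ⊆ Q} P) {x : α} (hx : x ∈ Z)
    (hxJ : x ∉ joinBelow M S Z) : x ∉ joinBelow M T P := by
  intro hcon
  obtain ⟨Q, hQ, hQP, hxQ⟩ := (mem_joinBelow h (hS.mono hTS)).1 hcon
  obtain hc | hc := hS.subset_or_subset h hZ (hTS hQ) hx hxQ
  · exact hQP.not_subset (hP.2 ⟨hQ, hc⟩)
  · obtain rfl | hne := hc.eq_or_ssubset
    · exact hQP.not_subset (hP.2 ⟨hQ, Subset.rfl⟩)
    · exact hxJ ((mem_joinBelow h hS).2 ⟨Q, hTS hQ, hne, hxQ⟩)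

/-- A member of `S` whose least superset in `T` is `P`, or which lies below `J`. -/
lemma isLeast_of_not_subset_joinBelow (h : IsBuildingSet M 𝒢) (hT : IsNested M 𝒢 T)
    (hP : P ∈ T) (hZP : Z ⊆ P) (hZ : ∃ x ∈ Z, x ∉ joinBelow M T P) : IsLeast {Q ∈ T | Z ⊆ Q} P := by
  obtain ⟨x, hx, hxJ⟩ := hZ
  refine ⟨⟨hP, hZP⟩, fun R hR => ?_⟩
  obtain hc | hc := hT.subset_or_subset h hP hR.1 (hZP hx) (hR.2 hx)
  · exact hc
  · obtain rfl | hne := hc.eq_or_ssubset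
    · exact Subset.rfl
    · exact absurd ((mem_joinBelow h hT).2 ⟨R, hR.1, hne, hR.2 hx⟩) hxJ

end MaxNested

/-! ### Labels, descents and the unique filling. -/

section Labels

variable [LinearOrder α] [M.Finite] [M.Loopless]

lemma isLabel_iff (h : IsBuildingSet M 𝒢) (hS : IsMaxNested M 𝒢 S) (hG : G ∈ S) {a : α} :
    IsLabel M S G a ↔ IsLeast (G \ joinBelow M S G) a := by
  have hGf := h.isFlat G (hS.isNested.subset hG)
  have : {a ∈ M.E | M.closure (insert a (joinBelow M S G)) = G} = G \ joinBelow M S G := by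
    ext b
    constructor
    · rintro ⟨hbE, hb⟩
      have hE : insert b (joinBelow M S G) ⊆ M.E :=
        insert_subset hbE ((joinBelow_subset hGf).trans hGf.subset_ground)
      refine ⟨hb ▸ M.subset_closure _ hE (mem_insert _ _), fun hbJ => ?_⟩
      rw [insert_eq_of_mem hbJ, isFlat_joinBelow.closure] at hb
      obtain ⟨x, hx, hxJ⟩ := hS.isNested.exists_notMem_joinBelow h (hS.isNested.subset hG)
      exact hxJ (hb.symm.subset hx)
    · rintro ⟨hbG, hbJ⟩
      exact ⟨hGf.subset_ground hbG, closure_insert_joinBelow h hS hG hbG hbJ⟩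
  rw [IsLabel, this]

lemma exists_isLeast_of_nonempty (h : IsBuildingSet M 𝒢) (hG : G ∈ 𝒢) {X : Set α} (hX : X ⊆ G)
    (hne : X.Nonempty) : ∃ a, IsLeast X a := by
  have hfin : X.Finite := M.ground_finite.subset (hX.trans (h.subset_ground hG))
  obtain ⟨a, ha, hmin⟩ := exists_min_image X id hfin hne
  exact ⟨a, ha, hmin⟩

lemma IsNested.exists_isLeast_diff (h : IsBuildingSet M 𝒢) (hS : IsNested M 𝒢 S) (hG : G ∈ 𝒢) :
    ∃ a, IsLeast (G \ joinBelow M S G) a := by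
  obtain ⟨x, hx, hxJ⟩ := hS.exists_notMem_joinBelow h hG
  exact exists_isLeast_of_nonempty h hG sdiff_subset ⟨x, hx, hxJ⟩

lemma exists_isLabel (h : IsBuildingSet M 𝒢) (hS : IsMaxNested M 𝒢 S) (hG : G ∈ S) :
    ∃ a, IsLabel M S G a := by
  simp only [isLabel_iff h hS hG]
  exact hS.isNested.exists_isLeast_diff h (hS.isNested.subset hG)

lemma IsLabel.unique {a b : α} (ha : IsLabel M S G a) (hb : IsLabel M S G b) : a = b :=
  IsLeast.unique ha hb

lemma IsParent.unique (hP : IsParent S G P) (hQ : IsParent S G Q) : P = Q :=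
  IsLeast.unique hP hQ

lemma not_isDescent_of_mem_factors (h : IsBuildingSet M 𝒢) (hS : IsNested M 𝒢 S)
    (hG : G ∈ factors 𝒢 M.E) : ¬ IsDescent M S G := by
  rintro ⟨_, P, hP, _⟩
  have hP𝒢 := hS.subset hP.1.1
  exact hP.1.2.not_subset (hG.2 ⟨hP𝒢, h.subset_ground hP𝒢⟩ hP.1.2.subset)

lemma descentSet_subset : descentSet M S ⊆ S := fun _ hG => hG.1

/-- Adding to a non-maximal nested set `T` the first element of a chain: the new member belongs to
every maximal nested set `S` with `Des(S) ⊆ T ⊆ S` and is never a descent. -/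
lemma IsNested.exists_isNested_insert (h : IsBuildingSet M 𝒢) (hT : IsNested M 𝒢 T)
    (hr : factors 𝒢 M.E ⊆ T) (hmax : ¬ IsMaxNested M 𝒢 T) :
    ∃ H ∉ T, IsNested M 𝒢 (insert H T) ∧
      (∀ S, IsMaxNested M 𝒢 S → insert H T ⊆ S → H ∉ descentSet M S) ∧
      (∀ S, IsMaxNested M 𝒢 S → T ⊆ S → descentSet M S ⊆ T → H ∈ S) := by
  obtain ⟨H₀, hH₀T, hH₀⟩ : ∃ H₀ ∉ T, IsNested M 𝒢 (insert H₀ T) := by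
    by_contra! hcon
    refine hmax ⟨hT, fun U hU hTU x hx => ?_⟩
    by_contra hxT
    exact hcon x hxT (hU.mono (insert_subset hx hTU))
  have hH₀𝒢 : H₀ ∈ 𝒢 := hH₀.subset (mem_insert _ _)
  obtain ⟨P, hP⟩ := hT.exists_least_superset h hr hH₀𝒢
  have hPT : P ∈ T := hP.1.1
  have hP𝒢 : P ∈ 𝒢 := hT.subset hPT
  have hPf := h.isFlat P hP𝒢
  -- The member `P` has a gap, since `H₀` fits strictly inside it. The greedy choice is the least
  -- new element `c` of `P`, and the added set is the factor of `cl(J ∪ c)` containing `c`.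
  obtain ⟨c, ⟨hcP, hcJ⟩, hcmin⟩ := hT.exists_isLeast_diff h hP𝒢
  set J := joinBelow M T P with hJ
  have hJP : J ⊆ P := joinBelow_subset hPf
  have hE : insert c J ⊆ M.E := (insert_subset hcP hJP).trans hPf.subset_ground
  have hsub := M.subset_closure _ hE
  set κ := M.closure (insert c J) with hκ
  have hκP : κ ⊆ P := closure_subset_of_isFlat hPf (insert_subset hcP hJP)
  obtain ⟨H, hH, hcH⟩ := h.exists_mem_factor (M.isFlat_closure (insert c J))
    (hsub (mem_insert _ _))
  have hHP : H ⊆ P := hH.1.2.trans hκP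
  have hnest : IsNested M 𝒢 (insert H T) :=
    hT.insert_factor h hPT (M.isFlat_closure _) ((subset_insert _ _).trans hsub) hκP hH
  have hTJ : ∀ Q ∈ T, c ∈ Q → P ⊆ Q := by
    intro Q hQ hcQ
    obtain hc | hc := hT.subset_or_subset h hPT hQ hcP hcQ
    · exact hc
    · obtain rfl | hne := hc.eq_or_ssubset
      · exact Subset.rfl
      · exact absurd ((mem_joinBelow h hT).2 ⟨Q, hQ, hne, hcQ⟩) hcJ
  -- If `H` were in `T`, then `κ = P` and `P` would have rank one over `J`. By exchange an element
  -- of `H₀` outside `J` would generate `P` over `J`, contradicting nestedness of `insert H₀ T`.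
  have hHT : H ∉ T := by
    intro hHT
    have hκeq : κ = P := hκP.antisymm ((hTJ H hHT hcH).trans hH.1.2)
    obtain ⟨x, hxH, hxJ⟩ : ∃ x ∈ H₀, x ∉ J := by
      by_contra! hcon
      obtain ⟨Q, hQ, hle⟩ := hT.exists_subset h (sep_subset _ _) hH₀𝒢 hcon
      exact hQ.2.not_subset (hP.2 ⟨hQ.1, hle⟩)
    have hexch : c ∈ M.closure (insert x J) \ M.closure J := by
      apply M.closure_exchange
      rw [(isFlat_joinBelow (M := M) (S := T)).closure]
      exact ⟨hκeq.symm.subset (hP.1.2 hxH), hxJ⟩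
    have hPle : P ⊆ join M (insert H₀ {Q ∈ T | Q ⊂ P}) := by
      have hE' := h.sUnion_subset_ground
        (hH₀.subset.trans' (insert_subset_insert (sep_subset T (· ⊂ P))))
      have hJle : J ⊆ join M (insert H₀ {Q ∈ T | Q ⊂ P}) := join_mono (subset_insert _ _)
      have hxle : insert x J ⊆ join M (insert H₀ {Q ∈ T | Q ⊂ P}) :=
        insert_subset (subset_join hE' (mem_insert _ _) hxH) hJle
      exact hκeq.symm.subset.trans <| closure_subset_of_isFlat (isFlat_join M _)
        (insert_subset (closure_subset_of_isFlat (isFlat_join M _) hxle hexch.1) hJle)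
    obtain ⟨Q, hQ, hPQ⟩ := hH₀.exists_subset h (insert_subset_insert (sep_subset T (· ⊂ P))) hP𝒢 hPle
    obtain rfl | hQ := hQ
    · exact hH₀T (hPQ.antisymm hP.1.2 ▸ hPT)
    · exact hQ.2.not_subset hPQ
  -- Such a `Q`, together with the members of `T` below `P`, would have a join containing `κ ⊇ H`;
  -- the covering property rules this out. Hence `c` remains a new element of `H`, which keeps the
  -- label of `H` at most `c` while that of its parent is at least `c`.
  have hleast : ∀ S, IsNested M 𝒢 S → T ⊆ S → ∀ Q ∈ S, c ∈ Q → Q ⊂ H → False := by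
    intro S hS hTS Q hQ hcQ hQH
    have hle : H ⊆ join M (insert Q {R ∈ T | R ⊂ P}) := by
      have hE' : ∀ a ∈ insert Q {R ∈ T | R ⊂ P}, a ⊆ M.E := by
        rintro a (rfl | ha)
        exacts [h.subset_ground (hS.subset hQ), h.subset_ground (hT.subset ha.1)]
      exact hH.1.2.trans (closure_subset_of_isFlat (isFlat_join M _)
        (insert_subset (subset_join hE' (mem_insert _ _) hcQ) (join_mono (subset_insert _ _))))
    obtain ⟨N, hN, hHN⟩ := hS.exists_subset h
      (insert_subset hQ ((sep_subset _ _).trans hTS)) hH.1.1 hle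
    obtain rfl | hN := hN
    · exact hQH.not_subset hHN
    · exact hN.2.not_subset (hTJ N hN.1 (hHN hcH))
  refine ⟨H, hHT, hnest, fun S hS hTS hdes => ?_, fun S hS hTS hdes => ?_⟩
  · obtain ⟨hHS, P', hP', a, b, ha, hb, hba⟩ := hdes
    rw [isLabel_iff h hS hHS] at ha
    rw [isLabel_iff h hS hP'.1.1] at hb
    have hTS' := (subset_insert H T).trans hTS
    have hac : a ≤ c := ha.2 ⟨hcH, fun hcon => by
      obtain ⟨Q, hQ, hQH, hcQ⟩ := (mem_joinBelow h hS.isNested).1 hcon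
      exact hleast S hS.isNested hTS' Q hQ hcQ hQH⟩
    have hP'P : P' ⊆ P := hP'.2 ⟨hTS' hPT, hHP, fun hPH => hHT (hHP.antisymm hPH ▸ hPT)⟩
    have hlst : IsLeast {Q ∈ T | P' ⊆ Q} P :=
      ⟨⟨hPT, hP'P⟩, fun R hR => hTJ R hR.1 (hR.2 (hP'.1.2.subset hcH))⟩
    have hcb : c ≤ b := hcmin ⟨hP'P hb.1.1,
      notMem_joinBelow_of_isLeast h hS.isNested hTS' hP'.1.1 hlst hb.1.1 hb.1.2⟩
    exact absurd (hba.trans_le (hac.trans hcb)) (lt_irrefl _)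
  · obtain ⟨H', hH'⟩ := hS.isNested.exists_least_mem h (hS.factors_subset h) (x := c)
      (hPf.subset_ground hcP)
    obtain ⟨hH'S, hcH'⟩ := hH'.1
    have hH'P : H' ⊆ P := hH'.2 ⟨hTS hPT, hcP⟩
    have hlst : IsLeast {Q ∈ T | H' ⊆ Q} P :=
      ⟨⟨hPT, hH'P⟩, fun R hR => hTJ R hR.1 (hR.2 hcH')⟩
    have hcJ' : c ∉ joinBelow M S H' := fun hcon => by
      obtain ⟨Q, hQ, hQH, hcQ⟩ := (mem_joinBelow h hS.isNested).1 hcon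
      exact hQH.not_subset (hH'.2 ⟨hQ, hcQ⟩)
    have hlab : IsLabel M S H' c := by
      rw [isLabel_iff h hS hH'S]
      exact ⟨⟨hcH', hcJ'⟩, fun y hy => hcmin ⟨hH'P hy.1,
        notMem_joinBelow_of_isLeast h hS.isNested hTS hH'S hlst hy.1 hy.2⟩⟩
    -- A child `R` of `H'` not absorbed in `J` is not in `T`, hence not a descent, so its label is
    -- at most `c`. It is also a new element of `P`, hence at least `c`. Equality would place `c`
    -- below `H'`.
    have hJle : joinBelow M S H' ⊆ J := by
      intro x hx
      obtain ⟨Q, hQ, hQH, hxQ⟩ := (mem_joinBelow h hS.isNested).1 hx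
      obtain ⟨R, hRS, hQR, hpar⟩ := hS.isNested.exists_child h hQ hH'S hQH
      have hRH := hpar.1.2
      by_contra hxJ
      have hRT : R ∉ T := fun hRT =>
        hxJ ((mem_joinBelow h hT).2 ⟨R, hRT, hRH.trans_subset hH'P, hQR hxQ⟩)
      obtain ⟨r, hlr⟩ := exists_isLabel h hS hRS
      have hnd : ¬ IsDescent M S R := fun hd => hRT (hdes hd)
      have hrc : r ≤ c := by
        by_contra! hlt
        exact hnd ⟨hRS, H', hpar, r, c, hlr, hlab, hlt⟩
      rw [isLabel_iff h hS hRS] at hlr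
      have hlst' : IsLeast {Q ∈ T | R ⊆ Q} P :=
        isLeast_of_not_subset_joinBelow h hT hPT (hRH.subset.trans hH'P) ⟨x, hQR hxQ, hxJ⟩
      have hcr : c ≤ r := hcmin ⟨hH'P (hRH.subset hlr.1.1),
        notMem_joinBelow_of_isLeast h hS.isNested hTS hRS hlst' hlr.1.1 hlr.1.2⟩
      obtain rfl := le_antisymm hcr hrc
      exact hcJ' ((mem_joinBelow h hS.isNested).2 ⟨R, hRS, hRH, hlr.1.1⟩)
    have hH'κ : H' ⊆ κ := by
      rw [← closure_insert_joinBelow h hS hH'S hcH' hcJ']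
      exact M.closure_subset_closure (insert_subset_insert hJle)
    obtain ⟨L, hL, hH'L⟩ := h.exists_factor (hS.isNested.subset hH'S) hH'κ
    obtain rfl := h.factor_unique (M.isFlat_closure _) hL hH (hH'L hcH') hcH
    obtain rfl | hne := hH'L.eq_or_ssubset
    · exact hH'S
    · exact (hleast S hS.isNested hTS H' hH'S hcH' hne).elim

/-- Every nested set containing the maximal members of `𝒢` lies between `Des(S)` and `S` for exactly
one maximal nested set `S`. -/
lemma existsUnique_fill (h : IsBuildingSet M 𝒢) (hT : IsNested M 𝒢 T) (hr : factors 𝒢 M.E ⊆ T) :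
    ∃! S, IsMaxNested M 𝒢 S ∧ T ⊆ S ∧ descentSet M S ⊆ T := by
  induction hn : (𝒢 \ T).ncard using Nat.strong_induction_on generalizing T with
  | _ n ih =>
    by_cases hmax : IsMaxNested M 𝒢 T
    · refine ⟨T, ⟨hmax, Subset.rfl, descentSet_subset⟩, fun S hS => ?_⟩
      exact (hmax.2 hS.1.1 hS.2.1).antisymm hS.2.1
    · obtain ⟨H, hHT, hnest, h1, h2⟩ := hT.exists_isNested_insert h hr hmax
      have hlt : (𝒢 \ insert H T).ncard < n := by
        rw [← hn]
        refine ncard_lt_ncard ⟨sdiff_subset_sdiff_right (subset_insert _ _), fun hcon => ?_⟩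
          (h.finite.subset sdiff_subset)
        exact (hcon ⟨hnest.subset (mem_insert _ _), hHT⟩).2 (mem_insert _ _)
      obtain ⟨S, ⟨hS, hTS, hdes⟩, huniq⟩ := ih _ hlt hnest (hr.trans (subset_insert _ _)) rfl
      refine ⟨S, ⟨hS, (subset_insert _ _).trans hTS, fun D hD => ?_⟩, fun S' hS' => ?_⟩
      · obtain rfl | hD' := hdes hD
        · exact absurd hD (h1 S hS hTS)
        · exact hD'
      · refine huniq S' ⟨hS'.1, insert_subset (h2 S' hS'.1 hS'.2.1 hS'.2.2) hS'.2.1, ?_⟩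
        exact hS'.2.2.trans (subset_insert _ _)

lemma ncard_ground_diff_lt (hG : G ⊆ M.E) (hQG : Q ⊂ G) : (M.E \ G).ncard < (M.E \ Q).ncard := by
  obtain ⟨x, hxG, hxQ⟩ := exists_of_ssubset hQG
  refine ncard_lt_ncard ⟨sdiff_subset_sdiff_right hQG.subset, fun hcon => ?_⟩
    (M.ground_finite.subset sdiff_subset)
  exact (hcon ⟨hG hxG, hxQ⟩).2 hxG

/-- Labels increase along chains that do not meet `T ⊇ Des(S)` before their top. -/
lemma label_le_of_subset (h : IsBuildingSet M 𝒢) (hS : IsMaxNested M 𝒢 S)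
    (hdes : descentSet M S ⊆ T) (hQ : Q ∈ S) (hZ : Z ∈ S) (hQZ : Q ⊆ Z)
    (hT : ∀ R ∈ T, Q ⊆ R → ¬ R ⊂ Z) {q z : α} (hq : IsLabel M S Q q) (hz : IsLabel M S Z z) :
    q ≤ z := by
  induction hn : (M.E \ Q).ncard using Nat.strong_induction_on generalizing Q q with
  | _ n ih =>
    obtain rfl | hne := hQZ.eq_or_ssubset
    · exact (hq.unique hz).le
    · obtain ⟨Q', hQ'⟩ := hS.isNested.exists_isParent h hQ ⟨Z, hZ, hne⟩
      have hQ'Z : Q' ⊆ Z := hQ'.2 ⟨hZ, hne⟩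
      obtain ⟨q', hq'⟩ := exists_isLabel h hS hQ'.1.1
      have h1 : q ≤ q' := by
        by_contra! hlt
        exact hT Q (hdes ⟨hQ, Q', hQ', q, q', hq, hq', hlt⟩) Subset.rfl hne
      refine h1.trans (ih _ ?_ hQ'.1.1 hQ'Z (fun R hR hle => hT R hR (hQ'.1.2.subset.trans hle))
        hq' rfl)
      rw [← hn]
      exact ncard_ground_diff_lt (h.subset_ground (hS.isNested.subset hQ'.1.1)) hQ'.1.2

/-- Inside a block there are no descents below its top, so labels weakly increase upwards.
Generating `Z` successively from its labels therefore uses only elements up to its own label,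
besides the join coming from `T`. -/
lemma subset_closure_label (h : IsBuildingSet M 𝒢) (hS : IsMaxNested M 𝒢 S) (hTS : T ⊆ S)
    (hdes : descentSet M S ⊆ T) (hZ : Z ∈ S) (hP : IsLeast {Q ∈ T | Z ⊆ Q} P) {z : α}
    (hz : IsLabel M S Z z) : Z ⊆ M.closure (joinBelow M T P ∪ {x ∈ P | x ≤ z}) := by
  have hT := hS.isNested.mono hTS
  have hPf := h.isFlat P (hT.subset hP.1.1)
  induction hn : Z.ncard using Nat.strong_induction_on generalizing Z z with
  | _ n ih =>
    have hz' := (isLabel_iff h hS hZ).1 hz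
    have hE : joinBelow M T P ∪ {x ∈ P | x ≤ z} ⊆ M.E :=
      (union_subset (joinBelow_subset hPf) (sep_subset _ _)).trans hPf.subset_ground
    have hsub := M.subset_closure _ hE
    have hgoal : insert z (joinBelow M S Z) ⊆ M.closure (joinBelow M T P ∪ {x ∈ P | x ≤ z}) := by
      refine insert_subset (hsub (Or.inr ⟨hP.1.2 hz'.1.1, le_rfl⟩)) fun x hx => ?_
      obtain ⟨Q, hQ, hQZ, hxQ⟩ := (mem_joinBelow h hS.isNested).1 hx
      by_cases hxJ : x ∈ joinBelow M T P
      · exact hsub (Or.inl hxJ)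
      have hQP : IsLeast {R ∈ T | Q ⊆ R} P :=
        isLeast_of_not_subset_joinBelow h hT hP.1.1 (hQZ.subset.trans hP.1.2) ⟨x, hxQ, hxJ⟩
      obtain ⟨q, hq⟩ := exists_isLabel h hS hQ
      have hqz : q ≤ z := label_le_of_subset h hS hdes hQ hZ hQZ.subset
        (fun R hR hQR hRZ => hRZ.not_subset (hP.1.2.trans (hQP.2 ⟨hR, hQR⟩))) hq hz
      have := ih _ (by
        rw [← hn]
        exact ncard_lt_ncard hQZ (M.ground_finite.subset
          (h.subset_ground (hS.isNested.subset hZ)))) hQ hQP hq rfl hxQ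
      have hmono : {x ∈ P | x ≤ q} ⊆ {x ∈ P | x ≤ z} := fun y hy => ⟨hy.1, hy.2.trans hqz⟩
      exact M.closure_subset_closure (union_subset_union_right _ hmono) this
    rw [← closure_insert_joinBelow h hS hZ hz'.1.1 hz'.1.2]
    exact closure_subset_of_isFlat (M.isFlat_closure _) hgoal

/-- Each element `x ≤ c` of `P` outside the join belongs to a block member whose label is at most
`x`, namely the least member of `S` containing it. The generators are thus covered by the listed
members, and nestedness covers `G`. -/
lemma exists_superset_of_subset_closure (h : IsBuildingSet M 𝒢) (hS : IsMaxNested M 𝒢 S)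
    (hTS : T ⊆ S) (hP : P ∈ T) (hG : G ∈ 𝒢) {c : α}
    (hle : G ⊆ M.closure (joinBelow M T P ∪ {x ∈ P | x ≤ c})) :
    ∃ Z ∈ S, G ⊆ Z ∧ ((Z ∈ T ∧ Z ⊂ P) ∨
      (IsLeast {Q ∈ T | Z ⊆ Q} P ∧ ∃ z, IsLabel M S Z z ∧ z ≤ c)) := by
  have hT := hS.isNested.mono hTS
  have hPf := h.isFlat P (hT.subset hP)
  set A : Set (Set α) := {Z ∈ S | (Z ∈ T ∧ Z ⊂ P) ∨
      (IsLeast {Q ∈ T | Z ⊆ Q} P ∧ ∃ z, IsLabel M S Z z ∧ z ≤ c)} with hA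
  have hAS : A ⊆ S := sep_subset _ _
  have hAE := h.sUnion_subset_ground (hAS.trans hS.isNested.subset)
  have hJA : joinBelow M T P ⊆ join M A := join_mono fun Q hQ => ⟨hTS hQ.1, Or.inl hQ⟩
  have : G ⊆ join M A := by
    refine hle.trans (closure_subset_of_isFlat (isFlat_join M A) (union_subset hJA ?_))
    rintro x ⟨hxP, hxc⟩
    by_cases hxJ : x ∈ joinBelow M T P
    · exact hJA hxJ
    obtain ⟨Z, hZ⟩ := hS.isNested.exists_least_mem h (hS.factors_subset h)
      (hPf.subset_ground hxP)
    have hZP : Z ⊆ P := hZ.2 ⟨hTS hP, hxP⟩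
    obtain ⟨z, hz⟩ := exists_isLabel h hS hZ.1.1
    have hzx : z ≤ x := ((isLabel_iff h hS hZ.1.1).1 hz).2 ⟨hZ.1.2, fun hcon => by
      obtain ⟨Q, hQ, hQZ, hxQ⟩ := (mem_joinBelow h hS.isNested).1 hcon
      exact hQZ.not_subset (hZ.2 ⟨hQ, hxQ⟩)⟩
    exact subset_join hAE ⟨hZ.1.1, Or.inr ⟨isLeast_of_not_subset_joinBelow h hT hP hZP
      ⟨x, hZ.1.2, hxJ⟩, z, hz, hzx.trans hxc⟩⟩ hZ.1.2
  obtain ⟨Z, hZ, hGZ⟩ := hS.isNested.exists_subset h hAS hG this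
  exact ⟨Z, hZ.1, hGZ, hZ.2⟩

end Labels

end BuiltMatroid
end

/-! ### Consequences of completeness, and the simplicial complex. -/

noncomputable section
namespace BuiltMatroid
open Set
set_option linter.unusedSectionVars false

variable {α : Type*} [LinearOrder α] {M : Matroid α} {𝒢 S T A D : Set (Set α)}
  {F G H K P Q R R' Z J : Set α} [M.Finite] [M.Loopless]

/-- In a complete pair, two elements of `P` outside the join of a family of members of `𝒢` lie in a
common member of `𝒢` inside the corresponding flat of the chain. -/
lemma IsComplete.exists_mem_mem (hc : IsComplete M 𝒢) (h : IsBuildingSet M 𝒢) (hA : A ⊆ 𝒢)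
    (hAP : ∀ a ∈ A, a ⊆ P) (hP : P ∈ 𝒢) {b c : α} (hb : b ∈ P) (hbA : b ∉ join M A) (hcP : c ∈ P)
    (hcA : c ∉ join M A) (hbc : b ≤ c) :
    ∃ H ∈ 𝒢, b ∈ H ∧ c ∈ H ∧ H ⊆ M.closure (join M A ∪ {x ∈ P | x ≤ c}) := by
  have hPf := h.isFlat P hP
  have hFP : join M A ⊆ P := join_subset hPf hAP
  set κ := M.closure (join M A ∪ {x ∈ P \ join M A | x ≤ c}) with hκ
  have hE : join M A ∪ {x ∈ P \ join M A | x ≤ c} ⊆ M.E :=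
    (union_subset hFP fun x hx => hx.1.1).trans hPf.subset_ground
  have hsub := M.subset_closure _ hE
  have hκc : c ∈ κ := hsub (Or.inr ⟨⟨hcP, hcA⟩, le_rfl⟩)
  have hκb : b ∈ κ := hsub (Or.inr ⟨⟨hb, hbA⟩, hbc⟩)
  have hmem : κ ∈ orderChain M (join M A) P := Or.inr ⟨c, ⟨hcP, hcA⟩, rfl⟩
  obtain ⟨H₀, hH₀, hH₀P, hκH⟩ : ∃ H ∈ 𝒢, H ⊆ P ∧ κ = join M {join M A, H} := by
    obtain hk | hk := hc _ _ (isFlat_join M A) hP hFP hmem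
    · exact hk.1
    · rw [mem_singleton_iff] at hk
      exact absurd (hk ▸ hκc) hcA
  have hEP : ∀ a ∈ insert H₀ A, a ⊆ M.E := by
    rintro a (rfl | ha)
    exacts [h.subset_ground hH₀, h.subset_ground (hA ha)]
  have hsub𝒢 : insert H₀ A ⊆ 𝒢 := insert_subset hH₀ hA
  have hκj : κ = join M (insert H₀ A) := by
    rw [hκH]
    apply subset_antisymm
    · refine join_subset (isFlat_join M _) ?_
      rintro a (rfl | rfl)
      · exact join_mono (subset_insert _ _)
      · exact subset_join hEP (mem_insert _ _)
    · have hEp : ∀ a ∈ ({join M A, H₀} : Set (Set α)), a ⊆ M.E := by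
        rintro a (rfl | rfl)
        exacts [(isFlat_join M A).subset_ground, h.subset_ground hH₀]
      refine join_subset (isFlat_join M _) ?_
      rintro a (rfl | ha)
      · exact subset_join hEp (by simp)
      · exact (subset_join (fun a ha => h.subset_ground (hA ha)) ha).trans
          (subset_join hEp (by simp))
  have hκf : M.IsFlat κ := M.isFlat_closure _
  have hle : ∀ a ∈ insert H₀ A, a ⊆ κ := fun a ha => hκj ▸ subset_join hEP ha
  obtain ⟨H, hH, hH₀H⟩ := h.exists_factor hH₀ (hle H₀ (mem_insert _ _))
  have key : ∀ x ∈ κ, x ∉ join M A → x ∈ H := by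
    intro x hx hxA
    obtain ⟨L, hL, hxL⟩ := h.exists_mem_factor hκf hx
    by_cases hLH : L = H
    · exact hLH ▸ hxL
    have h1 : x ∈ join M {a ∈ insert H₀ A | a ⊆ L} :=
      h.join_inter_factor hκf hsub𝒢 hle hL ⟨hκj ▸ hx, hxL⟩
    refine absurd (join_mono ?_ h1) hxA
    rintro a ⟨rfl | ha, haL⟩
    · obtain ⟨y, hy⟩ := h.nonempty _ hH₀
      exact absurd (h.factor_unique hκf hL hH (haL hy) (hH₀H hy)) hLH
    · exact ha
  have hmono : {x ∈ P \ join M A | x ≤ c} ⊆ {x ∈ P | x ≤ c} := fun x hx => ⟨hx.1.1, hx.2⟩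
  exact ⟨H, hH.1.1, key b hκb hbA, key c hκc hcA,
    hH.1.2.trans (M.closure_subset_closure (union_subset_union_right _ hmono))⟩

/-- Equality of labels is impossible: the label of the parent lies outside every smaller member,
whereas the label of `G` lies in `G`. -/
lemma IsLabel.lt_of_not_isDescent (h : IsBuildingSet M 𝒢) (hS : IsMaxNested M 𝒢 S) (hG : G ∈ S)
    (hnd : ¬ IsDescent M S G) (hP : IsParent S G P) {a b : α} (ha : IsLabel M S G a)
    (hb : IsLabel M S P b) : a < b := by
  have hle : a ≤ b := by
    by_contra! hlt
    exact hnd ⟨hG, P, hP, a, b, ha, hb, hlt⟩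
  refine hle.lt_of_ne ?_
  rintro rfl
  rw [isLabel_iff h hS hG] at ha
  rw [isLabel_iff h hS hP.1.1] at hb
  exact hb.1.2 ((mem_joinBelow h hS.isNested).2 ⟨G, hG, hP.1.2, ha.1.1⟩)

/-- A criterion for descents of the maximal nested set between `Des(S)` and `S`. -/
lemma isDescent_of_lt (hc : IsComplete M 𝒢) (h : IsBuildingSet M 𝒢) (hS : IsMaxNested M 𝒢 S)
    (hTS : T ⊆ S) (hdes : descentSet M S ⊆ T) (hG : G ∈ T) (hP : IsParent T G P) {b c : α}
    (hlc : IsLabel M S G c) (hbP : b ∈ P) (hbJ : b ∉ joinBelow M T P) (hbc : b < c) :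
    IsDescent M S G := by
  have hT := hS.isNested.mono hTS
  have hGS := hTS hG
  have hlc' := (isLabel_iff h hS hGS).1 hlc
  have hcG := hlc'.1.1
  have hGJ : G ⊆ joinBelow M T P := fun x hx => (mem_joinBelow h hT).2 ⟨G, hG, hP.1.2, hx⟩
  set A : Set (Set α) := {Q ∈ T | Q ⊂ P ∧ Q ≠ G} with hA
  have hAT : A ⊆ T := sep_subset _ _
  have hAJ : join M A ⊆ joinBelow M T P := join_mono fun Q hQ => ⟨hQ.1, hQ.2.1⟩
  have hcA : c ∉ join M A := by
    intro hcon
    obtain ⟨Q, hQ, hcQ⟩ := hT.mem_of_mem_join h hAT hcon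
    obtain hle | hle := hT.subset_or_subset h hG hQ.1 hcG hcQ
    · exact hQ.2.1.not_subset (hP.2 ⟨hQ.1, hle.ssubset_of_ne hQ.2.2.symm⟩)
    · exact hlc'.1.2 ((mem_joinBelow h hS.isNested).2
        ⟨Q, hTS hQ.1, hle.ssubset_of_ne hQ.2.2, hcQ⟩)
  obtain ⟨H, hH, hbH, hcH, hHle⟩ := hc.exists_mem_mem h (hAT.trans hT.subset)
    (fun a ha => ha.2.1.subset) (hT.subset hP.1.1) hbP (fun hb => hbJ (hAJ hb))
    (hP.1.2.subset hcG) hcA hbc.le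
  have hGH : join M {G, H} ∈ 𝒢 := h.join_pair_mem (hT.subset hG) hH ⟨c, hcG, hcH⟩
  have hE : ∀ a ∈ ({G, H} : Set (Set α)), a ⊆ M.E := by
    rintro a (rfl | rfl)
    exacts [h.subset_ground (hT.subset hG), h.subset_ground hH]
  have hPf := h.isFlat P (hT.subset hP.1.1)
  have hE2 : joinBelow M T P ∪ {x ∈ P | x ≤ c} ⊆ M.E :=
    (union_subset (joinBelow_subset hPf) (sep_subset _ _)).trans hPf.subset_ground
  have hle : join M {G, H} ⊆ M.closure (joinBelow M T P ∪ {x ∈ P | x ≤ c}) := by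
    refine join_subset (M.isFlat_closure _) ?_
    rintro a (rfl | rfl)
    · exact (hGJ.trans subset_union_left).trans (M.subset_closure _ hE2)
    · exact hHle.trans (M.closure_subset_closure (union_subset_union_left _ hAJ))
  obtain ⟨Z, hZ, hGZ, hcase⟩ := exists_superset_of_subset_closure h hS hTS hP.1.1 hGH hle
  have hbZ : b ∈ Z := hGZ (subset_join hE (by simp) hbH)
  -- The first case would put `b` in the join below `P`. In the second, `G ⊂ Z` with `Z` in the
  -- block of `P`, so the parent of `G` in `S` has label at most `z ≤ c`, which is incompatible with
  -- `G` being an ascent.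
  obtain ⟨hZT, hZP⟩ | ⟨hZP, z, hz, hzc⟩ := hcase
  · exact absurd ((mem_joinBelow h hT).2 ⟨Z, hZT, hZP, hbZ⟩) hbJ
  have hGZ' : G ⊂ Z := ((subset_join hE (by simp)).trans hGZ).ssubset_of_ne (by
    rintro rfl
    exact hbJ (hGJ hbZ))
  obtain ⟨Q, hQ⟩ := hS.isNested.exists_isParent h hGS ⟨Z, hZ, hGZ'⟩
  obtain ⟨q, hq⟩ := exists_isLabel h hS hQ.1.1
  have hqz : q ≤ z := label_le_of_subset h hS hdes hQ.1.1 hZ (hQ.2 ⟨hZ, hGZ'⟩)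
    (fun R hR hQR hRZ => (hRZ.trans_subset hZP.1.2).not_subset
      (hP.2 ⟨hR, hQ.1.2.trans_subset hQR⟩)) hq hz
  by_contra hnd
  exact absurd (hlc.lt_of_not_isDescent h hS hGS hnd hQ hq) (hqz.trans hzc).not_gt

lemma IsParent.eq_of_inter (h : IsBuildingSet M 𝒢) (hS : IsNested M 𝒢 S) (hR : R ∈ S)
    (hR' : R' ∈ S) (hQ : IsParent S R Q) (hQ' : IsParent S R' Q) {x : α} (hx : x ∈ R)
    (hx' : x ∈ R') : R = R' := by
  by_contra hne
  obtain hle | hle := hS.subset_or_subset h hR hR' hx hx'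
  · exact hQ'.1.2.not_subset (hQ.2 ⟨hR', hle.ssubset_of_ne hne⟩)
  · exact hQ.1.2.not_subset (hQ'.2 ⟨hR, hle.ssubset_of_ne (Ne.symm hne)⟩)

/-- In a complete pair, a member of a maximal nested set has at most one child that is not a
descent. -/
lemma eq_of_not_isDescent (hc : IsComplete M 𝒢) (h : IsBuildingSet M 𝒢)
    (hS : IsMaxNested M 𝒢 S) (hR : R ∈ S) (hR' : R' ∈ S) (hQ : IsParent S R Q)
    (hQ' : IsParent S R' Q) (hnd : ¬ IsDescent M S R) (hnd' : ¬ IsDescent M S R') : R = R' := by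
  obtain ⟨c, hlc⟩ := exists_isLabel h hS hR
  obtain ⟨c', hlc'⟩ := exists_isLabel h hS hR'
  wlog hcc : c ≤ c' generalizing R R' c c'
  · exact (this hR' hR hQ' hQ hnd' hnd c' hlc' c hlc (not_le.1 hcc).le).symm
  by_contra hne
  obtain ⟨q, hq⟩ := exists_isLabel h hS hQ.1.1
  have hc'q := hlc'.lt_of_not_isDescent h hS hR' hnd' hQ' hq
  -- With this smallest choice of `T`, the two ascents `R` and `R'` are not in `T` and lie in the
  -- same block as their parent `Q`, so both labels are new elements of `P`.
  set T := descentSet M S ∪ factors 𝒢 M.E with hT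
  have hTS : T ⊆ S := union_subset descentSet_subset (hS.factors_subset h)
  have hTn := hS.isNested.mono hTS
  have hdes : descentSet M S ⊆ T := subset_union_left
  obtain ⟨P, hP⟩ := hTn.exists_least_superset h subset_union_right (hS.isNested.subset hQ.1.1)
  have hblock : ∀ R, R ∈ S → IsParent S R Q → ¬ IsDescent M S R → IsLeast {N ∈ T | R ⊆ N} P := by
    intro R hR hQ hnd
    refine ⟨⟨hP.1.1, hQ.1.2.subset.trans hP.1.2⟩, fun N hN => ?_⟩
    obtain rfl | hRN := hN.2.eq_or_ssubset
    · obtain hN' | hN' := hN.1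
      · exact absurd hN' hnd
      · exact absurd (hN'.2 ⟨hS.isNested.subset hQ.1.1,
          h.subset_ground (hS.isNested.subset hQ.1.1)⟩ hQ.1.2.subset) hQ.1.2.not_subset
    · exact hP.2 ⟨hN.1, hQ.2 ⟨hTS hN.1, hRN⟩⟩
  have hl := (isLabel_iff h hS hR).1 hlc
  have hl' := (isLabel_iff h hS hR').1 hlc'
  have hcJ := notMem_joinBelow_of_isLeast h hS.isNested hTS hR (hblock R hR hQ hnd) hl.1.1 hl.1.2
  have hcJ' := notMem_joinBelow_of_isLeast h hS.isNested hTS hR' (hblock R' hR' hQ' hnd')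
    hl'.1.1 hl'.1.2
  obtain ⟨H, hH, hcH, hcH', hHle⟩ := hc.exists_mem_mem h (A := {N ∈ T | N ⊂ P})
    ((sep_subset _ _).trans hTn.subset) (fun a ha => ha.2.subset) (hTn.subset hP.1.1)
    (hP.1.2 (hQ.1.2.subset hl.1.1)) hcJ (hP.1.2 (hQ'.1.2.subset hl'.1.1)) hcJ' hcc
  obtain ⟨Z, hZ, hHZ, hcase⟩ := exists_superset_of_subset_closure h hS hTS hP.1.1 hH hHle
  obtain ⟨hZT, hZP⟩ | ⟨hZP, z, hz, hzc⟩ := hcase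
  · exact hcJ ((mem_joinBelow h hTn).2 ⟨Z, hZT, hZP, hHZ hcH⟩)
  -- `Z` meets both children, and distinct children of `Q` are disjoint, so `Z` must contain `Q`.
  -- Its label is at most `c'`, hence so is that of `Q`, against `c' < q`.
  have hQZ : Q ⊆ Z := by
    obtain hle | hle := hS.isNested.subset_or_subset h hZ hR (hHZ hcH) hl.1.1
    · exact absurd (hQ.eq_of_inter h hS.isNested hR hR' hQ' (hle (hHZ hcH')) hl'.1.1) hne
    · refine hQ.2 ⟨hZ, hle.ssubset_of_ne ?_⟩
      rintro rfl
      exact hne (hQ.eq_of_inter h hS.isNested hR hR' hQ' (hHZ hcH') hl'.1.1)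
  have hqz := label_le_of_subset h hS hdes hQ.1.1 hZ hQZ
    (fun N hN hQN hNZ => (hNZ.trans_subset hZP.1.2).not_subset (hP.2 ⟨hN, hQN⟩)) hq hz
  exact absurd hc'q (hqz.trans hzc).not_gt

/-- Having no bottom descent and no double descent means together that each descent has an ascending
child. Only this form is used for stability. -/
lemma isStable_iff : IsStable M 𝒢 S ↔ IsMaxNested M 𝒢 S ∧
    ∀ G ∈ descentSet M S, ∃ R ∈ S, IsParent S R G ∧ R ∉ descentSet M S := by
  constructor
  · refine fun hS => ⟨hS.isMaxNested, fun G hG => ?_⟩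
    have hmin : ¬ Minimal (fun H => H ∈ S) G := fun hm => hS.no_bottom G ⟨hG, hm⟩
    by_contra! hcon
    exact hS.no_double G ⟨hG, hmin, hcon⟩
  · rintro ⟨hS, hc⟩
    refine ⟨hS, ?_, ?_⟩
    · rintro G ⟨hG, hmin⟩
      obtain ⟨R, hR, hp, _⟩ := hc G hG
      exact hp.1.2.not_subset (hmin.2 hR hp.1.2.subset)
    · rintro G ⟨hG, _, hall⟩
      obtain ⟨R, hR, hp, hnd⟩ := hc G hG
      exact hnd (hall R hR hp)

lemma subset_of_subset_union_factors (h : IsBuildingSet M 𝒢) (hS : IsMaxNested M 𝒢 S)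
    (hD : descentSet M S ⊆ D ∪ factors 𝒢 M.E) : descentSet M S ⊆ D := fun _ hG =>
  (hD hG).resolve_right fun hf => not_isDescent_of_mem_factors h hS.isNested hf hG

lemma IsNested.exists_fill (h : IsBuildingSet M 𝒢) (hD : IsNested M 𝒢 D) :
    ∃ S, IsMaxNested M 𝒢 S ∧ D ∪ factors 𝒢 M.E ⊆ S ∧ descentSet M S ⊆ D := by
  obtain ⟨S, ⟨hS, hDS, hdes⟩, _⟩ := existsUnique_fill h (hD.union_factors h) subset_union_right
  exact ⟨S, hS, hDS, subset_of_subset_union_factors h hS hdes⟩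

/-- Both sets are fillings of the common descent set enlarged by the maximal members of `𝒢`. This
makes the faces of `Γ` correspond bijectively to the stable sets. -/
lemma IsMaxNested.eq_of_descentSet_eq (h : IsBuildingSet M 𝒢) {S' : Set (Set α)}
    (hS : IsMaxNested M 𝒢 S) (hS' : IsMaxNested M 𝒢 S') (heq : descentSet M S = descentSet M S') :
    S = S' := by
  have h1 : descentSet M S ∪ factors 𝒢 M.E ⊆ S :=
    union_subset descentSet_subset (hS.factors_subset h)
  have h2 : descentSet M S ∪ factors 𝒢 M.E ⊆ S' :=
    heq ▸ union_subset descentSet_subset (hS'.factors_subset h)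
  exact (existsUnique_fill h (hS.isNested.mono h1) subset_union_right).unique
    ⟨hS, h1, subset_union_left⟩ ⟨hS', h2, heq ▸ subset_union_left⟩

/-- Subsets of descent sets of stable maximal nested sets are again such. -/
lemma IsStable.exists_descentSet_eq (hc : IsComplete M 𝒢) (h : IsBuildingSet M 𝒢)
    (hS : IsStable M 𝒢 S) (hD : D ⊆ descentSet M S) :
    ∃ S', IsStable M 𝒢 S' ∧ D = descentSet M S' := by
  obtain ⟨hS, hst⟩ := isStable_iff.1 hS
  have hDS : D ⊆ S := hD.trans descentSet_subset
  have hDn : IsNested M 𝒢 D := hS.isNested.mono hDS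
  obtain ⟨S', hS', hDS', hdes'⟩ := hDn.exists_fill h
  set T := D ∪ factors 𝒢 M.E with hT
  have hTS : T ⊆ S := union_subset hDS (hS.factors_subset h)
  have hTn := hS.isNested.mono hTS
  have hdesT : descentSet M S' ⊆ T := hdes'.trans subset_union_left
  have heq : D = descentSet M S' := by
    refine subset_antisymm (fun G hG => ?_) hdes'
    obtain ⟨hGS, P₀, hP₀, a, b, ha, hb, hba⟩ := hD hG
    have hGT : G ∈ T := Or.inl hG
    obtain ⟨K, hK, hP₀K⟩ := h.exists_factor (hS.isNested.subset hP₀.1.1)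
      (h.subset_ground (hS.isNested.subset hP₀.1.1))
    obtain ⟨P, hP⟩ := hTn.exists_isParent h hGT ⟨K, Or.inr hK, hP₀.1.2.trans_subset hP₀K⟩
    have hP₀P : P₀ ⊆ P := hP₀.2 ⟨hTS hP.1.1, hP.1.2⟩
    obtain ⟨a', ha'⟩ := exists_isLabel h hS' (hDS' hGT)
    have hb' := (isLabel_iff h hS hP₀.1.1).1 hb
    have ha2 := (isLabel_iff h hS hGS).1 ha
    -- The label of `G` does not drop when `S` is replaced by `S'`. Elements of `G` smaller than `a`
    -- lie in the join below `G` in `S`; if `a'` were smaller, `subset_closure_label` would put all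
    -- of `G` in that join.
    have haa' : a ≤ a' := by
      by_contra! hlt
      have hsub := subset_closure_label h hS' hDS' hdesT (hDS' hGT)
        (P := G) ⟨⟨hGT, Subset.rfl⟩, fun R hR => hR.2⟩ ha'
      obtain ⟨x, hxG, hxJ⟩ := hS.isNested.exists_notMem_joinBelow h (hS.isNested.subset hGS)
      refine hxJ (closure_subset_of_isFlat isFlat_joinBelow ?_ (hsub hxG))
      refine union_subset (joinBelow_mono hTS) fun y hy => ?_
      by_contra hyJ
      exact absurd (ha2.2 ⟨hy.1, hyJ⟩) (hy.2.trans_lt hlt).not_ge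
    refine isDescent_of_lt hc h hS' hDS' hdesT hGT hP ha' (hP₀P hb'.1.1) (fun hcon => ?_)
      (hba.trans_le haa')
    obtain ⟨Q, hQ, hQP, hbQ⟩ := (mem_joinBelow h hTn).1 hcon
    obtain hle | hle := hS.isNested.subset_or_subset h hP₀.1.1 (hTS hQ) hb'.1.1 hbQ
    · exact hQP.not_subset (hP.2 ⟨hQ, hP₀.1.2.trans_subset hle⟩)
    · obtain rfl | hne := hle.eq_or_ssubset
      · exact hQP.not_subset (hP.2 ⟨hQ, hP₀.1.2⟩)
      · exact hb'.1.2 ((mem_joinBelow h hS.isNested).2 ⟨Q, hTS hQ, hne, hbQ⟩)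
  refine ⟨S', isStable_iff.2 ⟨hS', fun G hG => ?_⟩, heq⟩
  rw [← heq] at hG
  have hGT : G ∈ T := Or.inl hG
  have hG𝒢 := hTn.subset hGT
  obtain ⟨R, hR, hRG, hRd⟩ := hst G (hD hG)
  obtain ⟨x, hxR, hxJ⟩ : ∃ x ∈ R, x ∉ joinBelow M T G := by
    by_contra! hcon
    obtain ⟨Q, hQ, hle⟩ := hTn.exists_subset h (sep_subset _ _) (hS.isNested.subset hR) hcon
    obtain rfl | hne := hle.eq_or_ssubset
    · obtain hQ' | hQ' := hQ.1
      · exact hRd (hD hQ')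
      · exact hQ.2.not_subset (hQ'.2 ⟨hG𝒢, h.subset_ground hG𝒢⟩ hQ.2.subset)
    · exact hQ.2.not_subset (hRG.2 ⟨hTS hQ.1, hne⟩)
  have hJS : joinBelow M T G ⊆ joinBelow M S G := joinBelow_mono hTS
  -- The ascending child `R` leaves room between the join of `T` below `G` and `G`. If all of
  -- `J_{S'}(G)` came from `T`, an element of `R` would already generate `G` over it, forcing `G`
  -- into its join in `S`. Hence `S'` has a child of `G` outside `D`.
  have hnot : ¬ joinBelow M S' G ⊆ joinBelow M T G := by
    intro hle
    have hcl := closure_insert_joinBelow h hS' (hDS' hGT) (hRG.1.2.subset hxR)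
      (fun hx => hxJ (hle hx))
    obtain ⟨y, hyG, hyJ⟩ := hS.isNested.exists_notMem_joinBelow h hG𝒢
    refine hyJ (closure_subset_of_isFlat isFlat_joinBelow ?_ (hcl.symm.subset hyG))
    exact insert_subset ((mem_joinBelow h hS.isNested).2 ⟨R, hR, hRG.1.2, hxR⟩) (hle.trans hJS)
  obtain ⟨y, hy, hyJ⟩ := not_subset.1 hnot
  obtain ⟨Q, hQ, hQG, hyQ⟩ := (mem_joinBelow h hS'.isNested).1 hy
  obtain ⟨N, hN, hQN, hNG⟩ := hS'.isNested.exists_child h hQ (hDS' hGT) hQG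
  refine ⟨N, hN, hNG, fun hNd => hyJ ?_⟩
  exact (mem_joinBelow h hTn).2 ⟨N, hdesT hNd, hNG.1.2, hQN hyQ⟩

lemma empty_mem_gammaComplex (h : IsBuildingSet M 𝒢) : ∅ ∈ gammaComplex M 𝒢 := by
  obtain ⟨S, hS, -, hdes⟩ := (isNested_empty h).exists_fill h
  have hd : descentSet M S = ∅ := subset_empty_iff.1 hdes
  exact ⟨S, isStable_iff.2 ⟨hS, by simp [hd]⟩, hd.symm⟩

lemma isSimplicialComplexOn_gammaComplex (hc : IsComplete M 𝒢) (h : IsBuildingSet M 𝒢) :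
    IsSimplicialComplexOn (⋃₀ gammaComplex M 𝒢) (gammaComplex M 𝒢) := by
  have hdown : ∀ D ∈ gammaComplex M 𝒢, ∀ D' ⊆ D, D' ∈ gammaComplex M 𝒢 := by
    rintro D ⟨S, hS, rfl⟩ D' hD'
    exact hS.exists_descentSet_eq hc h hD'
  refine ⟨fun D hD => subset_sUnion_of_mem hD, empty_mem_gammaComplex h, hdown, ?_⟩
  rintro v ⟨D, hD, hv⟩
  exact hdown D hD _ (singleton_subset_iff.2 hv)

lemma sUnion_gammaComplex_subset (h : IsBuildingSet M 𝒢) :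
    ⋃₀ gammaComplex M 𝒢 ⊆ gammaVertices M 𝒢 := by
  rintro G ⟨_, ⟨S, hst, rfl⟩, hG⟩
  obtain ⟨hS, hst⟩ := isStable_iff.1 hst
  have hGS := descentSet_subset hG
  have hG𝒢 := hS.isNested.subset hGS
  refine ⟨hG𝒢, ?_⟩
  rintro ((hG0 | ⟨e, he, hGe⟩) | ⟨e, he, hGe⟩)
  · exact (h.nonempty G hG𝒢).ne_empty hG0
  · obtain ⟨_, P, hP, a, b, ha, hb, hba⟩ := hG
    have ha' := (isLabel_iff h hS hGS).1 ha
    have hb' := (isLabel_iff h hS hP.1.1).1 hb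
    rw [empty_union, sdiff_empty] at hGe
    -- For `G = cl {x ≤ e}` a label beyond `e` would put all these generators, hence `G`, in the
    -- join below `G`. Then the smaller parent label `b` is itself in `G`, which is impossible.
    have hae : a ≤ e := by
      by_contra! hlt
      obtain ⟨x, hxG, hxJ⟩ := hS.isNested.exists_notMem_joinBelow h hG𝒢
      have hsub : {x ∈ M.E | x ≤ e} ⊆ joinBelow M S G := fun y hy => by
        by_contra hyJ
        have hyG : y ∈ G := hGe ▸ M.subset_closure _ (sep_subset _ _) hy
        exact absurd (ha'.2 ⟨hyG, hyJ⟩) (hy.2.trans_lt hlt).not_ge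
      exact hxJ (closure_subset_of_isFlat isFlat_joinBelow hsub (hGe ▸ hxG))
    have hbE : b ∈ M.E := h.subset_ground (hS.isNested.subset hP.1.1) hb'.1.1
    have hbG : b ∈ G := hGe ▸ M.subset_closure _ (sep_subset _ _) ⟨hbE, (hba.trans_le hae).le⟩
    exact hb'.1.2 ((mem_joinBelow h hS.isNested).2 ⟨G, hGS, hP.1.2, hbG⟩)
  · obtain ⟨R, hR, hRG, -⟩ := hst G hG
    have hR𝒢 := hS.isNested.subset hR
    have := flat_eq_atom (h.isFlat R hR𝒢) (h.nonempty R hR𝒢) (hGe ▸ hRG.1.2.subset)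
    exact hRG.1.2.ne (this.trans hGe.symm)

/-- Fill `{v, E}`. The set `v` is a descent because it is not in the order chain, and it has an
ascending child because it is not an atom and is the only descent. -/
lemma gammaVertices_subset (hc : IsComplete M 𝒢) (h : IsBuildingSet M 𝒢) (hE : M.E ∈ 𝒢) :
    gammaVertices M 𝒢 ⊆ ⋃₀ gammaComplex M 𝒢 := by
  rintro v ⟨hv, hv'⟩
  simp only [mem_union, not_or] at hv'
  obtain ⟨hchain, hatom⟩ := hv'
  have hvE : v ⊂ M.E := by
    refine (h.subset_ground hv).ssubset_of_ne ?_
    rintro rfl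
    obtain ⟨e, he, hmax⟩ := exists_max_image M.E id M.ground_finite (h.nonempty _ hv)
    refine hchain (Or.inr ⟨e, ⟨he, notMem_empty _⟩, ?_⟩)
    have : {x ∈ M.E \ ∅ | x ≤ e} = M.E := by
      ext x
      simpa using hmax x
    rw [this, empty_union, M.closure_ground]
  obtain ⟨S, hS, hTS, hdes⟩ := (isNested_singleton hv).exists_fill h
  set T : Set (Set α) := {v} ∪ factors 𝒢 M.E with hT
  have hdesT : descentSet M S ⊆ T := hdes.trans subset_union_left
  have hTn := hS.isNested.mono hTS
  have hvT : v ∈ T := Or.inl rfl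
  have hET : M.E ∈ T := Or.inr ⟨⟨hE, Subset.rfl⟩, fun H hH _ => hH.2⟩
  have hcases : ∀ Q ∈ T, Q = v ∨ Q = M.E := by
    rintro Q (hQ | hQ)
    · exact Or.inl hQ
    · exact Or.inr (hQ.1.2.antisymm (hQ.2 ⟨hE, Subset.rfl⟩ hQ.1.2))
  have hpar : IsParent T v M.E := by
    refine ⟨⟨hET, hvE⟩, fun Q hQ => ?_⟩
    obtain rfl | rfl := hcases Q hQ.1
    · exact absurd hQ.2 (ssubset_irrefl _)
    · exact Subset.rfl
  have hJ : joinBelow M T v = ∅ := by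
    refine eq_empty_of_forall_notMem fun x hx => ?_
    obtain ⟨Q, hQ, hQv, -⟩ := (mem_joinBelow h hTn).1 hx
    obtain rfl | rfl := hcases Q hQ
    · exact ssubset_irrefl _ hQv
    · exact hQv.not_subset hvE.subset
  have hvS := hTS hvT
  obtain ⟨c, hlc⟩ := exists_isLabel h hS hvS
  have hc' := (isLabel_iff h hS hvS).1 hlc
  -- If every element smaller than the label `c` belonged to `v`, then `v` would be the closure of
  -- all elements up to `c`, a member of the chain.
  obtain ⟨b, hbE, hbv, hbc⟩ : ∃ b ∈ M.E, b ∉ v ∧ b < c := by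
    by_contra! hcon
    have hsub := subset_closure_label h hS hTS hdesT hvS
      (P := v) ⟨⟨hvT, Subset.rfl⟩, fun R hR => hR.2⟩ hlc
    rw [hJ] at hsub
    refine hchain (Or.inr ⟨c, ⟨hvE.subset hc'.1.1, notMem_empty _⟩, ?_⟩)
    refine subset_antisymm (hsub.trans (M.closure_subset_closure (union_subset_union_right _ ?_)))
      (closure_subset_of_isFlat (h.isFlat v hv) (union_subset (empty_subset _) ?_))
    · exact fun x hx => ⟨⟨hvE.subset hx.1, notMem_empty _⟩, hx.2⟩
    · rintro x ⟨⟨hxE, -⟩, hxc⟩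
      by_contra hxv
      exact hxv (le_antisymm hxc (hcon x hxE hxv) ▸ hc'.1.1)
  have hvd : v ∈ descentSet M S := by
    refine isDescent_of_lt hc h hS hTS hdesT hvT hpar hlc hbE (fun hcon => ?_) hbc
    obtain ⟨Q, hQ, hQE, hbQ⟩ := (mem_joinBelow h hTn).1 hcon
    obtain rfl | rfl := hcases Q hQ
    · exact hbv hbQ
    · exact ssubset_irrefl _ hQE
  have hdv : descentSet M S = {v} := hdes.antisymm (singleton_subset_iff.2 hvd)
  refine ⟨{v}, ⟨S, isStable_iff.2 ⟨hS, ?_⟩, hdv.symm⟩, rfl⟩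
  intro G hG
  rw [hdv] at hG ⊢
  obtain rfl : G = v := hG
  obtain ⟨x, hx⟩ : (joinBelow M S G).Nonempty := by
    by_contra hne
    rw [not_nonempty_iff_eq_empty] at hne
    have hcl := closure_insert_joinBelow h hS hvS hc'.1.1 hc'.1.2
    rw [hne] at hcl
    exact hatom ⟨c, hvE.subset hc'.1.1, by simpa using hcl.symm⟩
  obtain ⟨Q, hQ, hQv, -⟩ := (mem_joinBelow h hS.isNested).1 hx
  obtain ⟨R, hR, -, hRv⟩ := hS.isNested.exists_child h hQ hvS hQv
  refine ⟨R, hR, hRv, fun hRd => ?_⟩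
  obtain rfl : R = G := hRd
  exact ssubset_irrefl _ hRv.1.2

end BuiltMatroid
end

noncomputable section
namespace BuiltMatroid
open Set
set_option linter.unusedSectionVars false

/-! ### Generating function of exponents on paths. -/

section Paths

variable {β : Type*} (σ : β → Option β)

/-- Starting from `x`, the partial map `σ` can be iterated `n` times, through zeros of `d`. -/
def ZeroRun (d : β → ℕ) : ℕ → β → Prop
  | 0, _ => True
  | n + 1, x => ∃ y, σ x = some y ∧ d y = 0 ∧ ZeroRun d n y

/-- Exponents supported on `X`, nonzero on `D`, with a run of `d x` zeros below each `x`. -/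
structure IsRunExponent (X D : Finset β) (d : β →₀ ℕ) : Prop where
  mem_of_ne_zero : ∀ x, d x ≠ 0 → x ∈ X
  ne_zero_of_mem : ∀ x ∈ D, d x ≠ 0
  zeroRun : ∀ x, ZeroRun σ d (d x) x

variable {σ}

lemma zeroRun_congr {d d' : β → ℕ} {Y : Set β}
    (hY : ∀ x ∈ Y, ∀ y, σ x = some y → y ∈ Y ∧ d y = d' y) {x : β} (hx : x ∈ Y) (n : ℕ) :
    ZeroRun σ d n x ↔ ZeroRun σ d' n x := by
  induction n generalizing x with
  | zero => rfl
  | succ n ih =>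
    refine exists_congr fun y => and_congr_right fun hy => ?_
    obtain ⟨hyY, hyd⟩ := hY x hx y hy
    rw [hyd, ih hyY]

open Polynomial in
/-- The generating function of run exponents on a disjoint union of paths. -/
lemma exists_finset_isRunExponent [DecidableEq β]
    (hinj : ∀ x y z, σ x = some z → σ y = some z → x = y)
    (ht : β → ℕ) (hht : ∀ x y, σ x = some y → ht y < ht x) (X D : Finset β) (hDX : D ⊆ X)
    (hX : ∀ x ∈ X, ∀ y, σ x = some y → y ∈ X) (hD : ∀ x y, σ x = some y → y ∉ D) :
    ∃ Φ : Finset (β →₀ ℕ), (∀ d, d ∈ Φ ↔ IsRunExponent σ X D d) ∧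
      ∑ d ∈ Φ, (Polynomial.X : ℤ[X]) ^ d.degree =
        ∏ x ∈ X, ((if x ∈ D then 0 else 1) + (if (σ x).isSome then (Polynomial.X : ℤ[X]) else 0)) := by
  classical
  induction hn : X.card using Nat.strong_induction_on generalizing X D with
  | _ n ih =>
    obtain rfl | hne := X.eq_empty_or_nonempty
    · obtain rfl := Finset.subset_empty.1 hDX
      refine ⟨{0}, fun d => ?_, by simp⟩
      rw [Finset.mem_singleton]
      constructor
      · rintro rfl
        exact ⟨by simp, by simp, fun x => trivial⟩
      · intro hd
        ext x
        by_contra hx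
        exact absurd (hd.1 x hx) (Finset.notMem_empty x)
    -- An element of greatest height is the start of a path, so removing it leaves `X` closed under
    -- `σ` and affects no other run condition.
    obtain ⟨q, hq, hmax⟩ := X.exists_max_image ht hne
    have hqtop : ∀ x ∈ X, σ x ≠ some q := fun x hx hxq =>
      absurd (hht x q hxq) (hmax x hx).not_gt
    obtain ⟨Φ, hΦ, hsum⟩ := ih (X.erase q).card (hn ▸ Finset.card_erase_lt_of_mem hq) (X.erase q)
      (D.erase q) (Finset.erase_subset_erase q hDX)
      (fun x hx y hxy => Finset.mem_erase.2 ⟨fun hyq => hqtop x (Finset.mem_of_mem_erase hx)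
        (hyq ▸ hxy), hX x (Finset.mem_of_mem_erase hx) y hxy⟩)
      (fun x y hxy hy => hD x y hxy (Finset.mem_of_mem_erase hy)) rfl
    have hΦq : ∀ d ∈ Φ, d q = 0 := fun d hd => by
      by_contra hne
      exact Finset.notMem_erase q X (((hΦ d).1 hd).1 q hne)
    have hzero : ∀ d : β →₀ ℕ, d q = 0 ∧ IsRunExponent σ X D d ↔ q ∉ D ∧ d ∈ Φ := by
      intro d
      rw [hΦ]
      constructor
      · rintro ⟨hdq, hd⟩
        refine ⟨fun hqD => hd.2 q hqD hdq, fun x hx => ?_, fun x hx =>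
          hd.2 x (Finset.mem_of_mem_erase hx), hd.3⟩
        exact Finset.mem_erase.2 ⟨fun hxq => hx (hxq ▸ hdq), hd.1 x hx⟩
      · rintro ⟨hqD, hd⟩
        refine ⟨?_, fun x hx => Finset.mem_of_mem_erase (hd.1 x hx), fun x hx =>
          hd.2 x (Finset.mem_erase.2 ⟨fun hxq => hqD (hxq ▸ hx), hx⟩), hd.3⟩
        by_contra hne
        exact Finset.notMem_erase q X (hd.1 q hne)
    have hprod : ∏ x ∈ X.erase q, ((if x ∈ D.erase q then 0 else 1) +
        (if (σ x).isSome then (Polynomial.X : ℤ[X]) else 0)) =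
        ∏ x ∈ X.erase q, ((if x ∈ D then 0 else 1) +
        (if (σ x).isSome then (Polynomial.X : ℤ[X]) else 0)) := by
      refine Finset.prod_congr rfl fun x hx => ?_
      simp [Finset.mem_erase, (Finset.mem_erase.1 hx).1]
    rw [hprod] at hsum
    rw [← Finset.mul_prod_erase X _ hq, ← hsum]
    obtain hσ | ⟨r, hσ⟩ : σ q = none ∨ ∃ r, σ q = some r := by
      cases h : σ q <;> simp
    · have hdq : ∀ d, IsRunExponent σ X D d → d q = 0 := by
        intro d hd
        by_contra hne
        obtain ⟨m, hm⟩ := Nat.exists_eq_succ_of_ne_zero hne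
        have := hd.3 q
        rw [hm] at this
        obtain ⟨y, hy, -⟩ := this
        simp [hσ] at hy
      refine ⟨if q ∈ D then ∅ else Φ, fun d => ?_, ?_⟩
      · split_ifs with hqD
        · simp only [Finset.notMem_empty, false_iff]
          exact fun hd => hd.2 q hqD (hdq d hd)
        · exact ⟨fun hd => ((hzero d).2 ⟨hqD, hd⟩).2, fun hd => ((hzero d).1 ⟨hdq d hd, hd⟩).2⟩
      · by_cases hqD : q ∈ D <;> simp [hqD, hσ]
    · have hrX : r ∈ X := hX q hq r hσ
      have hrq : r ≠ q := fun hrq => hqtop q hq (hrq ▸ hσ)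
      have hrD : r ∉ D := hD q r hσ
      -- An exponent `m + 1` at `q` demands a zero at its successor `r` and a run of `m` zeros after
      -- `r`. This is the condition for an exponent `m` placed at `r` itself. Moving it up raises
      -- the degree by one, whence the factor `X` contributed by `q`.
      let up : (β →₀ ℕ) → (β →₀ ℕ) := fun d => (d.update r 0).update q (d r + 1)
      have hup : ∀ d x, up d x = if x = q then d r + 1 else if x = r then 0 else d x := by
        intro d x
        simp only [up, Finsupp.update_apply]
      have hrun : ∀ d x n, x ∈ X → x ≠ q → (ZeroRun σ (up d) n x ↔ ZeroRun σ d n x) := by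
        intro d x n hx hxq
        refine zeroRun_congr (Y := {x | x ∈ X ∧ x ≠ q}) ?_ ⟨hx, hxq⟩ n
        rintro x ⟨hx, hxq⟩ y hxy
        have hyq : y ≠ q := fun hyq => hqtop x hx (hyq ▸ hxy)
        have hyr : y ≠ r := fun hyr => hxq (hinj x q r (hyr ▸ hxy) hσ)
        exact ⟨⟨hX x hx y hxy, hyq⟩, by simp [hup, hyq, hyr]⟩
      have hpos : ∀ d, (d q ≠ 0 ∧ IsRunExponent σ X D d) ↔ d ∈ Φ.image up := by
        intro d
        rw [Finset.mem_image]
        constructor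
        · rintro ⟨hdq, hd⟩
          obtain ⟨m, hm⟩ := Nat.exists_eq_succ_of_ne_zero hdq
          have hq3 := hd.3 q
          rw [hm] at hq3
          obtain ⟨y, hy, hdy, hq3⟩ := hq3
          obtain rfl : y = r := Option.some_injective _ (hy.symm.trans hσ)
          let d' : β →₀ ℕ := (d.update q 0).update y m
          have hd' : ∀ x, d' x = if x = y then m else if x = q then 0 else d x := by
            intro x
            simp only [d', Finsupp.update_apply]
          have hupd : up d' = d := by
            ext x
            rw [hup, hd', hd']
            simp only [if_true]
            split_ifs with h1 h2
            · rw [h1, hm]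
            · rw [h2, hdy]
            · rfl
          refine ⟨d', ?_, hupd⟩
          rw [hΦ]
          refine ⟨fun x hx => ?_, fun x hx => ?_, fun x => ?_⟩
          · rw [hd'] at hx
            split_ifs at hx with h1 h2
            · exact h1 ▸ Finset.mem_erase.2 ⟨hrq, hrX⟩
            · exact absurd rfl hx
            · exact Finset.mem_erase.2 ⟨h2, hd.1 x hx⟩
          · obtain ⟨hxq, hxD⟩ := Finset.mem_erase.1 hx
            rw [hd', if_neg (fun hxy : x = y => hrD (hxy ▸ hxD)), if_neg hxq]
            exact hd.2 x hxD
          · rw [hd']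
            split_ifs with h1 h2
            · rw [h1, ← hrun d' y m hrX hrq, hupd]
              exact hq3
            · trivial
            · by_cases hx : x ∈ X
              · rw [← hrun d' x _ hx h2, hupd]
                exact hd.3 x
              · have : d x = 0 := by
                  by_contra hne
                  exact hx (hd.1 x hne)
                rw [this]
                trivial
        · rintro ⟨d', hd', rfl⟩
          have hq0 := hΦq d' hd'
          rw [hΦ] at hd'
          refine ⟨by simp [hup], fun x hx => ?_, fun x hx => ?_, fun x => ?_⟩
          · rw [hup] at hx
            split_ifs at hx with h1 h2
            · exact h1 ▸ hq
            · exact absurd rfl hx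
            · exact Finset.mem_of_mem_erase (hd'.1 x hx)
          · rw [hup]
            split_ifs with h1 h2
            · simp
            · exact absurd (h2 ▸ hx) hrD
            · exact hd'.2 x (Finset.mem_erase.2 ⟨h1, hx⟩)
          · by_cases h1 : x = q
            · subst h1
              have : up d' x = d' r + 1 := by simp [hup]
              rw [this]
              exact ⟨r, hσ, by simp [hup, hrq], (hrun d' r _ hrX hrq).2 (hd'.3 r)⟩
            · by_cases hx : x ∈ X
              · rw [hrun d' x _ hx h1, hup, if_neg h1]
                split_ifs with h2
                · trivial
                · exact hd'.3 x
              · have : up d' x = 0 := by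
                  rw [hup, if_neg h1]
                  split_ifs
                  · rfl
                  · by_contra hne
                    exact hx (Finset.mem_of_mem_erase (hd'.1 x hne))
                rw [this]
                trivial
      have hinjOn : Set.InjOn up Φ := by
        intro d hd d' hd' heq
        have hpt : ∀ x, up d x = up d' x := fun x => by rw [heq]
        ext x
        have h1 := hpt q
        simp only [hup, if_true] at h1
        have h2 := hpt x
        rw [hup, hup] at h2
        split_ifs at h2 with h3 h4
        · rw [h3, hΦq d hd, hΦq d' hd']
        · rw [h4]
          omega
        · exact h2
      have hdeg : ∀ d ∈ Φ, (up d).degree = d.degree + 1 := by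
        intro d hd
        have : up d + Finsupp.single r (d r) = d + Finsupp.single q (d r + 1) := by
          ext x
          rw [Finsupp.add_apply, Finsupp.add_apply, hup, Finsupp.single_apply, Finsupp.single_apply]
          by_cases h1 : x = q
          · subst h1
            simp [hrq, hΦq d hd]
          · by_cases h2 : x = r
            · subst h2
              simp [hrq.symm, h1]
            · simp [h1, h2, Ne.symm h1, Ne.symm h2]
        have := congrArg Finsupp.degree this
        simp only [map_add, Finsupp.degree_single] at this
        omega
      have hsumup : ∑ d ∈ Φ.image up, (Polynomial.X : ℤ[X]) ^ d.degree =
          Polynomial.X * ∑ d ∈ Φ, (Polynomial.X : ℤ[X]) ^ d.degree := by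
        rw [Finset.sum_image hinjOn, Finset.mul_sum]
        exact Finset.sum_congr rfl fun d hd => by rw [hdeg d hd, pow_succ']
      refine ⟨(if q ∈ D then ∅ else Φ) ∪ Φ.image up, fun d => ?_, ?_⟩
      · rw [Finset.mem_union, ← hpos]
        have h1 : d ∈ (if q ∈ D then ∅ else Φ) ↔ d q = 0 ∧ IsRunExponent σ X D d := by
          rw [hzero]
          split_ifs with hqD <;> simp [hqD]
        rw [h1]
        tauto
      · rw [Finset.sum_union, hsumup, hσ]
        · by_cases hqD : q ∈ D <;> simp [hqD, add_mul]
        · rw [Finset.disjoint_left]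
          intro d hd hd'
          have := ((hpos d).2 hd').1
          split_ifs at hd with hqD
          · exact absurd hd (Finset.notMem_empty d)
          · exact this (hΦq d hd)

end Paths

/-! ### The rank function with natural values. -/

section Rank

variable {α : Type*} {M : Matroid α} [M.Finite] {X Y F G : Set α}

/-- The rank function with values in `ℕ`. -/
def rk (M : Matroid α) (X : Set α) : ℕ := (M.eRk X).toNat

lemma coe_rk (M : Matroid α) [M.Finite] (X : Set α) : (rk M X : ℕ∞) = M.eRk X :=
  ENat.natCast_toNat (M.eRk_ne_top_iff.2 (M.isRkFinite_set X))

lemma rk_mono (h : X ⊆ Y) : rk M X ≤ rk M Y := by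
  have := M.eRk_mono h
  rw [← coe_rk, ← coe_rk] at this
  exact_mod_cast this

lemma rk_closure (X : Set α) : rk M (M.closure X) = rk M X := by
  rw [rk, M.eRk_closure_eq, rk]

lemma rk_submod (X Y : Set α) : rk M (X ∩ Y) + rk M (X ∪ Y) ≤ rk M X + rk M Y := by
  have := M.eRk_inter_add_eRk_union_le X Y
  simp only [← coe_rk] at this
  exact_mod_cast this

lemma rk_insert {a : α} (ha : a ∈ M.E) (haX : a ∉ M.closure X) : rk M (insert a X) = rk M X + 1 := by
  have := M.eRk_insert_eq_add_one (X := X) ⟨ha, haX⟩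
  simp only [← coe_rk] at this
  exact_mod_cast this

lemma rk_insert_le (a : α) (X : Set α) : rk M (insert a X) ≤ rk M X + 1 := by
  have := M.eRk_insert_le_add_one a X
  simp only [← coe_rk] at this
  exact_mod_cast this

lemma rk_lt_rk (hF : M.IsFlat F) (hFG : F ⊂ G) (hG : G ⊆ M.E) : rk M F < rk M G := by
  obtain ⟨a, haG, haF⟩ := exists_of_ssubset hFG
  have h1 := rk_insert (M := M) (X := F) (hG haG) (by rwa [hF.closure])
  have h2 := rk_mono (M := M) (insert_subset haG hFG.subset)
  omega

lemma rk_empty (M : Matroid α) : rk M ∅ = 0 := by simp [rk]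

end Rank

end BuiltMatroid
end

noncomputable section
namespace BuiltMatroid
open Set
set_option linter.unusedSectionVars false

/-! ### Ranks in maximal nested sets, and Feichtner–Yuzvinsky exponents. -/

section Count

variable {α : Type*} {M : Matroid α} {𝒢 S T A D X : Set (Set α)}
  {F G H K P Q R R' Z J : Set α} [M.Finite] [M.Loopless]

/-- In a maximal nested set, the rank of the join of a lower set is its number of elements. -/
lemma rk_join_eq_ncard (h : IsBuildingSet M 𝒢) (hS : IsMaxNested M 𝒢 S) (hXS : X ⊆ S)
    (hX : ∀ G ∈ X, ∀ H ∈ S, H ⊆ G → H ∈ X) : rk M (join M X) = X.ncard := by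
  have hfin := (hS.isNested.finite h).subset hXS
  induction hn : X.ncard using Nat.strong_induction_on generalizing X with
  | _ n ih =>
    obtain rfl | hne := X.eq_empty_or_nonempty
    · rw [join_empty, rk_empty, ← hn, ncard_empty]
    obtain ⟨G, hG⟩ := hfin.exists_maximal hne
    have hGS := hXS hG.1
    have hX'S : X \ {G} ⊆ S := sdiff_subset.trans hXS
    have hX'n := hS.isNested.mono hX'S
    have hcard : (X \ {G}).ncard + 1 = X.ncard := ncard_sdiff_singleton_add_one hG.1 hfin
    have hlow : ∀ Q ∈ S, Q ⊂ G → Q ∈ X \ {G} := fun Q hQ hQG => ⟨hX G hG.1 Q hQ hQG.subset, hQG.ne⟩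
    have hr := ih _ (by omega) hX'S (fun Q hQ H hH hHQ => ⟨hX Q hQ.1 H hH hHQ, by
      rintro rfl
      exact hQ.2 (hHQ.antisymm (hG.2 hQ.1 hHQ)).symm⟩) (hfin.subset sdiff_subset) rfl
    obtain ⟨a, haG, haJ⟩ := hS.isNested.exists_notMem_joinBelow h (hS.isNested.subset hGS)
    have hcl := closure_insert_joinBelow h hS hGS haG haJ
    have haE : a ∈ M.E := h.subset_ground (hS.isNested.subset hGS) haG
    have hJ : joinBelow M S G ⊆ join M (X \ {G}) := join_mono fun Q hQ => hlow Q hQ.1 hQ.2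
    have haX : a ∉ join M (X \ {G}) := by
      intro hcon
      obtain ⟨Q, hQ, haQ⟩ := hS.isNested.mem_of_mem_join h hX'S hcon
      obtain hle | hle := hS.isNested.subset_or_subset h hGS (hX'S hQ) haG haQ
      · exact hQ.2 ((hG.2 hQ.1 hle).antisymm hle)
      · exact haJ ((mem_joinBelow h hS.isNested).2 ⟨Q, hX'S hQ, hle.ssubset_of_ne hQ.2, haQ⟩)
    have hXE := h.sUnion_subset_ground (hXS.trans hS.isNested.subset)
    have hsubE : insert a (join M (X \ {G})) ⊆ M.E :=
      insert_subset haE (isFlat_join M _).subset_ground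
    have hjoin : join M X = M.closure (insert a (join M (X \ {G}))) := by
      apply subset_antisymm
      · refine join_subset (M.isFlat_closure _) fun Q hQ => ?_
        by_cases hQG : Q = G
        · rw [hQG]
          exact hcl.symm.subset.trans (M.closure_subset_closure (insert_subset_insert hJ))
        · exact (subset_join (A := X \ {G}) (fun b hb => hXE b hb.1) ⟨hQ, hQG⟩).trans
            ((subset_insert _ _).trans (M.subset_closure _ hsubE))
      · exact closure_subset_of_isFlat (isFlat_join M _)
          (insert_subset (subset_join hXE hG.1 haG) (join_mono sdiff_subset))
    rw [hjoin, rk_closure, rk_insert haE (by rwa [(isFlat_join M _).closure]), hr]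
    omega

lemma rk_eq_ncard (h : IsBuildingSet M 𝒢) (hS : IsMaxNested M 𝒢 S) (hG : G ∈ S) :
    rk M G = {K ∈ S | K ⊆ G}.ncard := by
  rw [← rk_join_eq_ncard h hS (sep_subset _ _) (fun Q hQ H hH hHQ => ⟨hH, hHQ.trans hQ.2⟩)]
  congr 1
  refine subset_antisymm ?_ (join_subset (h.isFlat G (hS.isNested.subset hG)) fun a ha => ha.2)
  exact subset_join (A := {K ∈ S | K ⊆ G})
    (fun a ha => h.subset_ground (hS.isNested.subset ha.1)) ⟨hG, Subset.rfl⟩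

lemma rk_joinBelow_eq_ncard (h : IsBuildingSet M 𝒢) (hS : IsMaxNested M 𝒢 S) (hT : T ⊆ S) :
    rk M (joinBelow M T G) = {K ∈ S | K ⊆ joinBelow M T G}.ncard := by
  rw [← rk_join_eq_ncard h hS (sep_subset _ _) (fun Q hQ H hH hHQ => ⟨hH, hHQ.trans hQ.2⟩)]
  congr 1
  refine subset_antisymm (join_mono fun Q hQ => ⟨hT hQ.1, ?_⟩)
    (join_subset isFlat_joinBelow fun a ha => ha.2)
  exact subset_join (A := {H ∈ T | H ⊂ G})
    (fun a ha => h.subset_ground (hS.isNested.subset (hT ha.1))) hQ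

lemma rk_ground_eq_ncard (h : IsBuildingSet M 𝒢) (hS : IsMaxNested M 𝒢 S) :
    rk M M.E = S.ncard := by
  rw [← rk_join_eq_ncard h hS Subset.rfl fun Q _ H hH _ => hH]
  congr 1
  refine subset_antisymm (fun x hx => ?_) (isFlat_join M S).subset_ground
  obtain ⟨K, hK, hxK⟩ := h.exists_mem_factor M.ground_isFlat hx
  exact subset_join (h.sUnion_subset_ground hS.isNested.subset) (hS.factors_subset h hK) hxK

lemma rk_eq_add_one (h : IsBuildingSet M 𝒢) (hS : IsMaxNested M 𝒢 S) (hT : T ⊆ S) (hG : G ∈ S)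
    (hall : ∀ R ∈ S, IsParent S R G → R ∈ T) : rk M G = rk M (joinBelow M T G) + 1 := by
  have hTn := hS.isNested.mono hT
  have hJ : joinBelow M S G = joinBelow M T G := by
    refine subset_antisymm (fun x hx => ?_) (joinBelow_mono hT)
    obtain ⟨Q, hQ, hQG, hxQ⟩ := (mem_joinBelow h hS.isNested).1 hx
    obtain ⟨R, hR, hQR, hRG⟩ := hS.isNested.exists_child h hQ hG hQG
    exact (mem_joinBelow h hTn).2 ⟨R, hall R hR hRG, hRG.1.2, hQR hxQ⟩
  obtain ⟨a, haG, haJ⟩ := hS.isNested.exists_notMem_joinBelow h (hS.isNested.subset hG)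
  have hcl := closure_insert_joinBelow h hS hG haG haJ
  have haE : a ∈ M.E := h.subset_ground (hS.isNested.subset hG) haG
  rw [← hJ, ← rk_insert haE (by rwa [isFlat_joinBelow.closure]), ← rk_closure (insert a _), hcl]

/-- The rank of `G` over the join of `T` counts the members of `S` below `G` but not below that
join. With a single child `R` outside `T`, these are the members counted for `R` together with `G`.
-/
lemma rk_add_rk_joinBelow (h : IsBuildingSet M 𝒢) (hS : IsMaxNested M 𝒢 S) (hT : T ⊆ S)
    (hR : R ∈ S) (hRT : R ∉ T) (hp : IsParent S R G)
    (hall : ∀ R' ∈ S, IsParent S R' G → R' ≠ R → R' ∈ T) :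
    rk M G + rk M (joinBelow M T R) = rk M R + rk M (joinBelow M T G) + 1 := by
  have hTn := hS.isNested.mono hT
  have hfin := hS.isNested.finite h
  have hsplit : ∀ G ∈ S, rk M G = rk M (joinBelow M T G) +
      {K ∈ S | K ⊆ G ∧ ¬ K ⊆ joinBelow M T G}.ncard := by
    intro G hG
    rw [rk_eq_ncard h hS hG, rk_joinBelow_eq_ncard h hS hT, ← ncard_union_eq
      (disjoint_left.2 fun K hK hK' => hK'.2.2 hK.2) (hfin.subset (sep_subset _ _))
      (hfin.subset (sep_subset _ _))]
    · congr 1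
      ext K
      have hJG := joinBelow_subset (M := M) (S := T) (h.isFlat G (hS.isNested.subset hG))
      simp only [mem_ofPred_eq, mem_union]
      constructor
      · rintro ⟨hK, hKG⟩
        by_cases hKJ : K ⊆ joinBelow M T G
        · exact Or.inl ⟨hK, hKJ⟩
        · exact Or.inr ⟨hK, hKG, hKJ⟩
      · rintro (⟨hK, hKJ⟩ | ⟨hK, hKG, -⟩)
        · exact ⟨hK, hKJ.trans hJG⟩
        · exact ⟨hK, hKG⟩
  have hG := hp.1.1
  have hblock : {K ∈ S | K ⊆ G ∧ ¬ K ⊆ joinBelow M T G} =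
      insert G {K ∈ S | K ⊆ R ∧ ¬ K ⊆ joinBelow M T R} := by
    ext K
    simp only [mem_ofPred_eq, mem_insert_iff]
    constructor
    · rintro ⟨hK, hKG, hKJ⟩
      obtain rfl | hne := hKG.eq_or_ssubset
      · exact Or.inl rfl
      obtain ⟨R', hR', hKR', hp'⟩ := hS.isNested.exists_child h hK hG hne
      by_cases hRR : R' = R
      · subst hRR
        refine Or.inr ⟨hK, hKR', fun hcon => hKJ (hcon.trans ?_)⟩
        exact join_mono fun Q hQ => ⟨hQ.1, hQ.2.trans hp.1.2⟩
      · refine absurd (fun x hx => ?_) hKJ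
        exact (mem_joinBelow h hTn).2 ⟨R', hall R' hR' hp' hRR, hp'.1.2, hKR' hx⟩
    · rintro (rfl | ⟨hK, hKR, hKJ⟩)
      · refine ⟨hG, Subset.rfl, fun hcon => ?_⟩
        obtain ⟨x, hx, hxJ⟩ := hTn.exists_notMem_joinBelow h (hS.isNested.subset hG)
        exact hxJ (hcon hx)
      · refine ⟨hK, hKR.trans hp.1.2.subset, fun hcon => hKJ ?_⟩
        have hK𝒢 := hS.isNested.subset hK
        obtain ⟨Q, hQ, hKQ⟩ := hTn.exists_subset h (sep_subset _ _) hK𝒢 hcon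
        obtain ⟨x, hx⟩ := h.nonempty K hK𝒢
        have hne : Q ≠ R := fun hQR => hRT (hQR ▸ hQ.1)
        obtain hle | hle := hS.isNested.subset_or_subset h (hT hQ.1) hR (hKQ hx) (hKR hx)
        · exact fun y hy => (mem_joinBelow h hTn).2 ⟨Q, hQ.1, hle.ssubset_of_ne hne, hKQ hy⟩
        · exact absurd (hp.2 ⟨hT hQ.1, hle.ssubset_of_ne hne.symm⟩) hQ.2.not_subset
  have h1 := hsplit G hG
  have h2 := hsplit R hR
  rw [hblock, ncard_insert_of_notMem (fun hcon => hp.1.2.not_subset hcon.2.1)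
    (hfin.subset (sep_subset _ _))] at h1
  omega

/-- The members of `𝒢` occurring in a monomial with exponents `d`. -/
def supportSet (d : 𝒢 →₀ ℕ) : Set (Set α) := Subtype.val '' (d.support : Set 𝒢)

lemma mem_supportSet {d : 𝒢 →₀ ℕ} {G : 𝒢} : G.1 ∈ supportSet d ↔ d G ≠ 0 := by
  simp [supportSet]

lemma supportSet_subset (d : 𝒢 →₀ ℕ) : supportSet d ⊆ 𝒢 := by
  rintro _ ⟨G, -, rfl⟩
  exact G.2

/-- The exponents of the Feichtner–Yuzvinsky monomials. -/
structure IsFYExponent (M : Matroid α) (𝒢 : Set (Set α)) (d : 𝒢 →₀ ℕ) : Prop where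
  isNested : IsNested M 𝒢 (supportSet d)
  lt_rk : ∀ G, d G ≠ 0 → rk M (joinBelow M (supportSet d) G.1) + d G < rk M G.1

end Count

/-! ### Counting exponents by stable nested sets. -/

section Stable

variable {α : Type*} [LinearOrder α] {M : Matroid α} {𝒢 S T A D X : Set (Set α)}
  {F H K P Q R R' Z J : Set α} [M.Finite] [M.Loopless]

open Classical in
/-- A child of `G` in `S` that is not a descent, if there is one. -/
def ascentChild (M : Matroid α) (𝒢 S : Set (Set α)) (G : 𝒢) : Option 𝒢 :=
  if h : ∃ R : 𝒢, R.1 ∈ S ∧ IsParent S R.1 G.1 ∧ R.1 ∉ descentSet M S then some h.choose else none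

lemma ascentChild_eq_some (hc : IsComplete M 𝒢) (h : IsBuildingSet M 𝒢) (hS : IsMaxNested M 𝒢 S)
    {G R : 𝒢} : ascentChild M 𝒢 S G = some R ↔
      R.1 ∈ S ∧ IsParent S R.1 G.1 ∧ R.1 ∉ descentSet M S := by
  rw [ascentChild]
  split_ifs with hex
  · rw [Option.some_inj]
    have hch := hex.choose_spec
    constructor
    · rintro rfl
      exact hch
    · intro hR
      exact Subtype.ext (eq_of_not_isDescent hc h hS hch.1 hR.1 hch.2.1 hR.2.1 hch.2.2 hR.2.2)
  · simp only [false_iff]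
    exact fun hR => hex ⟨R, hR⟩

lemma ascentChild_eq_none {G : 𝒢} : ascentChild M 𝒢 S G = none ↔
    ∀ R : 𝒢, R.1 ∈ S → IsParent S R.1 G.1 → R.1 ∈ descentSet M S := by
  rw [ascentChild]
  split_ifs with hex
  · simp only [false_iff]
    push Not
    exact hex
  · exact iff_of_true rfl fun R hR hp => by_contra fun hnd => hex ⟨R, hR, hp, hnd⟩

/-- Passing to the ascending child lowers the available rank by one as long as that child has
exponent zero. If there is no such child or its exponent is nonzero, all children lie in the support
and the rank over their join is one, so no further step is possible. -/
lemma zeroRun_iff (hc : IsComplete M 𝒢) (h : IsBuildingSet M 𝒢) (hS : IsMaxNested M 𝒢 S)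
    {d : 𝒢 →₀ ℕ} (hdS : supportSet d ⊆ S) (hdes : descentSet M S ⊆ supportSet d) (n : ℕ) {G : 𝒢}
    (hG : G.1 ∈ S) : ZeroRun (ascentChild M 𝒢 S) d n G ↔
      rk M (joinBelow M (supportSet d) G.1) + n < rk M G.1 := by
  induction n generalizing G with
  | zero =>
    have hTn := hS.isNested.mono hdS
    obtain ⟨x, hx, hxJ⟩ := hTn.exists_notMem_joinBelow h G.2
    simp only [ZeroRun, add_zero, true_iff]
    exact rk_lt_rk isFlat_joinBelow ⟨joinBelow_subset (h.isFlat _ G.2), fun hcon => hxJ (hcon hx)⟩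
      (h.subset_ground G.2)
  | succ n ih =>
    rw [ZeroRun]
    obtain hnone | ⟨R, hR⟩ : ascentChild M 𝒢 S G = none ∨ ∃ R, ascentChild M 𝒢 S G = some R := by
      cases hσ : ascentChild M 𝒢 S G <;> simp
    · have hr := rk_eq_add_one h hS hdS hG fun R hR hp =>
        hdes (ascentChild_eq_none.1 hnone ⟨R, hS.isNested.subset hR⟩ hR hp)
      simp only [hnone, reduceCtorEq, false_and, exists_false, false_iff]
      omega
    · obtain ⟨hRS, hp, hnd⟩ := (ascentChild_eq_some hc h hS).1 hR
      simp only [hR, Option.some_inj, exists_eq_left']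
      have hall : ∀ R' ∈ S, IsParent S R' G.1 → R' ≠ R.1 → R' ∈ supportSet d := by
        intro R' hR' hp' hne
        by_contra hcon
        exact hne (eq_of_not_isDescent hc h hS hR' hRS hp' hp (fun hd => hcon (hdes hd)) hnd)
      by_cases hRd : d R = 0
      · have := rk_add_rk_joinBelow h hS hdS hRS (fun hcon => mem_supportSet.1 hcon hRd) hp hall
        rw [ih hRS]
        simp only [hRd, true_and]
        omega
      · have hr := rk_eq_add_one h hS hdS hG fun R' hR' hp' => by
          by_cases hne : R' = R.1
          · exact hne ▸ mem_supportSet.2 hRd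
          · exact hall R' hR' hp' hne
        simp only [hRd, false_and, false_iff]
        omega

open Polynomial Classical in
/-- The generating function of the Feichtner–Yuzvinsky exponents attached to `S`. -/
lemma exists_finset_isFYExponent_of_isMaxNested [Fintype 𝒢] (hc : IsComplete M 𝒢)
    (h : IsBuildingSet M 𝒢) (hS : IsMaxNested M 𝒢 S) :
    ∃ Φ : Finset (𝒢 →₀ ℕ), (∀ d, d ∈ Φ ↔ IsFYExponent M 𝒢 d ∧ supportSet d ⊆ S ∧
      descentSet M S ⊆ supportSet d) ∧
      ∑ d ∈ Φ, (Polynomial.X : ℤ[X]) ^ d.degree =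
        ∏ G : 𝒢 with G.1 ∈ S, ((if G.1 ∈ descentSet M S then 0 else 1) +
          (if (ascentChild M 𝒢 S G).isSome then (Polynomial.X : ℤ[X]) else 0)) := by
  have hdS : descentSet M S ⊆ S := descentSet_subset
  obtain ⟨Φ, hΦ, hsum⟩ := exists_finset_isRunExponent (σ := ascentChild M 𝒢 S)
    (fun x y z hx hy => by
      have hx' := (ascentChild_eq_some hc h hS).1 hx
      have hy' := (ascentChild_eq_some hc h hS).1 hy
      exact Subtype.ext (hx'.2.1.unique hy'.2.1))
    (fun x => x.1.ncard)
    (fun x y hxy => ncard_lt_ncard ((ascentChild_eq_some hc h hS).1 hxy).2.1.1.2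
      (M.ground_finite.subset (h.subset_ground x.2)))
    ({G : 𝒢 | G.1 ∈ S} : Finset 𝒢) ({G : 𝒢 | G.1 ∈ descentSet M S} : Finset 𝒢)
    (fun x hx => by simpa using hdS (by simpa using hx))
    (fun x _ y hxy => by simpa using ((ascentChild_eq_some hc h hS).1 hxy).1)
    (fun x y hxy => by simpa using ((ascentChild_eq_some hc h hS).1 hxy).2.2)
  refine ⟨Φ, fun d => ?_, ?_⟩
  · rw [hΦ]
    constructor
    · intro hd
      have h1 : supportSet d ⊆ S := by
        rintro _ ⟨G, hG, rfl⟩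
        simpa using hd.1 G (by simpa using hG)
      have h2 : descentSet M S ⊆ supportSet d := fun G hG =>
        mem_supportSet (G := ⟨G, hS.isNested.subset (hdS hG)⟩).2 (hd.2 _ (by simpa using hG))
      exact ⟨⟨hS.isNested.mono h1, fun G hG => (zeroRun_iff hc h hS h1 h2 _
        (h1 (mem_supportSet.2 hG))).1 (hd.3 G)⟩, h1, h2⟩
    · rintro ⟨hd, h1, h2⟩
      refine ⟨fun G hG => ?_, fun G hG => ?_, fun G => ?_⟩
      · simpa using h1 (mem_supportSet.2 hG)
      · exact mem_supportSet.1 (h2 (by simpa using hG))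
      · by_cases hG : d G = 0
        · rw [hG]
          trivial
        · exact (zeroRun_iff hc h hS h1 h2 _ (h1 (mem_supportSet.2 hG))).2 (hd.2 G hG)
  · rw [hsum]
    simp only [Finset.mem_filter, Finset.mem_univ, true_and]

lemma card_filter_mem [Fintype 𝒢] [DecidablePred fun G : 𝒢 => G.1 ∈ S] (hS : S ⊆ 𝒢) :
    (Finset.univ.filter fun G : 𝒢 => G.1 ∈ S).card = S.ncard := by
  have : S = Subtype.val '' ((Finset.univ.filter fun G : 𝒢 => G.1 ∈ S : Finset 𝒢) : Set 𝒢) := by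
    ext G
    simp only [Finset.coe_filter, Finset.mem_univ, true_and, mem_image, mem_ofPred_eq,
      Subtype.exists, exists_and_left, exists_prop, exists_eq_right_right]
    exact ⟨fun hG => ⟨hG, hS hG⟩, fun hG => hG.1⟩
  conv_rhs => rw [this]
  rw [ncard_image_of_injective _ Subtype.val_injective, ncard_coe_finset]

open Classical in
/-- In a maximal nested set, the members with an ascending child are as many as those that are
neither descents nor maximal. -/
lemma card_ascentChild [Fintype 𝒢] (hc : IsComplete M 𝒢) (h : IsBuildingSet M 𝒢)
    (hS : IsMaxNested M 𝒢 S) :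
    (Finset.univ.filter fun G : 𝒢 => G.1 ∈ S ∧ (ascentChild M 𝒢 S G).isSome).card +
      (descentSet M S).ncard + (factors 𝒢 M.E).ncard = rk M M.E := by
  have hdS : descentSet M S ⊆ S := descentSet_subset
  have hcard : (Finset.univ.filter fun G : 𝒢 => G.1 ∈ S ∧ (ascentChild M 𝒢 S G).isSome).card =
      (Finset.univ.filter fun G : 𝒢 => G.1 ∈ S \ (descentSet M S ∪ factors 𝒢 M.E)).card := by
    refine Finset.card_bij (fun G hG => (ascentChild M 𝒢 S G).get (by simpa using
      (Finset.mem_filter.1 hG).2.2)) (fun G hG => ?_) (fun G hG G' hG' heq => ?_)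
      (fun R hR => ?_)
    · obtain ⟨R, hR⟩ := Option.isSome_iff_exists.1 (Finset.mem_filter.1 hG).2.2
      simp only [hR, Option.get_some]
      obtain ⟨hRS, hp, hnd⟩ := (ascentChild_eq_some hc h hS).1 hR
      simp only [Finset.mem_filter, Finset.mem_univ, true_and]
      refine ⟨hRS, ?_⟩
      rintro (hcon | hcon)
      · exact hnd hcon
      · exact hp.1.2.not_subset (hcon.2 ⟨G.2, h.subset_ground G.2⟩ hp.1.2.subset)
    · obtain ⟨R, hR⟩ := Option.isSome_iff_exists.1 (Finset.mem_filter.1 hG).2.2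
      obtain ⟨R', hR'⟩ := Option.isSome_iff_exists.1 (Finset.mem_filter.1 hG').2.2
      simp only [hR, hR', Option.get_some] at heq
      subst heq
      exact Subtype.ext (((ascentChild_eq_some hc h hS).1 hR).2.1.unique
        ((ascentChild_eq_some hc h hS).1 hR').2.1)
    · obtain ⟨hRS, hRn⟩ := (Finset.mem_filter.1 hR).2
      simp only [mem_union, not_or] at hRn
      obtain ⟨K, hK, hRK⟩ := h.exists_factor R.2 (h.subset_ground R.2)
      obtain ⟨P, hP⟩ := hS.isNested.exists_isParent h hRS ⟨K, hS.factors_subset h hK,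
        hRK.ssubset_of_ne (fun hRK => hRn.2 (hRK ▸ hK))⟩
      have hσ : ascentChild M 𝒢 S ⟨P, hS.isNested.subset hP.1.1⟩ = some R :=
        (ascentChild_eq_some hc h hS).2 ⟨hRS, hP, hRn.1⟩
      exact ⟨⟨P, hS.isNested.subset hP.1.1⟩, by simp [hσ, hP.1.1], by simp [hσ]⟩
  have hfin := hS.isNested.finite h
  have hdisj : Disjoint (descentSet M S) (factors 𝒢 M.E) :=
    disjoint_left.2 fun G hG hG' => not_isDescent_of_mem_factors h hS.isNested hG' hG
  rw [hcard, card_filter_mem (sdiff_subset.trans hS.isNested.subset), add_assoc, ← ncard_union_eq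
      hdisj (hfin.subset hdS) (hfin.subset (hS.factors_subset h)),
    rk_ground_eq_ncard h hS, ncard_sdiff_add_ncard_of_subset
      (union_subset hdS (hS.factors_subset h)) hfin]

/-- In a stable set the descents are among the members with an ascending child; combine with the
count of the latter. -/
lemma IsStable.two_mul_ncard_descentSet_le (hc : IsComplete M 𝒢) (h : IsBuildingSet M 𝒢)
    (hS : IsStable M 𝒢 S) :
    2 * (descentSet M S).ncard + (factors 𝒢 M.E).ncard ≤ rk M M.E := by
  classical
  obtain ⟨hS, hst⟩ := isStable_iff.1 hS
  let _ := h.finite.fintype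
  have hcard := card_ascentChild hc h hS
  rw [← card_filter_mem (descentSet_subset.trans hS.isNested.subset)] at hcard ⊢
  have : (Finset.univ.filter fun G : 𝒢 => G.1 ∈ descentSet M S).card ≤
      (Finset.univ.filter fun G : 𝒢 => G.1 ∈ S ∧ (ascentChild M 𝒢 S G).isSome).card := by
    refine Finset.card_le_card fun G hG => ?_
    simp only [Finset.mem_filter, Finset.mem_univ, true_and] at hG ⊢
    obtain ⟨R, hR, hp, hnd⟩ := hst G.1 hG
    have hσ : ascentChild M 𝒢 S G = some ⟨R, hS.isNested.subset hR⟩ :=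
      (ascentChild_eq_some hc h hS).2 ⟨hR, hp, hnd⟩
    exact ⟨descentSet_subset hG, by simp [hσ]⟩
  omega

-- By stability a descent has an ascending child and contributes `X`. Every other member contributes
-- `1 + X` or `1` according to whether it has an ascending child, and `card_ascentChild` counts the
-- former.
open Polynomial Classical in
lemma prod_ascentChild_of_isStable [Fintype 𝒢] (hc : IsComplete M 𝒢)
    (h : IsBuildingSet M 𝒢) (hS : IsStable M 𝒢 S) :
    ∏ G : 𝒢 with G.1 ∈ S, ((if G.1 ∈ descentSet M S then 0 else 1) +
      (if (ascentChild M 𝒢 S G).isSome then (Polynomial.X : ℤ[X]) else 0)) =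
      Polynomial.X ^ (descentSet M S).ncard *
        (1 + Polynomial.X) ^ (rk M M.E - (factors 𝒢 M.E).ncard - 2 * (descentSet M S).ncard) := by
  have hle := hS.two_mul_ncard_descentSet_le hc h
  obtain ⟨hS, hst⟩ := isStable_iff.1 hS
  have hdS : descentSet M S ⊆ S := descentSet_subset
  have hcard := card_ascentChild hc h hS
  have hsome : ∀ G : 𝒢, G.1 ∈ descentSet M S → (ascentChild M 𝒢 S G).isSome := by
    intro G hG
    obtain ⟨R, hR, hp, hnd⟩ := hst G.1 hG
    rw [(ascentChild_eq_some hc h hS (R := ⟨R, hS.isNested.subset hR⟩)).2 ⟨hR, hp, hnd⟩]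
    rfl
  have hterm : ∀ G : 𝒢, ((if G.1 ∈ descentSet M S then 0 else 1) +
      (if (ascentChild M 𝒢 S G).isSome then (Polynomial.X : ℤ[X]) else 0)) =
      (if G.1 ∈ descentSet M S then (Polynomial.X : ℤ[X]) else 1) *
        (if (ascentChild M 𝒢 S G).isSome ∧ G.1 ∉ descentSet M S then 1 + Polynomial.X else 1) := by
    intro G
    by_cases h1 : G.1 ∈ descentSet M S
    · simp [h1, hsome G h1]
    · by_cases h2 : (ascentChild M 𝒢 S G).isSome <;> simp [h1, h2]
  simp only [hterm]
  rw [Finset.prod_mul_distrib, Finset.prod_ite, Finset.prod_ite]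
  simp only [Finset.prod_const, one_pow, mul_one, Finset.filter_filter]
  have h1 : (Finset.univ.filter fun G : 𝒢 => G.1 ∈ S ∧ G.1 ∈ descentSet M S).card =
      (descentSet M S).ncard := by
    rw [← card_filter_mem (hdS.trans hS.isNested.subset)]
    congr 1
    ext G
    simp only [Finset.mem_filter, Finset.mem_univ, true_and, and_iff_right_iff_imp]
    exact fun hG => hdS hG
  have h2 : (Finset.univ.filter fun G : 𝒢 => G.1 ∈ S ∧ (ascentChild M 𝒢 S G).isSome ∧
      G.1 ∉ descentSet M S).card + (descentSet M S).ncard =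
      (Finset.univ.filter fun G : 𝒢 => G.1 ∈ S ∧ (ascentChild M 𝒢 S G).isSome).card := by
    rw [← h1, ← Finset.card_union_of_disjoint]
    · congr 1
      ext G
      simp only [Finset.mem_union, Finset.mem_filter, Finset.mem_univ, true_and]
      constructor
      · rintro (hG | hG)
        · exact ⟨hG.1, hG.2.1⟩
        · exact ⟨hG.1, hsome G hG.2⟩
      · rintro hG
        by_cases hd : G.1 ∈ descentSet M S
        · exact Or.inr ⟨hG.1, hd⟩
        · exact Or.inl ⟨hG.1, hG.2, hd⟩
    · rw [Finset.disjoint_left]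
      intro G hG hG'
      simp only [Finset.mem_filter, Finset.mem_univ, true_and] at hG hG'
      exact hG.2.2 hG'.2
  rw [h1]
  congr 2
  omega

-- A descent without ascending child contributes the factor `0 + 0`.
open Polynomial Classical in
lemma prod_ascentChild_of_not_isStable [Fintype 𝒢] (hS : IsMaxNested M 𝒢 S)
    (hst : ¬ IsStable M 𝒢 S) :
    ∏ G : 𝒢 with G.1 ∈ S, ((if G.1 ∈ descentSet M S then 0 else 1) +
      (if (ascentChild M 𝒢 S G).isSome then (Polynomial.X : ℤ[X]) else 0)) = 0 := by
  rw [isStable_iff] at hst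
  push Not at hst
  obtain ⟨G, hG, hall⟩ := hst hS
  have hG𝒢 := hS.isNested.subset (descentSet_subset hG)
  refine Finset.prod_eq_zero (i := ⟨G, hG𝒢⟩) (by simpa using descentSet_subset hG) ?_
  rw [ascentChild_eq_none.2 fun R hR hp => hall R.1 hR hp]
  simp [hG]

lemma finite_setOf_isMaxNested (h : IsBuildingSet M 𝒢) : {S | IsMaxNested M 𝒢 S}.Finite :=
  h.finite.finite_subsets.subset fun _ hS => hS.isNested.subset

lemma finite_setOf_isStable (h : IsBuildingSet M 𝒢) : {S | IsStable M 𝒢 S}.Finite :=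
  (finite_setOf_isMaxNested h).subset fun _ hS => hS.isMaxNested

open Polynomial in
/-- The generating function of all Feichtner–Yuzvinsky exponents. -/
lemma exists_finset_isFYExponent (hc : IsComplete M 𝒢) (h : IsBuildingSet M 𝒢) :
    ∃ Φ : Finset (𝒢 →₀ ℕ), (∀ d, d ∈ Φ ↔ IsFYExponent M 𝒢 d) ∧
      ∑ d ∈ Φ, (Polynomial.X : ℤ[X]) ^ d.degree =
        ∑ S ∈ (finite_setOf_isStable h).toFinset, Polynomial.X ^ (descentSet M S).ncard *
          (1 + Polynomial.X) ^ (rk M M.E - (factors 𝒢 M.E).ncard - 2 * (descentSet M S).ncard) := by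
  classical
  let _ := h.finite.fintype
  choose! Φ hΦ hsum using fun S (hS : IsMaxNested M 𝒢 S) =>
    exists_finset_isFYExponent_of_isMaxNested hc h hS
  set N := (finite_setOf_isMaxNested h).toFinset with hN
  have hNmem : ∀ S, S ∈ N ↔ IsMaxNested M 𝒢 S := fun S => by simp [hN]
  have hiff : ∀ {d : 𝒢 →₀ ℕ} {S : Set (Set α)}, IsMaxNested M 𝒢 S →
      (supportSet d ⊆ S ∧ descentSet M S ⊆ supportSet d ↔
        supportSet d ∪ factors 𝒢 M.E ⊆ S ∧ descentSet M S ⊆ supportSet d ∪ factors 𝒢 M.E) := by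
    intro d S hS
    exact ⟨fun hd => ⟨union_subset hd.1 (hS.factors_subset h), hd.2.trans subset_union_left⟩,
      fun hd => ⟨subset_union_left.trans hd.1, subset_of_subset_union_factors h hS hd.2⟩⟩
  refine ⟨N.biUnion Φ, fun d => ?_, ?_⟩
  · rw [Finset.mem_biUnion]
    constructor
    · rintro ⟨S, hS, hd⟩
      exact ((hΦ S ((hNmem S).1 hS) d).1 hd).1
    · intro hd
      obtain ⟨S, ⟨hS, hSd⟩, -⟩ := existsUnique_fill h (hd.isNested.union_factors h)
        subset_union_right
      exact ⟨S, (hNmem S).2 hS, (hΦ S hS d).2 ⟨hd, (hiff hS).2 hSd⟩⟩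
  · rw [Finset.sum_biUnion]
    · have hsub : (finite_setOf_isStable h).toFinset ⊆ N := fun S hS => by
        rw [hNmem]
        exact ((Finite.mem_toFinset _).1 hS : IsStable M 𝒢 S).isMaxNested
      rw [← Finset.sum_subset hsub]
      · refine Finset.sum_congr rfl fun S hS => ?_
        have hS' : IsStable M 𝒢 S := (Finite.mem_toFinset _).1 hS
        rw [hsum S hS'.isMaxNested, prod_ascentChild_of_isStable hc h hS']
      · intro S hS hS'
        rw [hNmem] at hS
        rw [hsum S hS, prod_ascentChild_of_not_isStable hS fun hst => hS' (by simpa using hst)]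
    · intro S hS S' hS' hne
      rw [Function.onFun, Finset.disjoint_left]
      intro d hd hd'
      have hS := (hNmem S).1 hS
      have hS' := (hNmem S').1 hS'
      have h1 := (hΦ S hS d).1 hd
      have h2 := (hΦ S' hS' d).1 hd'
      exact hne ((existsUnique_fill h (h1.1.isNested.union_factors h) subset_union_right).unique
        ⟨hS, (hiff hS).1 h1.2⟩ ⟨hS', (hiff hS').1 h2.2⟩)

lemma fNumber_gammaComplex (h : IsBuildingSet M 𝒢) (i : ℕ) :
    fNumber (gammaComplex M 𝒢) i =
      ((finite_setOf_isStable h).toFinset.filter fun S => (descentSet M S).ncard = i).card := by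
  classical
  rw [fNumber]
  have : {D ∈ gammaComplex M 𝒢 | D.Finite ∧ D.ncard = i} = descentSet M ''
      ((finite_setOf_isStable h).toFinset.filter fun S => (descentSet M S).ncard = i :
        Finset (Set (Set α))) := by
    ext D
    simp only [mem_ofPred_eq, Finset.coe_filter, Finite.mem_toFinset, mem_image]
    constructor
    · rintro ⟨⟨S, hS, rfl⟩, -, hD⟩
      exact ⟨S, ⟨hS, hD⟩, rfl⟩
    · rintro ⟨S, ⟨hS, hD⟩, rfl⟩
      exact ⟨⟨S, hS, rfl⟩, (hS.isMaxNested.isNested.finite h).subset descentSet_subset, hD⟩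
  rw [this, InjOn.ncard_image, ncard_coe_finset]
  intro S hS S' hS' heq
  simp only [Finset.coe_filter, Finite.mem_toFinset, mem_ofPred_eq] at hS hS'
  exact hS.1.isMaxNested.eq_of_descentSet_eq h hS'.1.isMaxNested heq

open Polynomial in
/-- A polynomial that is a sum of the `γ i * X ^ i * (1 + X) ^ (n - 2 * i)` with `γ 0 = 1` has
degree `n`. -/
lemma natDegree_gamma_sum (n : ℕ) (γ : ℕ → ℤ) (hγ : γ 0 = 1) :
    (∑ i ∈ Finset.range (n / 2 + 1),
      C (γ i) * Polynomial.X ^ i * (1 + Polynomial.X) ^ (n - 2 * i) : ℤ[X]).natDegree = n := by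
  have hdeg : ∀ i, (C (γ i) * Polynomial.X ^ i * (1 + Polynomial.X) ^ (n - 2 * i) : ℤ[X]).natDegree ≤
      i + (n - 2 * i) := by
    intro i
    refine natDegree_mul_le.trans (add_le_add (natDegree_C_mul_X_pow_le _ _) ?_)
    refine natDegree_pow_le.trans ?_
    have : (1 + Polynomial.X : ℤ[X]).natDegree ≤ 1 := by
      rw [add_comm, ← C_1, natDegree_X_add_C]
    calc (n - 2 * i) * (1 + Polynomial.X : ℤ[X]).natDegree ≤ (n - 2 * i) * 1 :=
          Nat.mul_le_mul_left _ this
      _ = _ := mul_one _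
  have hmonic : ((1 + Polynomial.X : ℤ[X]) ^ n).coeff n = 1 := by
    rw [coeff_one_add_X_pow]
    simp
  refine natDegree_eq_of_le_of_coeff_ne_zero ?_ ?_
  · refine natDegree_sum_le_of_forall_le _ _ fun i hi => (hdeg i).trans ?_
    have := Finset.mem_range.1 hi
    omega
  · rw [finsetSum_coeff, Finset.sum_eq_single 0]
    · simp [hγ, hmonic]
    · intro i hi hi0
      have := Finset.mem_range.1 hi
      exact coeff_eq_zero_of_natDegree_lt ((hdeg i).trans_lt (by omega))
    · intro hcon
      exact absurd (Finset.mem_range.2 (Nat.succ_pos _)) hcon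

open Polynomial in
lemma exists_isGammaVector (hc : IsComplete M 𝒢) (h : IsBuildingSet M 𝒢)
    (hrank : ∀ k, Module.finrank ℤ (chowPiece M 𝒢 k) =
      {d : 𝒢 →₀ ℕ | IsFYExponent M 𝒢 d ∧ d.degree = k}.ncard) :
    ∃ H : ℤ[X], (H : PowerSeries ℤ) = chowSeries M 𝒢 ∧
      IsGammaVector H (fun i => (fNumber (gammaComplex M 𝒢) i : ℤ)) := by
  classical
  obtain ⟨Φ, hΦ, hsum⟩ := exists_finset_isFYExponent hc h
  set n := rk M M.E - (factors 𝒢 M.E).ncard with hn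
  set N := (finite_setOf_isStable h).toFinset with hN
  have hNle : ∀ S ∈ N, 2 * (descentSet M S).ncard ≤ n := fun S hS => by
    have : IsStable M 𝒢 S := (Finite.mem_toFinset _).1 hS
    have := this.two_mul_ncard_descentSet_le hc h
    omega
  have hgroup : ∑ d ∈ Φ, (Polynomial.X : ℤ[X]) ^ d.degree = ∑ i ∈ Finset.range (n / 2 + 1),
      C (fNumber (gammaComplex M 𝒢) i : ℤ) * Polynomial.X ^ i * (1 + Polynomial.X) ^ (n - 2 * i) := by
    rw [hsum, ← Finset.sum_fiberwise_of_maps_to (g := fun S => (descentSet M S).ncard)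
      (t := Finset.range (n / 2 + 1))]
    · refine Finset.sum_congr rfl fun i _ => ?_
      rw [fNumber_gammaComplex h, ← hN]
      rw [Finset.sum_congr rfl (g := fun _ => Polynomial.X ^ i * (1 + Polynomial.X) ^ (n - 2 * i))
        (fun S hS => by rw [(Finset.mem_filter.1 hS).2]), Finset.sum_const, nsmul_eq_mul]
      simp [mul_assoc]
    · intro S hS
      have := hNle S hS
      simp only [Finset.mem_range]
      omega
  -- The empty face makes the leading coefficient of the sum equal to `1`, so that the degree of the
  -- Hilbert series is exactly `n`.
  have hzero : fNumber (gammaComplex M 𝒢) 0 = 1 := by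
    have : {D ∈ gammaComplex M 𝒢 | D.Finite ∧ D.ncard = 0} = {∅} := by
      ext D
      simp only [mem_ofPred_eq, mem_singleton_iff]
      constructor
      · rintro ⟨-, hfin, hD⟩
        exact (ncard_eq_zero hfin).1 hD
      · rintro rfl
        exact ⟨empty_mem_gammaComplex h, finite_empty, ncard_empty _⟩
    rw [fNumber, this, ncard_singleton]
  have hdeg := natDegree_gamma_sum n (fun i => (fNumber (gammaComplex M 𝒢) i : ℤ))
    (by simp [hzero])
  refine ⟨∑ d ∈ Φ, Polynomial.X ^ d.degree, ?_, ?_, ?_⟩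
  · ext k
    rw [chowSeries, Polynomial.coeff_coe, PowerSeries.coeff_mk, hrank, finsetSum_coeff]
    simp only [coeff_X_pow]
    rw [Finset.sum_boole]
    have : {d : 𝒢 →₀ ℕ | IsFYExponent M 𝒢 d ∧ d.degree = k} =
        ((Φ.filter fun d => k = d.degree : Finset _) : Set (𝒢 →₀ ℕ)) := by
      ext d
      simp only [mem_ofPred_eq, Finset.coe_filter, hΦ, eq_comm]
    rw [this, ncard_coe_finset]
  · intro i hi
    rw [hgroup, hdeg] at hi
    simp only [Nat.cast_eq_zero]
    rw [fNumber_gammaComplex h, Finset.card_eq_zero, Finset.filter_eq_empty_iff]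
    intro S hS hSi
    have := hNle S hS
    omega
  · conv_rhs => rw [hgroup, hdeg]
    exact hgroup

end Stable

end BuiltMatroid
end

noncomputable section
namespace BuiltMatroid
open Set
set_option linter.unusedSectionVars false

/-! ### Upper bound: spanning monomials of the Chow ring. -/

section Spanning

open MvPolynomial Classical

variable {α : Type*} {M : Matroid α} {𝒢 S : Set (Set α)} {F : Set α} [M.Finite] [M.Loopless]

lemma monomial_mem_chowIdeal {d : 𝒢 →₀ ℕ} (hd : ¬ IsNested M 𝒢 (supportSet d)) :
    (monomial d 1 : MvPolynomial 𝒢 ℤ) ∈ chowIdeal M 𝒢 := by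
  have hmem : (∏ G ∈ d.support, X G : MvPolynomial 𝒢 ℤ) ∈ chowIdeal M 𝒢 :=
    Ideal.subset_span (Or.inl ⟨d.support, hd, rfl⟩)
  refine Ideal.mem_of_dvd _ ?_ hmem
  rw [← prod_X_pow_eq_monomial]
  exact Finset.prod_dvd_prod_of_dvd _ _ fun G hG =>
    dvd_pow_self _ (Finsupp.mem_support_iff.1 hG)

variable (𝒢) in
/-- The sum of the variables `x_G` with `F ⊆ G`. -/
def sumAbove [Fintype 𝒢] (F : Set α) : MvPolynomial 𝒢 ℤ := ∑ G : 𝒢 with F ⊆ G.1, X G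

lemma sumAbove_singleton_mem [Fintype 𝒢] {e : α} (he : e ∈ M.E) :
    sumAbove 𝒢 {e} ∈ chowIdeal M 𝒢 := by
  refine Ideal.subset_span (Or.inr ⟨e, he, ?_⟩)
  rw [finsum_eq_sum_of_fintype, sumAbove]
  simp only [singleton_subset_iff]
  exact Finset.sum_subtype _ (by simp) (fun G : 𝒢 => (X G : MvPolynomial 𝒢 ℤ))

/-- A flat is spanned over a subflat by as many elements as the difference of the ranks. -/
lemma exists_fun_subset_closure {F G : Set α} (hF : M.IsFlat F) (hG : M.IsFlat G) (hFG : F ⊆ G)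
    {D : ℕ} (hD : rk M G = rk M F + D) :
    ∃ e : Fin D → α, (∀ i, e i ∈ G) ∧ G ⊆ M.closure (F ∪ range e) := by
  induction D generalizing F with
  | zero =>
    refine ⟨Fin.elim0, fun i => i.elim0, ?_⟩
    by_contra hcon
    have hss : F ⊂ G := hFG.ssubset_of_ne (by
      rintro rfl
      exact hcon ((subset_union_left).trans (M.subset_closure _ (by simp [hF.subset_ground]))))
    have := rk_lt_rk hF hss hG.subset_ground
    omega
  | succ D ih =>
    have hss : ¬ G ⊆ F := fun hle => by
      rw [hFG.antisymm hle] at hD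
      omega
    obtain ⟨a, haG, haF⟩ := not_subset.1 hss
    have haE := hG.subset_ground haG
    have hsub : M.closure (insert a F) ⊆ G := closure_subset_of_isFlat hG (insert_subset haG hFG)
    have hr : rk M (M.closure (insert a F)) = rk M F + 1 := by
      rw [rk_closure, rk_insert haE (by rwa [hF.closure])]
    obtain ⟨e, heG, he⟩ := ih (M.isFlat_closure _) hsub (by omega)
    refine ⟨Fin.cons a e, Fin.cases haG heG, he.trans ?_⟩
    have hE : F ∪ range (Fin.cons a e : Fin (D + 1) → α) ⊆ M.E := by
      refine union_subset hF.subset_ground ?_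
      rintro _ ⟨i, rfl⟩
      exact hG.subset_ground (Fin.cases (motive := fun i =>
        (Fin.cons a e : Fin (D + 1) → α) i ∈ G) haG heG i)
    refine closure_subset_of_isFlat (M.isFlat_closure _) (union_subset ?_ ?_)
    · refine M.closure_subset_closure (insert_subset (Or.inr ⟨0, rfl⟩) subset_union_left)
    · rintro _ ⟨i, rfl⟩
      exact M.subset_closure _ hE (Or.inr ⟨i.succ, rfl⟩)

lemma sumAbove_singleton_eq [Fintype 𝒢] {G : Set α} {e : α} (he : e ∈ G) :
    sumAbove 𝒢 {e} = sumAbove 𝒢 G + ∑ G' : 𝒢 with e ∈ G'.1 ∧ ¬ G ⊆ G'.1, X G' := by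
  rw [sumAbove, sumAbove, ← Finset.sum_union]
  · refine Finset.sum_congr ?_ fun _ _ => rfl
    ext G'
    simp only [Finset.mem_union, Finset.mem_filter, Finset.mem_univ, true_and, singleton_subset_iff]
    exact ⟨fun h => (Classical.em (G ⊆ G'.1)).imp id fun h' => ⟨h, h'⟩,
      fun h => h.elim (fun h => h he) And.left⟩
  · rw [Finset.disjoint_filter]
    exact fun _ _ h h' => h'.2 h

/-- The relations of the Gröbner basis of Feichtner and Yuzvinsky. -/
lemma monomial_mul_sumAbove_pow_mem [Fintype 𝒢] (h : IsBuildingSet M 𝒢) (n : 𝒢 →₀ ℕ) (G : 𝒢)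
    {D : ℕ} (hD : rk M G.1 = rk M (joinBelow M (supportSet n) G.1) + D) :
    (monomial n 1 : MvPolynomial 𝒢 ℤ) * sumAbove 𝒢 G.1 ^ D ∈ chowIdeal M 𝒢 := by
  have hGF := h.isFlat _ G.2
  obtain ⟨e, heG, he⟩ := exists_fun_subset_closure isFlat_joinBelow hGF (joinBelow_subset hGF) hD
  have hmk : ∀ i, Ideal.Quotient.mk (chowIdeal M 𝒢) (sumAbove 𝒢 G.1) =
      Ideal.Quotient.mk (chowIdeal M 𝒢)
        (-∑ G' : 𝒢 with e i ∈ G'.1 ∧ ¬ G.1 ⊆ G'.1, X G') := by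
    intro i
    rw [Ideal.Quotient.eq, sub_neg_eq_add, ← sumAbove_singleton_eq (heG i)]
    exact sumAbove_singleton_mem (hGF.subset_ground (heG i))
  -- A different linear relation is used in each of the `D` factors: the `i`-th copy of `sumAbove`
  -- is traded for the variables containing `e i` but not `G`.
  rw [← Ideal.Quotient.eq_zero_iff_mem, map_mul, map_pow, ← Fin.prod_const,
    Finset.prod_congr rfl fun i _ => hmk i, ← map_prod, ← map_mul, Ideal.Quotient.eq_zero_iff_mem,
    Finset.prod_neg, mul_left_comm]
  refine Ideal.mul_mem_left _ _ ?_
  rw [Finset.prod_univ_sum, Finset.mul_sum]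
  refine Ideal.sum_mem _ fun φ hφ => ?_
  simp only [Fintype.mem_piFinset, Finset.mem_filter, Finset.mem_univ, true_and] at hφ
  have hX : ∏ i, (X (φ i) : MvPolynomial 𝒢 ℤ) =
      monomial (∑ i, Finsupp.single (φ i) 1) 1 := by
    rw [monomial_sum_one]
    rfl
  rw [hX, monomial_mul, one_mul]
  -- The chosen sets contain the `e i`, so with the members of the support below `G` their join
  -- contains `G`. None of them contains `G`, so the support is not nested.
  refine monomial_mem_chowIdeal fun hnest => ?_
  have hφne : ∀ i, (n + ∑ i, Finsupp.single (φ i) 1 : 𝒢 →₀ ℕ) (φ i) ≠ 0 := by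
    intro i
    rw [Finsupp.add_apply, Finsupp.finsetSum_apply]
    have := Finset.single_le_sum (f := fun j => (Finsupp.single (φ j) 1 : 𝒢 →₀ ℕ) (φ i))
      (fun _ _ => Nat.zero_le _) (Finset.mem_univ i)
    simp only [Finsupp.single_eq_same] at this
    omega
  set A : Set (Set α) := {H ∈ supportSet n | H ⊂ G.1} ∪ range fun i => (φ i).1 with hA
  have hAS : A ⊆ supportSet (n + ∑ i, Finsupp.single (φ i) 1) := by
    rintro _ (⟨⟨H, hH, rfl⟩, -⟩ | ⟨i, rfl⟩)
    · refine mem_supportSet.2 ?_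
      have : n H ≠ 0 := Finsupp.mem_support_iff.1 hH
      rw [Finsupp.add_apply]
      omega
    · exact mem_supportSet.2 (hφne i)
  have hAE := h.sUnion_subset_ground (hAS.trans hnest.subset)
  have hGA : G.1 ⊆ join M A := by
    refine he.trans (closure_subset_of_isFlat (isFlat_join M A) (union_subset
      (join_mono subset_union_left) ?_))
    rintro _ ⟨i, rfl⟩
    exact subset_join hAE (Or.inr ⟨i, rfl⟩) (hφ i).1
  obtain ⟨_, ⟨-, hH⟩ | ⟨i, rfl⟩, hle⟩ := hnest.exists_subset h hAS G.2 hGA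
  · exact hH.not_subset hle
  · exact (hφ i).2 hle

/-- The span of the monomials of degree `k` and weight at least `w`. -/
def heavySpan (M : Matroid α) (𝒢 : Set (Set α)) (k w : ℕ) : Submodule ℤ (MvPolynomial 𝒢 ℤ) :=
  Submodule.span ℤ {p | ∃ d : 𝒢 →₀ ℕ, d.degree = k ∧
    w ≤ Finsupp.weight (fun G : 𝒢 => rk M G.1) d ∧ p = monomial d 1}

lemma monomial_mem_heavySpan {k w : ℕ} {d : 𝒢 →₀ ℕ} (hk : d.degree = k)
    (hw : w ≤ Finsupp.weight (fun G : 𝒢 => rk M G.1) d) :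
    (monomial d 1 : MvPolynomial 𝒢 ℤ) ∈ heavySpan M 𝒢 k w :=
  Submodule.subset_span ⟨d, hk, hw, rfl⟩

lemma X_mem_heavySpan {w : ℕ} {G : 𝒢} (hw : w ≤ rk M G.1) :
    (X G : MvPolynomial 𝒢 ℤ) ∈ heavySpan M 𝒢 1 w :=
  monomial_mem_heavySpan (by simp) (by simpa [Finsupp.weight_single] using hw)

lemma mul_mem_heavySpan {k l v w : ℕ} {p q : MvPolynomial 𝒢 ℤ} (hp : p ∈ heavySpan M 𝒢 k w)
    (hq : q ∈ heavySpan M 𝒢 l v) : p * q ∈ heavySpan M 𝒢 (k + l) (w + v) := by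
  have := Submodule.mul_mem_mul hp hq
  rw [heavySpan, heavySpan, Submodule.span_mul_span] at this
  refine Submodule.span_mono ?_ this
  rintro _ ⟨_, ⟨d, hd, hwd, rfl⟩, _, ⟨d', hd', hwd', rfl⟩, rfl⟩
  exact ⟨d + d', by rw [map_add, hd, hd'], by rw [map_add]; omega, by simp [monomial_mul]⟩

lemma pow_mem_heavySpan {w : ℕ} {p : MvPolynomial 𝒢 ℤ} (hp : p ∈ heavySpan M 𝒢 1 w) (D : ℕ) :
    p ^ D ∈ heavySpan M 𝒢 D (D * w) := by
  induction D with
  | zero => exact monomial_mem_heavySpan (by simp) (by simp)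
  | succ D ih =>
    rw [pow_succ, Nat.succ_mul]
    exact mul_mem_heavySpan ih hp

lemma sumAbove_sub_mem_heavySpan [Fintype 𝒢] (h : IsBuildingSet M 𝒢) (G : 𝒢) :
    sumAbove 𝒢 G.1 - X G ∈ heavySpan M 𝒢 1 (rk M G.1 + 1) := by
  rw [sumAbove, ← Finset.add_sum_erase _ _ (show G ∈ _ by simp), add_sub_cancel_left]
  refine Submodule.sum_mem _ fun G' hG' => X_mem_heavySpan ?_
  simp only [Finset.mem_erase, Finset.mem_filter, Finset.mem_univ, true_and] at hG'
  exact rk_lt_rk (h.isFlat _ G.2) (hG'.2.ssubset_of_ne fun heq => hG'.1 (Subtype.ext heq.symm))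
    (h.subset_ground G'.2)

lemma heavySpan_anti {k v w : ℕ} (hvw : v ≤ w) : heavySpan M 𝒢 k w ≤ heavySpan M 𝒢 k v := by
  refine Submodule.span_mono ?_
  rintro _ ⟨d, hd, hw, rfl⟩
  exact ⟨d, hd, hvw.trans hw, rfl⟩

lemma sumAbove_pow_sub_mem_heavySpan [Fintype 𝒢] (h : IsBuildingSet M 𝒢) (G : 𝒢) (D : ℕ) :
    sumAbove 𝒢 G.1 ^ D - X G ^ D ∈ heavySpan M 𝒢 D (D * rk M G.1 + 1) := by
  have hX : (X G : MvPolynomial 𝒢 ℤ) ∈ heavySpan M 𝒢 1 (rk M G.1) := X_mem_heavySpan le_rfl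
  have hr := sumAbove_sub_mem_heavySpan h G
  have hs : sumAbove 𝒢 G.1 ∈ heavySpan M 𝒢 1 (rk M G.1) := by
    have := Submodule.add_mem _ (heavySpan_anti (Nat.le_succ _) hr) hX
    rwa [sub_add_cancel] at this
  induction D with
  | zero => simp
  | succ D ih =>
    have key : sumAbove 𝒢 G.1 ^ (D + 1) - X G ^ (D + 1) =
        (sumAbove 𝒢 G.1 ^ D - X G ^ D) * sumAbove 𝒢 G.1 +
          X G ^ D * (sumAbove 𝒢 G.1 - X G) := by ring
    rw [key]
    refine Submodule.add_mem _ ?_ ?_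
    · have := mul_mem_heavySpan ih hs
      rwa [show D * rk M G.1 + 1 + rk M G.1 = (D + 1) * rk M G.1 + 1 by ring] at this
    · have := mul_mem_heavySpan (pow_mem_heavySpan hX D) hr
      rwa [show D * rk M G.1 + (rk M G.1 + 1) = (D + 1) * rk M G.1 + 1 by ring] at this

lemma weight_le (h : IsBuildingSet M 𝒢) (d : 𝒢 →₀ ℕ) :
    Finsupp.weight (fun G : 𝒢 => rk M G.1) d ≤ d.degree * rk M M.E := by
  rw [Finsupp.weight_apply, Finsupp.sum, Finsupp.degree_apply, Finset.sum_mul]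
  refine Finset.sum_le_sum fun G _ => Nat.mul_le_mul_left _ (rk_mono (h.subset_ground G.2))

/-- A violated rank bound allows a power of `X G` to be rewritten modulo the ideal by monomials of
the same degree and larger rank weight. The weight is at most the degree times the total rank, so
the process stops. -/
lemma monomial_mem_span_sup [Fintype 𝒢] (h : IsBuildingSet M 𝒢) (d : 𝒢 →₀ ℕ) :
    (monomial d 1 : MvPolynomial 𝒢 ℤ) ∈
      Submodule.span ℤ {p | ∃ n : 𝒢 →₀ ℕ, IsFYExponent M 𝒢 n ∧ n.degree = d.degree ∧
        p = monomial n 1} ⊔ (chowIdeal M 𝒢).restrictScalars ℤ := by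
  induction hN : d.degree * rk M M.E - Finsupp.weight (fun G : 𝒢 => rk M G.1) d
    using Nat.strong_induction_on generalizing d with
  | _ N ih =>
    by_cases hnest : IsNested M 𝒢 (supportSet d)
    swap
    · exact Submodule.mem_sup_right (monomial_mem_chowIdeal hnest)
    by_cases hFY : IsFYExponent M 𝒢 d
    · exact Submodule.mem_sup_left (Submodule.subset_span ⟨d, hFY, rfl, rfl⟩)
    obtain ⟨G, hG, hle⟩ : ∃ G, d G ≠ 0 ∧
        rk M G.1 ≤ rk M (joinBelow M (supportSet d) G.1) + d G := by
      by_contra! hcon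
      exact hFY ⟨hnest, hcon⟩
    set J := joinBelow M (supportSet d) G.1 with hJ
    have hJG : rk M J ≤ rk M G.1 := rk_mono (joinBelow_subset (h.isFlat _ G.2))
    obtain ⟨D, hD⟩ := Nat.exists_eq_add_of_le hJG
    -- Only `D` copies of `X G` are removed. Exponents of the members strictly below `G` are
    -- unchanged, so the join `J`, and with it the relation of exponent `D`, is the same for `n`.
    set n := d - Finsupp.single G D with hn
    have hdn : d = n + Finsupp.single G D :=
      (tsub_add_cancel_of_le (Finsupp.single_le_iff.2 (by omega))).symm
    have hnJ : joinBelow M (supportSet n) G.1 = J := by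
      rw [hJ]
      unfold joinBelow
      congr 1
      ext H
      refine and_congr_left fun hHG => ?_
      have key : ∀ H : 𝒢, H.1 ⊂ G.1 → (H.1 ∈ supportSet n ↔ H.1 ∈ supportSet d) := by
        intro H hHG
        rw [mem_supportSet, mem_supportSet, hn, Finsupp.tsub_apply,
          Finsupp.single_eq_of_ne (fun heq => hHG.ne (by rw [heq])), tsub_zero]
      constructor
      · intro hH
        exact (key ⟨H, supportSet_subset _ hH⟩ hHG).1 hH
      · intro hH
        exact (key ⟨H, supportSet_subset _ hH⟩ hHG).2 hH
    have hrel := monomial_mul_sumAbove_pow_mem h n G (D := D) (by rw [hnJ]; exact hD)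
    have hmon : (monomial d 1 : MvPolynomial 𝒢 ℤ) = monomial n 1 * X G ^ D := by
      rw [X_pow_eq_monomial, monomial_mul, one_mul, ← hdn]
    have hsplit : (monomial d 1 : MvPolynomial 𝒢 ℤ) = monomial n 1 * sumAbove 𝒢 G.1 ^ D -
        monomial n 1 * (sumAbove 𝒢 G.1 ^ D - X G ^ D) := by
      rw [hmon]
      ring
    rw [hsplit]
    refine Submodule.sub_mem _ (Submodule.mem_sup_right hrel) ?_
    have hheavy := mul_mem_heavySpan (monomial_mem_heavySpan (M := M) (d := n) rfl le_rfl)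
      (sumAbove_pow_sub_mem_heavySpan h G D)
    have hdeg : n.degree + D = d.degree := by
      conv_rhs => rw [hdn, map_add, Finsupp.degree_single]
    have hwt : Finsupp.weight (fun G : 𝒢 => rk M G.1) n + (D * rk M G.1 + 1) =
        Finsupp.weight (fun G : 𝒢 => rk M G.1) d + 1 := by
      conv_rhs => rw [hdn, map_add, Finsupp.weight_single]
      rw [smul_eq_mul]
      ring
    rw [hdeg, hwt] at hheavy
    refine Submodule.span_le.2 ?_ hheavy
    rintro _ ⟨d', hd', hw, rfl⟩
    have := ih _ (by have := weight_le h d'; rw [hd'] at this ⊢; omega) d' rfl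
    rwa [hd'] at this

/-- The degree `k` piece of the Chow ring is spanned by the monomials of the exponents of
Feichtner and Yuzvinsky. -/
lemma chowPiece_eq_span [Fintype 𝒢] (h : IsBuildingSet M 𝒢) (k : ℕ) :
    chowPiece M 𝒢 k = Submodule.span ℤ (range
      fun d : {d : 𝒢 →₀ ℕ | IsFYExponent M 𝒢 d ∧ d.degree = k} =>
        Ideal.Quotient.mk (chowIdeal M 𝒢) (monomial d.1 1)) := by
  apply le_antisymm
  · rw [chowPiece, Submodule.map_le_iff_le_comap]
    intro p hp
    rw [p.as_sum]
    refine Submodule.sum_mem _ fun d hd => ?_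
    have hdk : d.degree = k := by
      by_contra hne
      exact mem_support_iff.1 hd (((mem_homogeneousSubmodule k p).1 hp).coeff_eq_zero hne)
    have hmon : (monomial d (coeff d p) : MvPolynomial 𝒢 ℤ) = coeff d p • monomial d 1 := by
      rw [smul_monomial, smul_eq_mul, mul_one]
    rw [hmon]
    refine Submodule.smul_mem _ _ ?_
    refine (sup_le ?_ ?_ : _ ≤ Submodule.comap _ _) (monomial_mem_span_sup h d)
    · refine Submodule.span_le.2 ?_
      rintro _ ⟨n, hn, hnd, rfl⟩
      exact Submodule.subset_span ⟨⟨n, hn, hnd.trans hdk⟩, rfl⟩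
    · intro q hq
      have : Ideal.Quotient.mk (chowIdeal M 𝒢) q = 0 := Ideal.Quotient.eq_zero_iff_mem.2 hq
      rw [Submodule.mem_comap]
      exact (congrArg (· ∈ _) this).mpr (Submodule.zero_mem _)
  · refine Submodule.span_le.2 ?_
    rintro _ ⟨⟨d, -, hdk⟩, rfl⟩
    exact ⟨monomial d 1, (mem_homogeneousSubmodule k _).2 (isHomogeneous_monomial 1 hdk), rfl⟩

lemma finite_exponents [Fintype 𝒢] (k : ℕ) :
    {d : 𝒢 →₀ ℕ | IsFYExponent M 𝒢 d ∧ d.degree = k}.Finite :=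
  (Finsupp.finite_of_degree_le k).subset fun _ hd => hd.2.le

lemma finrank_chowPiece_le [Fintype 𝒢] (h : IsBuildingSet M 𝒢) (k : ℕ) :
    Module.finrank ℤ (chowPiece M 𝒢 k) ≤
      {d : 𝒢 →₀ ℕ | IsFYExponent M 𝒢 d ∧ d.degree = k}.ncard := by
  have := (finite_exponents (M := M) (𝒢 := 𝒢) k).fintype
  rw [chowPiece_eq_span h, ← Nat.card_coe_set_eq, Nat.card_eq_fintype_card]
  exact finrank_range_le_card _

lemma finite_chowPiece [Fintype 𝒢] (h : IsBuildingSet M 𝒢) (k : ℕ) :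
    Module.Finite ℤ (chowPiece M 𝒢 k) := by
  have := (finite_exponents (M := M) (𝒢 := 𝒢) k).fintype
  rw [chowPiece_eq_span h]
  exact Module.Finite.span_of_finite ℤ (finite_range _)

end Spanning

end BuiltMatroid
end

noncomputable section
namespace BuiltMatroid
open Set
set_option linter.unusedSectionVars false

/-! ### A sign-reversing pairing from submodularity. -/

section Pairing

variable {β : Type*} [DecidableEq β]

/-- The exponent of the monomial indexed by `I ⊆ A` in the expansion of
`∏ a ∈ A, (x_a - x_g)` times the monomial with exponent `n`. -/
def expansionExponent (n : β → ℕ) (A : Finset β) (g : β) (I : Finset β) (x : β) : ℕ :=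
  n x + (if x ∈ I then 1 else 0) + if x = g then (A \ I).card else 0

lemma sum_expansionExponent (n : β → ℕ) (A : Finset β) (g : β) (I B : Finset β) :
    ∑ x ∈ B, expansionExponent n A g I x =
      ∑ x ∈ B, n x + (B ∩ I).card + if g ∈ B then (A \ I).card else 0 := by
  simp only [expansionExponent, Finset.sum_add_distrib, Finset.sum_ite_eq']
  simp

/-- The sums over `B` of the exponents `e` are smaller than `ρ B - c`, or zero. -/
def IsSmall (ρ : Finset β → ℕ) (c : ℕ) (U : Finset β) (e : β → ℕ) : Prop :=
  ∀ B ⊆ U, ∑ x ∈ B, e x ≠ 0 → ∑ x ∈ B, e x + c < ρ B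

/-- In the expansion of `∏ a ∈ A, (x_a - x_g)` times a monomial, the small terms can be paired
off with opposite signs. -/
lemma exists_isSmall_insert_iff {ρ : Finset β → ℕ}
    (hsub : ∀ B B', ρ (B ∪ B') + ρ (B ∩ B') ≤ ρ B + ρ B') {c : ℕ} (hc : ∀ B, c ≤ ρ B)
    {U A : Finset β} {g : β} (hA : A.Nonempty) (hAU : A ⊆ U) (hgU : g ∈ U)
    (hg : ∀ B, g ∈ B → ∀ I ⊆ A, ρ (B ∪ I) = ρ B) (hAg : ∀ B, A ⊆ B → ρ (insert g B) = ρ B)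
    (n : β → ℕ) :
    ∃ i ∈ A, ∀ I ⊆ A.erase i, (IsSmall ρ c U (expansionExponent n A g I) ↔
      IsSmall ρ c U (expansionExponent n A g (insert i I))) := by
  set E : Finset β → Finset β → ℕ := fun I B => ∑ x ∈ B, expansionExponent n A g I x with hE
  have hEval : ∀ I B, E I B = ∑ x ∈ B, n x + (B ∩ I).card + if g ∈ B then (A \ I).card else 0 :=
    sum_expansionExponent n A g
  have hcard : ∀ I ⊆ A, I.card + (A \ I).card = A.card := fun I hI => by
    rw [Finset.card_sdiff_of_subset hI]
    have := Finset.card_le_card hI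
    omega
  have hsum : ∀ B B', B ⊆ B' → ∑ x ∈ B, n x ≤ ∑ x ∈ B', n x := fun B B' hB =>
    Finset.sum_le_sum_of_subset hB
  -- a violator containing `g` can be enlarged
  have henl : ∀ I ⊆ A, ∀ I' ⊆ A, ∀ B ⊆ U, g ∈ B → IsSmall ρ c U (expansionExponent n A g I') →
      E I B ≠ 0 → E I B + c < ρ B := by
    intro I hI I' hI' B hB hgB hsm hne
    have h1 : E I B ≤ E I' (B ∪ I') := by
      have hint : (B ∪ I') ∩ I' = I' := Finset.inter_eq_right.2 Finset.subset_union_right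
      rw [hEval, hEval, if_pos hgB, if_pos (Finset.mem_union_left _ hgB), hint]
      have := hsum B (B ∪ I') Finset.subset_union_left
      have := Finset.card_le_card (Finset.inter_subset_right (s₁ := B) (s₂ := I))
      have := hcard I hI
      have := hcard I' hI'
      omega
    have h2 := hsm (B ∪ I') (Finset.union_subset hB (hI'.trans hAU)) (by
      change E I' (B ∪ I') ≠ 0
      omega)
    rw [hg B hgB I' hI'] at h2
    change E I' (B ∪ I') + c < ρ B at h2
    omega
  have hanti : ∀ I I', I ⊆ I' → I' ⊆ A → IsSmall ρ c U (expansionExponent n A g I') →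
      IsSmall ρ c U (expansionExponent n A g I) := by
    intro I I' hII' hI' hsm B hB hne
    by_cases hgB : g ∈ B
    · exact henl I (hII'.trans hI') I' hI' B hB hgB hsm hne
    · have h1 : E I B ≤ E I' B := by
        rw [hEval, hEval, if_neg hgB, if_neg hgB]
        have := Finset.card_le_card (Finset.inter_subset_inter (Finset.Subset.refl B) hII')
        omega
      change E I B ≠ 0 at hne
      have h2 := hsm B hB (by change E I' B ≠ 0; omega)
      change E I' B + c < ρ B at h2
      change E I B + c < ρ B
      omega
  -- Smallness is inherited by subsets of the index set. If `∅` fails or `A` succeeds, any `i`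
  -- works; the remaining case is that `∅` is small and `A` is not.
  by_cases h0 : IsSmall ρ c U (expansionExponent n A g ∅)
  swap
  · obtain ⟨i, hi⟩ := hA
    refine ⟨i, hi, fun I hI => iff_of_false (fun hs => h0 (hanti ∅ I (Finset.empty_subset _)
      (hI.trans (Finset.erase_subset _ _)) hs)) fun hs => h0 (hanti ∅ _ (Finset.empty_subset _)
      (Finset.insert_subset hi (hI.trans (Finset.erase_subset _ _))) hs)⟩
  by_cases h1 : IsSmall ρ c U (expansionExponent n A g A)
  · obtain ⟨i, hi⟩ := hA
    refine ⟨i, hi, fun I hI => iff_of_true (hanti I A (hI.trans (Finset.erase_subset _ _))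
      Finset.Subset.rfl h1) (hanti _ A (Finset.insert_subset hi
      (hI.trans (Finset.erase_subset _ _))) Finset.Subset.rfl h1)⟩
  -- The pairing element `i` is taken outside a violator `B` for `A` of greatest cardinality. A
  -- violator `B'` created by inserting `i` would contain `i`, and submodularity would make `B ∪ B'`
  -- a larger violator for `A`.
  obtain ⟨B, hBmem, hmax⟩ := Finset.exists_max_image
    (U.powerset.filter fun B => E A B ≠ 0 ∧ ρ B ≤ E A B + c) Finset.card (by
      unfold IsSmall at h1
      push Not at h1
      obtain ⟨B, hB, hne, hle⟩ := h1
      exact ⟨B, Finset.mem_filter.2 ⟨Finset.mem_powerset.2 hB, hne, hle⟩⟩)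
  simp only [Finset.mem_filter, Finset.mem_powerset] at hBmem hmax
  obtain ⟨hBU, hBne, hBle⟩ := hBmem
  -- If `A ⊆ B`, then adding `g` to `B` does not change `ρ`, while in the term `I = ∅` all of
  -- `A.card` sits at `g`. That would make `insert g B` a violator for `∅`.
  have hnot : ¬ A ⊆ B := by
    intro hAB
    have h2 : E A B ≤ E ∅ (insert g B) := by
      rw [hEval, hEval, if_pos (Finset.mem_insert_self g B), Finset.inter_eq_right.2 hAB]
      have := hsum B (insert g B) (Finset.subset_insert _ _)
      simp only [Finset.sdiff_self, Finset.card_empty, ite_self, Finset.sdiff_empty]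
      omega
    have h3 := h0 (insert g B) (Finset.insert_subset hgU hBU) (by
      change E ∅ (insert g B) ≠ 0
      omega)
    rw [hAg B hAB] at h3
    change E ∅ (insert g B) + c < ρ B at h3
    omega
  obtain ⟨i, hiA, hiB⟩ := Finset.not_subset.1 hnot
  refine ⟨i, hiA, fun I hI => ?_⟩
  have hIA : I ⊆ A := hI.trans (Finset.erase_subset _ _)
  have hI'A : insert i I ⊆ A := Finset.insert_subset hiA hIA
  refine ⟨fun hs B' hB' hne => ?_, hanti I _ (Finset.subset_insert _ _) hI'A⟩
  by_cases hgB' : g ∈ B'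
  · exact henl _ hI'A I hIA B' hB' hgB' hs hne
  have hEB : ∀ I B, g ∉ B → E I B = ∑ x ∈ B, n x + (B ∩ I).card := fun I B hgB => by
    rw [hEval, if_neg hgB, add_zero]
  have hEA : ∀ B, E A B = ∑ x ∈ B, n x + (B ∩ A).card := fun B => by
    rw [hEval, Finset.sdiff_self]
    simp
  by_cases hiB' : i ∈ B'
  swap
  · have heq : E (insert i I) B' = E I B' := by
      rw [hEB _ _ hgB', hEB _ _ hgB', Finset.inter_insert_of_notMem hiB']
    change E (insert i I) B' + c < ρ B'
    rw [heq]
    exact hs B' hB' (by change E I B' ≠ 0; rw [← heq]; exact hne)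
  by_contra! hcon
  change ρ B' ≤ E (insert i I) B' + c at hcon
  -- Smallness says nothing about sets of total zero; there the bound `c ≤ ρ` is used.
  have hint : E I (B ∩ B') + c ≤ ρ (B ∩ B') := by
    by_cases hz : E I (B ∩ B') = 0
    · rw [hz, zero_add]
      exact hc _
    · exact (hs (B ∩ B') (Finset.inter_subset_left.trans hBU) hz).le
  have hgBB' : g ∉ B ∩ B' := fun hg => hgB' (Finset.mem_inter.1 hg).2
  have hn : ∑ x ∈ B ∪ B', n x + ∑ x ∈ B ∩ B', n x = ∑ x ∈ B, n x + ∑ x ∈ B', n x :=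
    Finset.sum_union_inter
  have hk : (B ∩ A).card + (B' ∩ insert i I).card ≤ ((B ∪ B') ∩ A).card + (B ∩ B' ∩ I).card := by
    have h2 : B ∩ B' ∩ I = (B ∩ A) ∩ (B' ∩ insert i I) := by
      ext x
      simp only [Finset.mem_inter, Finset.mem_insert]
      constructor
      · exact fun ⟨⟨hx, hx'⟩, hxI⟩ => ⟨⟨hx, hIA hxI⟩, hx', Or.inr hxI⟩
      · rintro ⟨⟨hx, -⟩, hx', rfl | hxI⟩
        exacts [absurd hx hiB, ⟨⟨hx, hx'⟩, hxI⟩]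
    rw [h2, ← Finset.card_union_add_card_inter]
    refine Nat.add_le_add_right (Finset.card_le_card ?_) _
    rw [Finset.union_inter_distrib_right]
    exact Finset.union_subset_union_right (Finset.inter_subset_inter_left hI'A)
  have hle : E A B + E (insert i I) B' ≤ E A (B ∪ B') + E I (B ∩ B') := by
    rw [hEA, hEA, hEB _ _ hgB', hEB _ _ hgBB']
    omega
  have h4 := hsub B B'
  have hge : E A B ≤ E A (B ∪ B') := by
    rw [hEA, hEA]
    have := hsum B (B ∪ B') Finset.subset_union_left
    have := Finset.card_le_card (Finset.inter_subset_inter_right (u := A)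
      (Finset.subset_union_left (s₁ := B) (s₂ := B')))
    omega
  have h5 := hmax (B ∪ B') ⟨Finset.union_subset hBU hB', by omega, by omega⟩
  have h6 : B.card < (B ∪ B').card := Finset.card_lt_card
    (Finset.ssubset_iff_of_subset Finset.subset_union_left |>.2
      ⟨i, Finset.mem_union_right _ hiB', hiB⟩)
  omega

end Pairing

end BuiltMatroid
end

noncomputable section
namespace BuiltMatroid
open Set
set_option linter.unusedSectionVars false

/-! ### Functionals from rank conditions on blocks. -/

section Functional

open MvPolynomial Classical

variable {α : Type*} {M : Matroid α} {𝒢 T : Set (Set α)} [M.Finite] [M.Loopless] [Fintype 𝒢]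
  {blk : 𝒢 → 𝒢} {m : 𝒢 → ℕ}

/-- The rank of the flat `P` joined with the members of a finset. -/
def unionRk (M : Matroid α) (J : Set α) (B : Finset 𝒢) : ℕ := rk M (J ∪ ⋃ G ∈ B, G.1)

/-- The exponents that, in each block `blk ⁻¹ {P}`, have total `m P` and are small with respect to
the rank over the join of the members of `T` strictly below `P`. -/
def IsGood (M : Matroid α) (T : Set (Set α)) (blk : 𝒢 → 𝒢) (m : 𝒢 → ℕ) (e : 𝒢 → ℕ) : Prop :=
  ∀ P : 𝒢, ∑ G with blk G = P, e G = m P ∧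
    IsSmall (unionRk M (joinBelow M T P.1)) (rk M (joinBelow M T P.1))
      (Finset.univ.filter fun G => blk G = P) e

/-- The linear functional whose value on a monomial is `1` or `0` according to whether the exponent
is good. -/
def goodForm (M : Matroid α) (T : Set (Set α)) (blk : 𝒢 → 𝒢) (m : 𝒢 → ℕ) :
    MvPolynomial 𝒢 ℤ →ₗ[ℤ] ℤ :=
  (basisMonomials 𝒢 ℤ).constr ℤ fun e => if IsGood M T blk m e then 1 else 0

lemma goodForm_monomial (e : 𝒢 →₀ ℕ) :
    goodForm M T blk m (monomial e 1) = if IsGood M T blk m e then 1 else 0 := by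
  have := (basisMonomials 𝒢 ℤ).constr_basis ℤ
    (fun e : 𝒢 →₀ ℕ => if IsGood M T blk m e then (1 : ℤ) else 0) e
  rwa [coe_basisMonomials] at this

lemma goodForm_mul_eq_zero {p : MvPolynomial 𝒢 ℤ}
    (hp : ∀ n, goodForm M T blk m (p * monomial n 1) = 0) (q : MvPolynomial 𝒢 ℤ) :
    goodForm M T blk m (p * q) = 0 := by
  rw [q.as_sum, Finset.mul_sum, map_sum]
  refine Finset.sum_eq_zero fun n _ => ?_
  have : (monomial n (coeff n q) : MvPolynomial 𝒢 ℤ) = coeff n q • monomial n 1 := by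
    rw [smul_monomial, smul_eq_mul, mul_one]
  rw [this, mul_smul_comm, map_smul, hp, smul_zero]

/-- The polynomials all of whose multiples are in the kernel of `goodForm`. -/
def goodIdeal (M : Matroid α) (T : Set (Set α)) (blk : 𝒢 → 𝒢) (m : 𝒢 → ℕ) :
    Ideal (MvPolynomial 𝒢 ℤ) where
  carrier := {p | ∀ q, goodForm M T blk m (p * q) = 0}
  zero_mem' q := by rw [zero_mul, map_zero]
  add_mem' hp hp' q := by rw [add_mul, map_add, hp, hp', add_zero]
  smul_mem' r p hp q := by rw [smul_eq_mul, mul_comm r, mul_assoc, hp]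

lemma mem_goodIdeal {p : MvPolynomial 𝒢 ℤ} :
    p ∈ goodIdeal M T blk m ↔ ∀ q, goodForm M T blk m (p * q) = 0 := Iff.rfl

lemma mem_goodIdeal_of_monomial {p : MvPolynomial 𝒢 ℤ}
    (hp : ∀ n, goodForm M T blk m (p * monomial n 1) = 0) : p ∈ goodIdeal M T blk m :=
  goodForm_mul_eq_zero hp

/-- Variables of atoms are in `goodIdeal`. -/
lemma X_atom_mem_goodIdeal {a : 𝒢} {x : α} (ha : a.1 = M.closure {x}) (hx : x ∈ M.E) :
    X a ∈ goodIdeal M T blk m := by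
  refine mem_goodIdeal_of_monomial fun n => ?_
  rw [X, monomial_mul, one_mul, goodForm_monomial, if_neg]
  intro hgood
  have h1 := (hgood (blk a)).2 {a} (by simp) (by simp)
  set J := joinBelow M T (blk a).1
  have h2 : unionRk M J {a} ≤ rk M J + 1 := by
    refine le_trans ?_ (rk_insert_le x J)
    rw [← rk_closure (insert x J)]
    refine rk_mono (union_subset ?_ ?_)
    · exact (subset_insert _ _).trans (M.subset_closure _
        (insert_subset hx (isFlat_join M _).subset_ground))
    · simp only [Finset.mem_singleton, iUnion_iUnion_eq_left, ha]
      exact M.closure_subset_closure (singleton_subset_iff.2 (mem_insert _ _))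
  rw [Finset.sum_singleton, Finsupp.add_apply, Finsupp.single_eq_same] at h1
  omega

lemma unionRk_submod (J : Set α) (B B' : Finset 𝒢) :
    unionRk M J (B ∪ B') + unionRk M J (B ∩ B') ≤ unionRk M J B + unionRk M J B' := by
  refine le_trans ?_ (rk_submod (J ∪ ⋃ G ∈ B, G.1) (J ∪ ⋃ G ∈ B', G.1))
  rw [add_comm]
  refine add_le_add (rk_mono (union_subset (subset_inter subset_union_left subset_union_left) ?_))
    (rk_mono (union_subset (subset_union_left.trans subset_union_left) ?_))
  · refine iUnion₂_subset fun G hG => ?_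
    rw [Finset.mem_inter] at hG
    exact subset_inter
      ((subset_biUnion_of_mem (u := fun G : 𝒢 => G.1) hG.1).trans subset_union_right)
      ((subset_biUnion_of_mem (u := fun G : 𝒢 => G.1) hG.2).trans subset_union_right)
  · refine iUnion₂_subset fun G hG => ?_
    obtain hG | hG := Finset.mem_union.1 hG
    · exact (subset_biUnion_of_mem (u := fun G : 𝒢 => G.1) hG).trans
        (subset_union_right.trans subset_union_left)
    · exact (subset_biUnion_of_mem (u := fun G : 𝒢 => G.1) hG).trans
        (subset_union_right.trans subset_union_right)

lemma prod_X_eq_monomial (A : Finset 𝒢) :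
    ∏ a ∈ A, (X a : MvPolynomial 𝒢 ℤ) = monomial (∑ a ∈ A, Finsupp.single a 1) 1 := by
  rw [monomial_sum_one]
  rfl

lemma sum_single_apply (A : Finset 𝒢) (x : 𝒢) :
    (∑ a ∈ A, Finsupp.single a 1 : 𝒢 →₀ ℕ) x = if x ∈ A then 1 else 0 := by
  rw [Finsupp.finsetSum_apply]
  simp [Finsupp.single_apply]

/-- The product of the `x_a - x_G`, for `a` in a set of members of `𝒢` below `G ∈ 𝒢` with join
`G`, is in `goodIdeal`. -/
lemma prod_X_sub_X_mem_goodIdeal (h : IsBuildingSet M 𝒢) (hT : IsNested M 𝒢 T)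
    (hblk : ∀ G : 𝒢, IsLeast {Q ∈ T | G.1 ⊆ Q} (blk G).1) {A : Finset 𝒢} {G : 𝒢}
    (hAG : ∀ a ∈ A, a.1 ⊆ G.1) (hjoin : G.1 ⊆ join M (Subtype.val '' (A : Set 𝒢))) :
    ∏ a ∈ A, (X a - X G) ∈ goodIdeal M T blk m := by
  set P := blk G with hP
  set J := joinBelow M T P.1 with hJ
  have hAE : ∀ a ∈ Subtype.val '' (A : Set 𝒢), a ⊆ M.E := by
    rintro _ ⟨a, -, rfl⟩
    exact h.subset_ground a.2
  have hTE := h.sUnion_subset_ground hT.subset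
  have hJE : J ⊆ M.E := (isFlat_join M _).subset_ground
  have hlow : ∀ a ∈ A, blk a ≠ P → a.1 ⊆ J := by
    intro a ha hne
    have hle : (blk a).1 ⊆ P.1 := (hblk a).2 ⟨(hblk G).1.1, (hAG a ha).trans (hblk G).1.2⟩
    refine (hblk a).1.2.trans (subset_join (fun b hb => hTE b hb.1)
      ⟨(hblk a).1.1, hle.ssubset_of_ne fun heq => hne (Subtype.ext heq)⟩)
  -- The members of `A` outside the block of `G` lie in `J` and add no rank over it. So the partial
  -- product over `A₁` is already in the ideal, and `A₁` is nonempty because `G` is not contained in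
  -- `J`.
  set A₁ := A.filter fun a => blk a = P with hA₁
  have hA₁A : A₁ ⊆ A := Finset.filter_subset _ _
  have hGJ : ¬ G.1 ⊆ J := by
    intro hcon
    obtain ⟨Q, hQ, hle⟩ := hT.exists_subset h (sep_subset _ _) G.2 hcon
    exact hQ.2.not_subset ((hblk G).2 ⟨hQ.1, hle⟩)
  have hne : A₁.Nonempty := by
    rw [Finset.nonempty_iff_ne_empty]
    intro hemp
    refine hGJ (hjoin.trans (join_subset (isFlat_join M _) ?_))
    rintro _ ⟨a, ha, rfl⟩
    refine hlow a ha fun heq => ?_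
    have : a ∈ A₁ := Finset.mem_filter.2 ⟨ha, heq⟩
    rw [hemp] at this
    exact absurd this (Finset.notMem_empty a)
  rw [← Finset.prod_sdiff hA₁A]
  refine Ideal.mul_mem_left _ _ (mem_goodIdeal_of_monomial fun n => ?_)
  have hUE : ∀ B : Finset 𝒢, J ∪ ⋃ G ∈ B, G.1 ⊆ M.E := fun B =>
    union_subset hJE (iUnion₂_subset fun G _ => h.subset_ground G.2)
  obtain ⟨i, hi, hpair⟩ := exists_isSmall_insert_iff (ρ := unionRk M J) (unionRk_submod J)
    (c := rk M J) (fun B => rk_mono subset_union_left)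
    (U := Finset.univ.filter fun G => blk G = P) (A := A₁) (g := G) hne
    (fun a ha => Finset.mem_filter.2 ⟨Finset.mem_univ _, (Finset.mem_filter.1 ha).2⟩)
    (Finset.mem_filter.2 ⟨Finset.mem_univ _, rfl⟩) (by
      intro B hGB I hI
      unfold unionRk
      congr 2
      refine subset_antisymm (iUnion₂_subset fun H hH => ?_) (iUnion₂_subset fun H hH =>
        subset_biUnion_of_mem (u := fun G : 𝒢 => G.1) (Finset.mem_union_left _ hH))
      obtain hH | hH := Finset.mem_union.1 hH
      · exact subset_biUnion_of_mem (u := fun G : 𝒢 => G.1) hH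
      · exact (hAG H (hA₁A (hI hH))).trans (subset_biUnion_of_mem (u := fun G : 𝒢 => G.1) hGB))
    (by
      intro B hB
      refine le_antisymm ?_ (rk_mono (union_subset_union_right _ (iUnion₂_subset fun H hH =>
        subset_biUnion_of_mem (u := fun G : 𝒢 => G.1) (Finset.mem_insert_of_mem hH))))
      unfold unionRk
      rw [← rk_closure (J ∪ ⋃ G ∈ B, G.1)]
      have hself := M.subset_closure _ (hUE B)
      have hGcl : G.1 ⊆ M.closure (J ∪ ⋃ G ∈ B, G.1) := by
        refine hjoin.trans (join_subset (M.isFlat_closure _) ?_)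
        rintro _ ⟨a, ha, rfl⟩
        refine subset_trans ?_ hself
        by_cases hab : blk a = P
        · exact (subset_biUnion_of_mem (u := fun G : 𝒢 => G.1)
            (hB (Finset.mem_filter.2 ⟨ha, hab⟩))).trans subset_union_right
        · exact (hlow a ha hab).trans subset_union_left
      refine rk_mono (union_subset (subset_union_left.trans hself) (iUnion₂_subset fun H hH => ?_))
      obtain rfl | hH := Finset.mem_insert.1 hH
      · exact hGcl
      · exact (subset_biUnion_of_mem (u := fun G : 𝒢 => G.1) hH).trans
          (subset_union_right.trans hself)) n
  have hcardI : ∀ I ⊆ A₁, I.card + (A₁ \ I).card = A₁.card := fun I hI => by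
    rw [Finset.card_sdiff_of_subset hI]
    have := Finset.card_le_card hI
    omega
  have hgood : ∀ I ⊆ A₁.erase i, (IsGood M T blk m (expansionExponent n A₁ G I) ↔
      IsGood M T blk m (expansionExponent n A₁ G (insert i I))) := by
    intro I hI
    have hIA : I ⊆ A₁ := hI.trans (Finset.erase_subset _ _)
    have hIA' : insert i I ⊆ A₁ := Finset.insert_subset hi hIA
    refine forall_congr' fun Q => ?_
    by_cases hQ : Q = P
    · subst hQ
      refine and_congr ?_ (hpair I hI)
      rw [sum_expansionExponent, sum_expansionExponent]
      have hGU : G ∈ Finset.univ.filter fun G => blk G = P :=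
        Finset.mem_filter.2 ⟨Finset.mem_univ _, rfl⟩
      have hU : A₁ ⊆ Finset.univ.filter fun G => blk G = P := fun a ha =>
        Finset.mem_filter.2 ⟨Finset.mem_univ _, (Finset.mem_filter.1 ha).2⟩
      rw [Finset.inter_eq_right.2 (hIA.trans hU), Finset.inter_eq_right.2 (hIA'.trans hU),
        if_pos hGU, if_pos hGU, add_assoc, add_assoc,
        hcardI I hIA, hcardI _ hIA']
    · have heq : ∀ x, blk x = Q →
          expansionExponent n A₁ G I x = expansionExponent n A₁ G (insert i I) x := by
        intro x hx
        have hxA : x ∉ A₁ := fun hxA => hQ (hx.symm.trans (Finset.mem_filter.1 hxA).2)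
        have hxG : x ≠ G := fun hxG => hQ (hx.symm.trans (hxG ▸ rfl))
        simp only [expansionExponent, if_neg hxG, if_neg fun hxI => hxA (hIA hxI),
          if_neg fun hxI => hxA (hIA' hxI)]
      have hsum : ∀ B ⊆ Finset.univ.filter fun G => blk G = Q,
          ∑ x ∈ B, expansionExponent n A₁ G I x =
            ∑ x ∈ B, expansionExponent n A₁ G (insert i I) x := fun B hB =>
        Finset.sum_congr rfl fun x hx => heq x (Finset.mem_filter.1 (hB hx)).2
      refine and_congr (by rw [hsum _ Finset.Subset.rfl]) (forall₂_congr fun B hB => ?_)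
      rw [hsum B hB]
  have hterm : ∀ I, (∏ a ∈ I, X a) * (∏ a ∈ A₁ \ I, -X G) * monomial n (1 : ℤ) =
      (-1) ^ (A₁ \ I).card • monomial
        (n + ∑ a ∈ I, Finsupp.single a 1 + Finsupp.single G (A₁ \ I).card) 1 := by
    intro I
    rw [prod_X_eq_monomial, Finset.prod_const, neg_pow, X_pow_eq_monomial, zsmul_eq_mul]
    push_cast
    have hadd : n + ∑ a ∈ I, Finsupp.single a 1 + Finsupp.single G (A₁ \ I).card =
        ∑ a ∈ I, Finsupp.single a 1 + Finsupp.single G (A₁ \ I).card + n := by abel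
    rw [mul_left_comm, mul_assoc, monomial_mul, monomial_mul, hadd, one_mul, one_mul]
  have hexp : ∀ I, ⇑(n + ∑ a ∈ I, Finsupp.single a 1 + Finsupp.single G (A₁ \ I).card : 𝒢 →₀ ℕ) =
      expansionExponent n A₁ G I := by
    intro I
    funext x
    rw [Finsupp.add_apply, Finsupp.add_apply, sum_single_apply, Finsupp.single_apply,
      expansionExponent]
    simp only [eq_comm]
  simp only [sub_eq_add_neg]
  rw [Finset.prod_add, Finset.sum_mul, map_sum]
  simp only [hterm, map_smul, goodForm_monomial, hexp]
  -- The terms of `I` and `insert i I` have opposite signs and are good simultaneously, so they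
  -- cancel.
  rw [← Finset.insert_erase hi, Finset.sum_powerset_insert (Finset.notMem_erase i A₁),
    Finset.insert_erase hi, ← Finset.sum_add_distrib]
  refine Finset.sum_eq_zero fun I hI => ?_
  rw [Finset.mem_powerset] at hI
  have hIA : I ⊆ A₁ := hI.trans (Finset.erase_subset _ _)
  have hiI : i ∉ I := fun hiI => Finset.notMem_erase i A₁ (hI hiI)
  have hc1 := hcardI I hIA
  have hc2 := hcardI _ (Finset.insert_subset hi hIA)
  rw [Finset.card_insert_of_notMem hiI] at hc2
  have hc3 : (A₁ \ I).card = (A₁ \ insert i I).card + 1 := by omega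
  simp only [hgood I hI]
  rw [hc3, pow_succ]
  split_ifs <;> simp

end Functional

end BuiltMatroid
end

noncomputable section
namespace BuiltMatroid
open Set
set_option linter.unusedSectionVars false

/-! ### Lower bound: linear independence in the Chow ring. -/

section Independence

open MvPolynomial Classical

variable {α : Type*} {M : Matroid α} {𝒢 T : Set (Set α)} [M.Finite] [M.Loopless] [Fintype 𝒢]
  {blk : 𝒢 → 𝒢} {m : 𝒢 → ℕ}

/-- On a finite poset, every function is a sum over upper intervals. -/
lemma exists_sum_Ici_eq {β R : Type*} [PartialOrder β] [Fintype β] [AddCommGroup R] (f : β → R) :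
    ∃ g : β → R, ∀ b, ∑ b' with b ≤ b', g b' = f b := by
  have hwf : WellFounded fun a b : β => b < a := wellFounded_gt
  let g : β → R := hwf.fix fun b rec => f b - ∑ b' : {b' // b < b'}, rec b'.1 b'.2
  refine ⟨g, fun b => ?_⟩
  have hb : g b = f b - ∑ b' : {b' // b < b'}, g b'.1 := hwf.fix_eq _ b
  rw [← Finset.sum_subtype (Finset.univ.filter fun b' => b < b') (by simp) g] at hb
  have hins : (Finset.univ.filter fun b' => b ≤ b') =
      insert b (Finset.univ.filter fun b' => b < b') := by
    ext b'
    simp [le_iff_eq_or_lt, eq_comm]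
  rw [hins, Finset.sum_insert (by simp), hb, sub_add_cancel]

-- The passage from the `x_G` to the `sumAbove` is unitriangular for inclusion, so these can serve
-- as new variables.
variable (𝒢) in
lemma exists_aeval_sumAbove_eq_X :
    ∃ ψ : MvPolynomial 𝒢 ℤ →ₐ[ℤ] MvPolynomial 𝒢 ℤ, ∀ G : 𝒢, ψ (sumAbove 𝒢 G.1) = X G := by
  obtain ⟨ξ, hξ⟩ := exists_sum_Ici_eq (fun G : 𝒢 => (X G : MvPolynomial 𝒢 ℤ))
  refine ⟨aeval ξ, fun G => ?_⟩
  rw [sumAbove, map_sum, ← hξ G]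
  exact Finset.sum_congr rfl fun G' _ => aeval_X ξ G'

lemma sumAbove_sub_sumAbove {a G : Set α} (ha : a ⊆ G) :
    sumAbove 𝒢 a - sumAbove 𝒢 G = ∑ G' : 𝒢 with a ⊆ G'.1 ∧ ¬ G ⊆ G'.1, X G' := by
  rw [sub_eq_iff_eq_add, sumAbove, sumAbove, ← Finset.sum_union]
  · refine Finset.sum_congr ?_ fun _ _ => rfl
    ext G'
    simp only [Finset.mem_union, Finset.mem_filter, Finset.mem_univ, true_and]
    exact ⟨fun h => (Classical.em (G ⊆ G'.1)).symm.imp (fun h' => ⟨h, h'⟩) id,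
      fun h => h.elim And.left ha.trans⟩
  · rw [Finset.disjoint_filter]
    exact fun _ _ h => h.2

/-- The image of the monomial of a non-nested set under the change of variables is in
`goodIdeal`. -/
lemma aeval_monomial_mem_goodIdeal (h : IsBuildingSet M 𝒢) (hT : IsNested M 𝒢 T)
    (hblk : ∀ G : 𝒢, IsLeast {Q ∈ T | G.1 ⊆ Q} (blk G).1)
    {ψ : MvPolynomial 𝒢 ℤ →ₐ[ℤ] MvPolynomial 𝒢 ℤ} (hψ : ∀ G : 𝒢, ψ (sumAbove 𝒢 G.1) = X G)
    (d : 𝒢 →₀ ℕ) (hd : ¬ IsNested M 𝒢 (supportSet d)) :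
    ψ (monomial d 1) ∈ goodIdeal M T blk m := by
  induction hN : d.degree * rk M M.E - Finsupp.weight (fun G : 𝒢 => rk M G.1) d
    using Nat.strong_induction_on generalizing d with
  | _ N ih =>
    obtain ⟨A', hA', hanti, hnt, hmem⟩ : ∃ A ⊆ supportSet d, IsAntichain (· ⊆ ·) A ∧
        A.Nontrivial ∧ join M A ∈ 𝒢 := by
      by_contra! hcon
      exact hd ⟨supportSet_subset d, hcon⟩
    have hA'𝒢 := hA'.trans (supportSet_subset d)
    set A : Finset 𝒢 := Finset.univ.filter fun a => a.1 ∈ A' with hA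
    set G : 𝒢 := ⟨join M A', hmem⟩ with hG
    have hAA' : Subtype.val '' (A : Set 𝒢) = A' := by
      ext a
      simp only [hA, Finset.coe_filter, Finset.mem_univ, true_and, mem_image, mem_ofPred_eq]
      exact ⟨fun ⟨b, hb, hba⟩ => hba ▸ hb, fun ha => ⟨⟨a, hA'𝒢 ha⟩, ha, rfl⟩⟩
    have hAG : ∀ a ∈ A, a.1 ⊆ G.1 := fun a ha =>
      subset_join (h.sUnion_subset_ground hA'𝒢) (Finset.mem_filter.1 ha).2
    have hGa : ∀ a ∈ A, ¬ G.1 ⊆ a.1 := by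
      intro a ha hle
      have haA' := (Finset.mem_filter.1 ha).2
      obtain ⟨b, hb, hba⟩ := hnt.exists_ne a.1
      exact hanti hb haA' hba ((hAG ⟨b, hA'𝒢 hb⟩ (Finset.mem_filter.2 ⟨Finset.mem_univ _, hb⟩)).trans
        hle)
    set s : 𝒢 →₀ ℕ := ∑ a ∈ A, Finsupp.single a 1 with hs
    have hsd : s ≤ d := by
      intro x
      rw [hs, sum_single_apply]
      split_ifs with hx
      · have := mem_supportSet.1 (hA' (Finset.mem_filter.1 hx).2)
        omega
      · exact Nat.zero_le _
    have hkill := Ideal.mul_mem_left (goodIdeal M T blk m) (ψ (monomial (d - s) 1))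
      (prod_X_sub_X_mem_goodIdeal (m := m) h hT hblk hAG (hAA'.symm ▸ Subset.rfl))
    have hprod : ∏ a ∈ A, (X a - X G) = ψ (∏ a ∈ A, (sumAbove 𝒢 a.1 - sumAbove 𝒢 G.1)) := by
      rw [map_prod]
      exact Finset.prod_congr rfl fun a _ => by rw [map_sub, hψ, hψ]
    have hexpand : ∏ a ∈ A, (sumAbove 𝒢 a.1 - sumAbove 𝒢 G.1) =
        ∑ φ ∈ Fintype.piFinset fun a : A => Finset.univ.filter fun G' : 𝒢 =>
          a.1.1 ⊆ G'.1 ∧ ¬ G.1 ⊆ G'.1, monomial (∑ a, Finsupp.single (φ a) 1) 1 := by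
      rw [← Finset.prod_coe_sort, Finset.prod_congr rfl fun a _ =>
        sumAbove_sub_sumAbove (𝒢 := 𝒢) (hAG a.1 a.2), Finset.prod_univ_sum]
      refine Finset.sum_congr rfl fun φ _ => ?_
      rw [monomial_sum_one]
      rfl
    rw [hprod, ← map_mul, hexpand, Finset.mul_sum] at hkill
    simp only [monomial_mul, one_mul] at hkill
    -- The choice `φ(a) = a` reproduces the given monomial. It is allowed because an antichain with
    -- at least two members has no member containing its join.
    have hid : (fun a : A => a.1) ∈ Fintype.piFinset fun a : A => Finset.univ.filter fun G' : 𝒢 =>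
        a.1.1 ⊆ G'.1 ∧ ¬ G.1 ⊆ G'.1 := by
      simp only [Fintype.mem_piFinset, Finset.mem_filter, Finset.mem_univ, true_and]
      exact fun a => ⟨Subset.rfl, hGa a.1 a.2⟩
    rw [← Finset.add_sum_erase _ _ hid, map_add, map_sum] at hkill
    have hds : d - s + ∑ a : A, Finsupp.single a.1 1 = d := by
      rw [Finset.sum_coe_sort A fun a => Finsupp.single a 1]
      exact tsub_add_cancel_of_le hsd
    rw [hds] at hkill
    refine (Submodule.add_mem_iff_left _ (Submodule.sum_mem _ fun φ hφ => ?_)).1 hkill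
    simp only [Finset.mem_erase, Fintype.mem_piFinset, Finset.mem_filter, Finset.mem_univ,
      true_and] at hφ
    obtain ⟨hφne, hφ⟩ := hφ
    have hdeg : (d - s + ∑ a : A, Finsupp.single (φ a) 1).degree = d.degree := by
      conv_rhs => rw [← hds]
      simp only [map_add, map_sum, Finsupp.degree_single]
    have hle : ∀ a : A, rk M a.1.1 ≤ rk M (φ a).1 := fun a => rk_mono (hφ a).1
    obtain ⟨a₀, ha₀⟩ := Function.ne_iff.1 hφne
    have hlt : rk M a₀.1.1 < rk M (φ a₀).1 := rk_lt_rk (h.isFlat _ a₀.1.2)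
      ((hφ a₀).1.ssubset_of_ne fun heq => ha₀ (Subtype.ext heq.symm)) (h.subset_ground (φ a₀).2)
    have hwt : Finsupp.weight (fun G : 𝒢 => rk M G.1) d <
        Finsupp.weight (fun G : 𝒢 => rk M G.1) (d - s + ∑ a : A, Finsupp.single (φ a) 1) := by
      conv_lhs => rw [← hds]
      simp only [map_add, map_sum, Finsupp.weight_single, smul_eq_mul, one_mul]
      exact Nat.add_lt_add_left (Finset.sum_lt_sum (fun a _ => hle a)
        ⟨a₀, Finset.mem_univ _, hlt⟩) _
    have hbound := weight_le h (d - s + ∑ a : A, Finsupp.single (φ a) 1)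
    -- Every other choice enlarges some `a`, so the weight goes up. The support is again not nested:
    -- the join of the chosen sets contains `G`, but none of them does.
    refine ih _ (by rw [hdeg] at hbound ⊢; omega) _ (fun hnest => ?_) rfl
    have hφne : ∀ i, (d - s + ∑ a : A, Finsupp.single (φ a) 1 : 𝒢 →₀ ℕ) (φ i) ≠ 0 := by
      intro i
      rw [Finsupp.add_apply, Finsupp.finsetSum_apply]
      have := Finset.single_le_sum (f := fun j : A => (Finsupp.single (φ j) 1 : 𝒢 →₀ ℕ) (φ i))
        (fun _ _ => Nat.zero_le _) (Finset.mem_univ i)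
      simp only [Finsupp.single_eq_same] at this
      omega
    have hsub : range (fun a => (φ a).1) ⊆
        supportSet (d - s + ∑ a : A, Finsupp.single (φ a) 1) := by
      rintro _ ⟨i, rfl⟩
      exact mem_supportSet.2 (hφne i)
    obtain ⟨_, ⟨i, rfl⟩, hGi⟩ := hnest.exists_subset h hsub G.2 (by
      refine join_subset (isFlat_join M _) fun a ha => ?_
      exact (hφ ⟨⟨a, hA'𝒢 ha⟩, Finset.mem_filter.2 ⟨Finset.mem_univ _, ha⟩⟩).1.trans
        (subset_join (h.sUnion_subset_ground (hsub.trans (supportSet_subset _)))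
          ⟨⟨⟨a, hA'𝒢 ha⟩, Finset.mem_filter.2 ⟨Finset.mem_univ _, ha⟩⟩, rfl⟩))
    exact (hφ i).2 hGi

lemma aeval_mem_goodIdeal (h : IsBuildingSet M 𝒢) (hT : IsNested M 𝒢 T)
    (hblk : ∀ G : 𝒢, IsLeast {Q ∈ T | G.1 ⊆ Q} (blk G).1)
    {ψ : MvPolynomial 𝒢 ℤ →ₐ[ℤ] MvPolynomial 𝒢 ℤ} (hψ : ∀ G : 𝒢, ψ (sumAbove 𝒢 G.1) = X G)
    {p : MvPolynomial 𝒢 ℤ} (hp : p ∈ chowIdeal M 𝒢) : ψ p ∈ goodIdeal M T blk m := by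
  suffices hle : chowIdeal M 𝒢 ≤ (goodIdeal M T blk m).comap ψ.toRingHom from hle hp
  refine Ideal.span_le.2 ?_
  rintro _ (⟨S, hS, rfl⟩ | ⟨x, hx, rfl⟩)
  · rw [prod_X_eq_monomial, SetLike.mem_coe, Ideal.mem_comap]
    refine aeval_monomial_mem_goodIdeal h hT hblk hψ _ ?_
    rwa [supportSet, show (∑ a ∈ S, Finsupp.single a 1 : 𝒢 →₀ ℕ).support = S by
      ext a
      simp [Finsupp.mem_support_iff, sum_single_apply]]
  · have hatom : (∑ᶠ G : {G : 𝒢 // x ∈ G.1}, X G.1 : MvPolynomial 𝒢 ℤ) =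
        sumAbove 𝒢 (M.closure {x}) := by
      rw [finsum_eq_sum_of_fintype, sumAbove]
      refine (Finset.sum_subtype _ (fun G => ?_) (fun G : 𝒢 => (X G : MvPolynomial 𝒢 ℤ))).symm
      simp only [Finset.mem_filter, Finset.mem_univ, true_and]
      exact ⟨fun hG => hG (M.mem_closure_self x hx), fun hG =>
        closure_subset_of_isFlat (h.isFlat _ G.2) (singleton_subset_iff.2 hG)⟩
    rw [hatom, SetLike.mem_coe, Ideal.mem_comap]
    have := hψ ⟨M.closure {x}, h.atom_mem hx⟩
    rw [AlgHom.toRingHom_eq_coe, RingHom.coe_coe, this]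
    exact X_atom_mem_goodIdeal rfl hx

/-- An exponent of Feichtner and Yuzvinsky is good for its own support. -/
lemma IsFYExponent.isGood (h : IsBuildingSet M 𝒢) {m : 𝒢 →₀ ℕ} (hm : IsFYExponent M 𝒢 m)
    (hblk : ∀ G : 𝒢, IsLeast {Q ∈ supportSet m ∪ factors 𝒢 M.E | G.1 ⊆ Q} (blk G).1) :
    IsGood M (supportSet m ∪ factors 𝒢 M.E) blk m m := by
  have hfix : ∀ G : 𝒢, m G ≠ 0 → blk G = G := fun G hG => Subtype.ext
    (((hblk G).2 ⟨Or.inl (mem_supportSet.2 hG), Subset.rfl⟩).antisymm (hblk G).1.2)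
  have hsum : ∀ P, ∀ B : Finset 𝒢, (∀ G ∈ B, blk G = P) → P ∈ B → ∑ G ∈ B, m G = m P :=
    fun P B hB hPB => Finset.sum_eq_single P (fun G hG hGP => by
      by_contra hne
      exact hGP ((hfix G hne).symm.trans (hB G hG))) fun hP => absurd hPB hP
  have hzero : ∀ P, ∀ B : Finset 𝒢, (∀ G ∈ B, blk G = P) → P ∉ B → ∑ G ∈ B, m G = 0 :=
    fun P B hB hPB => Finset.sum_eq_zero fun G hG => by
      by_contra hne
      exact hPB (((hfix G hne).symm.trans (hB G hG)) ▸ hG)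
  intro P
  refine ⟨?_, fun B hB hne => ?_⟩
  · by_cases hP : blk P = P
    · exact hsum P _ (fun G hG => (Finset.mem_filter.1 hG).2) (by simpa using hP)
    · rw [hzero P _ (fun G hG => (Finset.mem_filter.1 hG).2) (by simpa using hP)]
      by_contra hne
      exact hP (hfix P (Ne.symm hne))
  · have hB' : ∀ G ∈ B, blk G = P := fun G hG => (Finset.mem_filter.1 (hB hG)).2
    have hPB : P ∈ B := by
      by_contra hPB
      exact hne (hzero P B hB' hPB)
    rw [hsum P B hB' hPB] at hne ⊢
    have hJ : joinBelow M (supportSet m ∪ factors 𝒢 M.E) P.1 = joinBelow M (supportSet m) P.1 := by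
      unfold joinBelow
      congr 1
      ext Q
      constructor
      · rintro ⟨hQ | hQ, hQP⟩
        · exact ⟨hQ, hQP⟩
        · exact absurd (hQ.2 ⟨P.2, h.subset_ground P.2⟩ hQP.subset) hQP.not_subset
      · exact fun hQ => ⟨Or.inl hQ.1, hQ.2⟩
    rw [hJ]
    have h1 := hm.lt_rk P hne
    have h2 : rk M P.1 ≤ unionRk M (joinBelow M (supportSet m) P.1) B := rk_mono
      ((subset_biUnion_of_mem (u := fun G : 𝒢 => G.1) hPB).trans subset_union_right)
    omega

lemma weight_eq_sum_rk (n : 𝒢 →₀ ℕ) :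
    Finsupp.weight (fun G : 𝒢 => rk M G.1) n = ∑ G, n G * rk M G.1 := by
  rw [Finsupp.weight_eq_sum]
  rfl

/-- A good exponent is the reference exponent, or it has smaller weight. -/
lemma eq_or_weight_lt_of_isGood (h : IsBuildingSet M 𝒢) {m n : 𝒢 →₀ ℕ}
    (hblk : ∀ G : 𝒢, IsLeast {Q ∈ supportSet m ∪ factors 𝒢 M.E | G.1 ⊆ Q} (blk G).1)
    (hn : IsGood M (supportSet m ∪ factors 𝒢 M.E) blk m n) :
    n = m ∨ Finsupp.weight (fun G : 𝒢 => rk M G.1) n <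
      Finsupp.weight (fun G : 𝒢 => rk M G.1) m := by
  -- A good `n` has total `m P` on the block of `P`, so moving its exponents to the tops of their
  -- blocks yields the weight of `m`. A nontrivial move strictly increases the weight.
  have hm : ∑ G, m G * rk M G.1 = ∑ G, n G * rk M (blk G).1 := by
    rw [← Finset.sum_fiberwise Finset.univ blk (fun G => n G * rk M (blk G).1)]
    refine Finset.sum_congr rfl fun P _ => ?_
    rw [← (hn P).1, Finset.sum_mul]
    exact Finset.sum_congr rfl fun G hG => by rw [(Finset.mem_filter.1 hG).2]
  have hle : ∀ G, n G * rk M G.1 ≤ n G * rk M (blk G).1 := fun G =>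
    Nat.mul_le_mul_left _ (rk_mono (hblk G).1.2)
  rw [weight_eq_sum_rk, weight_eq_sum_rk, hm]
  by_cases hall : ∀ G, n G ≠ 0 → blk G = G
  · left
    ext P
    rw [← (hn P).1]
    by_cases hP : blk P = P
    · refine (Finset.sum_eq_single P (fun G hG hGP => ?_) fun hP' => ?_).symm
      · by_contra hne
        exact hGP ((hall G hne).symm.trans (Finset.mem_filter.1 hG).2)
      · exact absurd (by simpa using hP) hP'
    · have h0 : n P = 0 := by
        by_contra hne
        exact hP (hall P hne)
      rw [h0]
      refine (Finset.sum_eq_zero fun G hG => ?_).symm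
      by_contra hne
      have hGP : G = P := (hall G hne).symm.trans (Finset.mem_filter.1 hG).2
      exact hne (hGP ▸ h0)
  · right
    push Not at hall
    obtain ⟨G, hG, hGb⟩ := hall
    refine Finset.sum_lt_sum (fun G _ => hle G) ⟨G, Finset.mem_univ _, ?_⟩
    refine Nat.mul_lt_mul_of_pos_left (rk_lt_rk (h.isFlat _ G.2) ((hblk G).1.2.ssubset_of_ne
      fun heq => hGb (Subtype.ext heq.symm)) (h.subset_ground (blk G).2)) (Nat.pos_of_ne_zero hG)

/-- The product of the powers of the `sumAbove` with the given exponents. -/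
def sumAboveMonomial (d : 𝒢 →₀ ℕ) : MvPolynomial 𝒢 ℤ := ∏ G ∈ d.support, sumAbove 𝒢 G.1 ^ d G

lemma isHomogeneous_sumAboveMonomial (d : 𝒢 →₀ ℕ) : (sumAboveMonomial d).IsHomogeneous d.degree := by
  rw [Finsupp.degree_apply]
  refine IsHomogeneous.prod _ _ _ fun G _ => ?_
  have := (IsHomogeneous.sum (Finset.univ.filter fun G' : 𝒢 => G.1 ⊆ G'.1)
    (fun G' => (X G' : MvPolynomial 𝒢 ℤ)) 1 fun G' _ => isHomogeneous_X ℤ G').pow (d G)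
  rwa [one_mul] at this

/-- The functional attached to the support of `m` reads off goodness after the change of variables.
It kills the ideal, is `1` at `m`, and elsewhere sees only lighter exponents. -/
lemma IsFYExponent.exists_goodForm (h : IsBuildingSet M 𝒢) {m : 𝒢 →₀ ℕ}
    (hm : IsFYExponent M 𝒢 m) :
    ∃ L : MvPolynomial 𝒢 ℤ →ₗ[ℤ] ℤ, (∀ p ∈ chowIdeal M 𝒢, L p = 0) ∧
      L (sumAboveMonomial m) = 1 ∧ ∀ n, L (sumAboveMonomial n) ≠ 0 → n = m ∨
        Finsupp.weight (fun G : 𝒢 => rk M G.1) n < Finsupp.weight (fun G : 𝒢 => rk M G.1) m := by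
  obtain ⟨ψ, hψ⟩ := exists_aeval_sumAbove_eq_X 𝒢
  have hT := hm.isNested.union_factors h
  choose blk hblk using fun G : 𝒢 => hT.exists_least_superset h subset_union_right G.2
  let blk' : 𝒢 → 𝒢 := fun G => ⟨blk G, hT.subset (hblk G).1.1⟩
  have hblk' : ∀ G : 𝒢, IsLeast {Q ∈ supportSet m ∪ factors 𝒢 M.E | G.1 ⊆ Q} (blk' G).1 := hblk
  have hval : ∀ n : 𝒢 →₀ ℕ, ψ (sumAboveMonomial n) = monomial n 1 := by
    intro n
    rw [sumAboveMonomial, map_prod, ← prod_X_pow_eq_monomial]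
    exact Finset.prod_congr rfl fun G _ => by rw [map_pow, hψ]
  refine ⟨(goodForm M (supportSet m ∪ factors 𝒢 M.E) blk' m).comp ψ.toLinearMap,
    fun p hp => ?_, ?_, fun n hn => ?_⟩
  · have := mem_goodIdeal.1 (aeval_mem_goodIdeal (m := m) h hT hblk' hψ hp) 1
    rwa [mul_one] at this
  · rw [LinearMap.comp_apply, AlgHom.toLinearMap_apply, hval, goodForm_monomial,
      if_pos (hm.isGood h hblk')]
  · rw [LinearMap.comp_apply, AlgHom.toLinearMap_apply, hval, goodForm_monomial] at hn
    refine eq_or_weight_lt_of_isGood h hblk' ?_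
    by_contra hbad
    exact hn (if_neg hbad)

lemma linearIndependent_sumAboveMonomial (h : IsBuildingSet M 𝒢) {Φ : Finset (𝒢 →₀ ℕ)}
    (hΦ : ∀ d ∈ Φ, IsFYExponent M 𝒢 d) :
    LinearIndependent ℤ fun d : Φ =>
      Ideal.Quotient.mk (chowIdeal M 𝒢) (sumAboveMonomial d.1) := by
  rw [Fintype.linearIndependent_iff]
  intro c hc
  have hI : ∑ d : Φ, c d • sumAboveMonomial d.1 ∈ chowIdeal M 𝒢 := by
    rw [← Ideal.Quotient.eq_zero_iff_mem, map_sum, ← hc]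
    exact Finset.sum_congr rfl fun d _ => map_zsmul _ _ _
  intro d
  -- Coefficients are eliminated in order of increasing weight: the functional of `d` sees only `d`
  -- and lighter exponents, whose coefficients already vanish.
  induction hN : Finsupp.weight (fun G : 𝒢 => rk M G.1) d.1
    using Nat.strong_induction_on generalizing d with
  | _ N ih =>
    obtain ⟨L, hL, hL1, hL0⟩ := (hΦ d.1 d.2).exists_goodForm h
    have hsum := hL _ hI
    rw [map_sum, Finset.sum_eq_single d] at hsum
    · rwa [map_smul, hL1, smul_eq_mul, mul_one] at hsum
    · intro n _ hnd
      rw [map_smul]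
      by_cases hn : L (sumAboveMonomial n.1) = 0
      · rw [hn, smul_zero]
      · obtain heq | hlt := hL0 n.1 hn
        · exact absurd (Subtype.ext heq) hnd
        · rw [ih _ (hN ▸ hlt) n rfl, zero_smul]
    · exact fun hd => absurd (Finset.mem_univ d) hd

end Independence

/-- The rank of the degree `k` piece of the Chow ring is the number of exponents of Feichtner and
Yuzvinsky of degree `k`. -/
lemma finrank_chowPiece {α : Type*} {M : Matroid α} {𝒢 : Set (Set α)} [M.Finite] [M.Loopless]
    (h : IsBuildingSet M 𝒢) (k : ℕ) : Module.finrank ℤ (chowPiece M 𝒢 k) =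
      {d : 𝒢 →₀ ℕ | IsFYExponent M 𝒢 d ∧ d.degree = k}.ncard := by
  have := h.finite.fintype
  have hfin := finite_exponents (M := M) (𝒢 := 𝒢) k
  refine (finrank_chowPiece_le h k).antisymm ?_
  have := finite_chowPiece h k
  have hli := linearIndependent_sumAboveMonomial h (Φ := hfin.toFinset) fun d hd =>
    (hfin.mem_toFinset.1 hd).1
  let v : hfin.toFinset → chowPiece M 𝒢 k := fun d =>
    ⟨Ideal.Quotient.mk (chowIdeal M 𝒢) (sumAboveMonomial d.1), sumAboveMonomial d.1,
      (MvPolynomial.mem_homogeneousSubmodule k _).2 (by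
        have hd := isHomogeneous_sumAboveMonomial d.1
        rwa [(hfin.mem_toFinset.1 d.2).2] at hd), rfl⟩
  have hv : LinearIndependent ℤ v := LinearIndependent.of_comp (chowPiece M 𝒢 k).subtype hli
  have hcard := hv.fintype_card_le_finrank
  rwa [Fintype.card_coe, ← ncard_eq_toFinset_card _ hfin] at hcard

end BuiltMatroid
end

theorem theorem1p2 {α : Type*} [LinearOrder α] (M : Matroid α) [M.Finite] [M.Loopless]
    (𝒢 : Set (Set α)) (h𝒢 : BuiltMatroid.IsBuildingSet M 𝒢)
    (hcomplete : BuiltMatroid.IsComplete M 𝒢) :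
    BuiltMatroid.IsSimplicialComplexOn
        (⋃₀ BuiltMatroid.gammaComplex M 𝒢) (BuiltMatroid.gammaComplex M 𝒢) ∧
      ⋃₀ BuiltMatroid.gammaComplex M 𝒢 ⊆ BuiltMatroid.gammaVertices M 𝒢 ∧
      (M.E ∈ 𝒢 → ⋃₀ BuiltMatroid.gammaComplex M 𝒢 = BuiltMatroid.gammaVertices M 𝒢) ∧
      ∃ H : Polynomial ℤ, (H : PowerSeries ℤ) = BuiltMatroid.chowSeries M 𝒢 ∧
        BuiltMatroid.IsGammaVector H
          (fun i => (BuiltMatroid.fNumber (BuiltMatroid.gammaComplex M 𝒢) i : ℤ)) :=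
  ⟨BuiltMatroid.isSimplicialComplexOn_gammaComplex hcomplete h𝒢,
    BuiltMatroid.sUnion_gammaComplex_subset h𝒢,
    fun hE => (BuiltMatroid.sUnion_gammaComplex_subset h𝒢).antisymm
      (BuiltMatroid.gammaVertices_subset hcomplete h𝒢 hE),
    BuiltMatroid.exists_isGammaVector hcomplete h𝒢 (BuiltMatroid.finrank_chowPiece h𝒢)⟩
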